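/- **Conventions.** An $n$-dimensional manifold with corners is a second countable Hausdorff space with a maximal atlas of charts onto open subsets of $\mathbb R^n_k=[0,\infty)^k\times\mathbb R^{n-k}$ ($n$ fixed, $k$ may vary) with smooth transition maps. The depth of a point is the number of its vanishing coordinates among the first $k$; $X$ has no boundary ($\partial X=\emptyset$) if all depths are $0$. A map $f$ is *smooth* (in the sense of Joyce) if it is $C^\infty$ in charts and, near each point $x$, for charts in which $u_i\ge0$ and $f_j\ge 0$ are the boundary coordinates at $x$ and $f(x)$, each $f_j$ is either $F_j\cdot\prod_i u_i^{a_{j,i}}$ with $F_j>0$ smooth and $a_{j,i}\in\mathbb N$, or identically $0$. It is *simple* if the second alternative does not occur and each $u_i$ occurs in exactly one $f_j$, with exponent $1$; it is *perfectly simple* if it is simple and preserves depth; it is *étale* if it is a local diffeomorphism. A *proper étale groupoid* $X_\bullet$ is a groupoid $X_2\xrightarrow{m}X_1\rightrightarrows X_0$ (with $X_2=X_1\times_{t,X_0,s}X_1$, source $s$, target $t$, units $e$, inverse $i$, composition $m$) in manifolds with corners, whose structure maps are étale and for which $s\times t:X_1\to X_0\times X_0$ is proper. Smooth functors are the 1-cells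 and smooth natural transformations the 2-cells of a bicategory. A *refinement* is a smooth functor $F_\bullet$ which is an equivalence of categories and for which $F_0$ is étale. $\mathbf{PEG}^c_{ps}$ is the bicategory of proper étale groupoids with corners, smooth functors with $F_0$ perfectly simple, and all smooth natural transformations. Let $X$ be a manifold without boundary. A *hyper subset* $E\subset X$ is the image of a *hyper map*, i.e. a proper immersion $h:W\to X$ of codimension one from a manifold without boundary such that for every $x\in X$ the map $\bigoplus_{w\in h^{-1}(x)}\ker(dh_w^\vee)\to T_x^\vee X$ is injective (the empty manifold is regarded as having every dimension). A smooth map $f:Y\to X$ of manifolds without boundary is *multi-transverse* to $E$ if, for some hyper map $h$ with image $E$, $f$ is transverse to $h$ and the pullback $Y\times_XW\to Y$ again satisfies this injectivity condition. $\mathbf{PEG}^+_{\partial=\emptyset}$ is the bicategory whose objects are pairs $(X_\bullet,E)$ of a proper étale groupoid without boundary and a hyper subset $E\subset X_0$ with $s^{-1}E=t^{-1}E$, whose 1-cells $(X_\bullet,E)\to(Y_\bullet,E')$ are the smooth functors $F$ such that $F_0$ is multi-transverse to $E'$ and $F_0^{-1}E'=E$, and whose 2-cells are all smooth natural transformations.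 For $E\subset X$ a hyper subset, the *blowup* is the set $$B(X,E)=\bigcup_{x\in X}\{x\}\times\lim_{x\in V\subset X}\pi_0^x(V\setminus E),$$ where $V$ runs over the open neighbourhoods of $x$ and $\pi_0^x(V\setminus E)$ is the set of connected components of $V\setminus E$ with $x$ in their closure. It carries the topology generated by the sets of all germs which are based at points of an open set $V$ and whose component in $V\setminus E$ is a given one, and the structure of a manifold with corners on this topological space for which $\beta_{(X,E)}:B(X,E)\to X$ is *rectilinear*: injective on the points of depth $0$ and, in suitable charts centred at any $c$ and at $\beta(c)$, the restriction of the inclusion $\mathbb R^n_k\subset\mathbb R^n$. A map $f:Y\to X$ which is multi-transverse to $E$ induces $B(f):B(Y,f^{-1}E)\to B(X,E)$. **Theorem (hyperplane blowup of orbifolds).** $B$ extends to a strict 2-functor $$B:\mathbf{PEG}^+_{\partial=\emptyset}\to\mathbf{PEG}^c_{ps}$$ which takes $(X_\bullet,E)$ to the groupoid with manifolds of objects, arrows and composable arrows $B(X_0,E)$, $B(X_1,s^{-1}E)$, $B(X_2,p_1^{-1}E)$ (where $p_1:X_2\to X_0$ is the first object of a composable pair) and structure maps $B(s),B(t),B(e),B(i),B(m)$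 (and projections $X_2\to X_1$ blown up likewise), takes a 1-cell $(F_0,F_1)$ to $(B(F_0),B(F_1))$ and a 2-cell $\alpha:X_0\to Y_1$ to $B(\alpha)$. The maps $\beta$ constitute a strict natural transformation $B(X_\bullet)\to X_\bullet$ (of 2-functors to the 2-category of groupoids in manifolds with corners). This 2-functor takes refinements to refinements. Hence there is an induced functor $B:\mathbf{Orb}^+_{\partial=\emptyset}\to\mathbf{Orb}^c_{ps}$ between the 2-localizations of these bicategories at the refinements: a pseudofunctor which commutes, up to equivalence of pseudofunctors, with $B$ and the two localization functors. -/

import Mathlib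

open CategoryTheory Set Topology
open scoped Manifold ContDiff

noncomputable section

namespace HyperBlowup

/-! ### Manifolds with corners -/

/-- A manifold with corners: a second countable Hausdorff space with a smooth atlas modelled on
the quadrant `[0,∞)ⁿ`.  (Open subsets of `[0,∞)ᵏ × ℝⁿ⁻ᵏ` are diffeomorphic to open subsets of
`[0,∞)ⁿ`, so that charts in all `[0,∞)ᵏ × ℝⁿ⁻ᵏ` are accounted for.) -/
structure ManC where
  carrier : Type
  dim : ℕ
  [top : TopologicalSpace carrier]
  [t2 : T2Space carrier]
  [secondCountable : SecondCountableTopology carrier]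
  [charted : ChartedSpace (EuclideanQuadrant dim) carrier]
  [isManifold : IsManifold (modelWithCornersEuclideanQuadrant dim) ∞ carrier]

namespace ManC

instance : CoeSort ManC Type := ⟨ManC.carrier⟩

attribute [instance] top t2 secondCountable charted isManifold

/-- The vector space `ℝⁿ`, `n = dim X`. -/
abbrev Vec (X : ManC) : Type := EuclideanSpace ℝ (Fin X.dim)

/-- The model with corners of a manifold with corners. -/
abbrev model (X : ManC) : ModelWithCorners ℝ X.Vec (EuclideanQuadrant X.dim) :=
  modelWithCornersEuclideanQuadrant X.dim

/-- `X.coord x y i` is the `i`-th coordinate of `y` in the preferred chart at `x`. -/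
def coord (X : ManC) (x y : X) (i : Fin X.dim) : ℝ :=
  (chartAt (EuclideanQuadrant X.dim) x y).1 i

/-- The depth of a point: the number of its vanishing coordinates. -/
def depth (X : ManC) (x : X) : ℕ := {i | X.coord x x i = 0}.ncard

/-- A manifold without boundary. -/
def IsBoundaryless (X : ManC) : Prop := ∀ x : X, X.depth x = 0

/-- Near `x`, the function `g` is of the form `G · u₁^{a₁} ⋯ uₙ^{aₙ}` with `G` smooth and positive,
where `u` are the coordinates of the chart at `x`, and where only coordinates that vanish at `x`
occur. -/
def IsMonomialAt (X : ManC) (x : X) (g : X → ℝ) (a : Fin X.dim → ℕ) : Prop :=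
  (∀ i, X.coord x x i ≠ 0 → a i = 0) ∧
  ∃ (G : X → ℝ) (U : Set X), IsOpen U ∧ x ∈ U ∧ ContMDiffOn X.model 𝓘(ℝ, ℝ) ∞ G U ∧
    ∀ y ∈ U, 0 < G y ∧ g y = G y * ∏ i, X.coord x y i ^ a i

lemma coord_nonneg (X : ManC) (x y : X) (i : Fin X.dim) : 0 ≤ X.coord x y i :=
  (chartAt (EuclideanQuadrant X.dim) x y).2 i

lemma contMDiffOn_coord (X : ManC) (x : X) (i : Fin X.dim) :
    ContMDiffOn X.model 𝓘(ℝ, ℝ) ∞ (fun y => X.coord x y i)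
      (chartAt (EuclideanQuadrant X.dim) x).source := by
  have h : ContMDiffOn X.model 𝓘(ℝ, X.Vec) ∞ (extChartAt X.model x)
      (chartAt (EuclideanQuadrant X.dim) x).source := contMDiffOn_extChartAt
  have h2 : ContMDiff 𝓘(ℝ, X.Vec) 𝓘(ℝ, ℝ) ∞ (EuclideanSpace.proj (𝕜 := ℝ) i : X.Vec →L[ℝ] ℝ) :=
    (EuclideanSpace.proj (𝕜 := ℝ) i : X.Vec →L[ℝ] ℝ).contMDiff
  exact h2.comp_contMDiffOn h

section Monomial

variable {X : ManC} {x : X}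

lemma IsMonomialAt.congr {g g' : X → ℝ} {a : Fin X.dim → ℕ} (h : X.IsMonomialAt x g a)
    (hg : ∀ᶠ y in 𝓝 x, g' y = g y) : X.IsMonomialAt x g' a := by
  obtain ⟨ha, G, U, hU, hx, hG, hy⟩ := h
  obtain ⟨V, hV, hVo, hxV⟩ := eventually_nhds_iff.1 hg
  refine ⟨ha, G, U ∩ V, hU.inter hVo, ⟨hx, hxV⟩, hG.mono inter_subset_left, fun y hyUV => ?_⟩
  exact ⟨(hy y hyUV.1).1, by rw [hV y hyUV.2]; exact (hy y hyUV.1).2⟩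

lemma isMonomialAt_of_pos {G : X → ℝ} {U : Set X} (hU : IsOpen U) (hx : x ∈ U)
    (hG : ContMDiffOn X.model 𝓘(ℝ, ℝ) ∞ G U) (hpos : ∀ y ∈ U, 0 < G y) :
    X.IsMonomialAt x G 0 :=
  ⟨fun _ _ => rfl, G, U, hU, hx, hG, fun y hy => ⟨hpos y hy, by simp⟩⟩

lemma isMonomialAt_one : X.IsMonomialAt x (fun _ => 1) 0 :=
  isMonomialAt_of_pos isOpen_univ (mem_univ x) contMDiffOn_const (fun _ _ => one_pos)

lemma IsMonomialAt.mul {g g' : X → ℝ} {a a' : Fin X.dim → ℕ} (h : X.IsMonomialAt x g a)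
    (h' : X.IsMonomialAt x g' a') : X.IsMonomialAt x (fun y => g y * g' y) (a + a') := by
  obtain ⟨ha, G, U, hU, hx, hG, hy⟩ := h
  obtain ⟨ha', G', U', hU', hx', hG', hy'⟩ := h'
  refine ⟨fun i hi => by simp [ha i hi, ha' i hi], fun y => G y * G' y, U ∩ U', hU.inter hU',
    ⟨hx, hx'⟩, (hG.mono inter_subset_left).mul (hG'.mono inter_subset_right), fun y hyU => ?_⟩
  refine ⟨mul_pos (hy y hyU.1).1 (hy' y hyU.2).1, ?_⟩
  simp only [(hy y hyU.1).2, (hy' y hyU.2).2, Pi.add_apply, pow_add, Finset.prod_mul_distrib]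
  ring

lemma IsMonomialAt.pow {g : X → ℝ} {a : Fin X.dim → ℕ} (h : X.IsMonomialAt x g a) (k : ℕ) :
    X.IsMonomialAt x (fun y => g y ^ k) (k • a) := by
  induction k with
  | zero => simpa using isMonomialAt_one
  | succ k ih => simpa [pow_succ, add_smul] using ih.mul h

lemma IsMonomialAt.prod {ι : Type} (s : Finset ι) {g : ι → X → ℝ} {a : ι → Fin X.dim → ℕ}
    (h : ∀ j ∈ s, X.IsMonomialAt x (g j) (a j)) :
    X.IsMonomialAt x (fun y => ∏ j ∈ s, g j y) (∑ j ∈ s, a j) := by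
  classical
  induction s using Finset.induction_on with
  | empty => simpa using isMonomialAt_one
  | insert j s hj ih =>
    simp only [Finset.prod_insert hj, Finset.sum_insert hj]
    exact (h j (Finset.mem_insert_self j s)).mul
      (ih fun k hk => h k (Finset.mem_insert_of_mem hk))

lemma IsMonomialAt.comp {Y : ManC} {f : X → Y} (hf : ContMDiff X.model Y.model ∞ f)
    {g : Y → ℝ} {b : Fin Y.dim → ℕ} (hg : Y.IsMonomialAt (f x) g b)
    {a : Fin Y.dim → Fin X.dim → ℕ}
    (ha : ∀ j, b j ≠ 0 → X.IsMonomialAt x (fun y => Y.coord (f x) (f y) j) (a j)) :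
    X.IsMonomialAt x (fun y => g (f y)) (∑ j, b j • a j) := by
  obtain ⟨_, G, V, hV, hxV, hG, hy⟩ := hg
  have h1 : X.IsMonomialAt x (fun y => G (f y)) 0 :=
    isMonomialAt_of_pos (hV.preimage hf.continuous) hxV
      (hG.comp hf.contMDiffOn fun _ h => h) (fun y h => (hy _ h).1)
  have h2 : X.IsMonomialAt x (fun y => ∏ j, Y.coord (f x) (f y) j ^ b j) (∑ j, b j • a j) := by
    refine IsMonomialAt.prod _ fun j _ => ?_
    by_cases hb : b j = 0
    · simpa [hb] using isMonomialAt_one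
    · exact (ha j hb).pow (b j)
  have h3 := h1.mul h2
  rw [zero_add] at h3
  refine h3.congr ?_
  filter_upwards [(hV.preimage hf.continuous).mem_nhds hxV] with y h using (hy _ h).2

lemma isMonomialAt_coord (x : X) (j : Fin X.dim) :
    X.IsMonomialAt x (fun y => X.coord x y j) (if X.coord x x j = 0 then Pi.single j 1 else 0) := by
  split_ifs with h
  · refine ⟨fun i hi => ?_, fun _ => 1, univ, isOpen_univ, mem_univ x, contMDiffOn_const,
      fun y _ => ⟨one_pos, ?_⟩⟩
    · by_cases hij : i = j
      · exact absurd (hij ▸ h) hi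
      · simp [hij]
    · rw [one_mul, Finset.prod_eq_single j]
      · simp
      · intro i _ hij; simp [hij]
      · simp
  · have hc := X.contMDiffOn_coord x j
    have ho : IsOpen ((chartAt (EuclideanQuadrant X.dim) x).source ∩
        (fun y => X.coord x y j) ⁻¹' Ioi 0) :=
      hc.continuousOn.isOpen_inter_preimage (chartAt _ x).open_source isOpen_Ioi
    exact isMonomialAt_of_pos ho ⟨mem_chart_source _ x, lt_of_le_of_ne (X.coord_nonneg x x j)
      (Ne.symm h)⟩ (hc.mono inter_subset_left) (fun y hy => hy.2)

end Monomial

/-- A weakly smooth map is *smooth* if each of its coordinate functions is, near each point,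
either a monomial times a positive smooth function or identically zero. -/
structure Hom (X Y : ManC) where
  toFun : X → Y
  weaklySmooth : ContMDiff X.model Y.model ∞ toFun
  smooth : ∀ (x : X) (j : Fin Y.dim),
    (∃ a, X.IsMonomialAt x (fun y => Y.coord (toFun x) (toFun y) j) a) ∨
      ∀ᶠ y in 𝓝 x, Y.coord (toFun x) (toFun y) j = 0

/-- The category of manifolds with corners and smooth maps. -/
instance : Category ManC where
  Hom := Hom
  id X :=
    { toFun := id
      weaklySmooth := contMDiff_id
      smooth := fun x j => Or.inl ⟨_, isMonomialAt_coord x j⟩ }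
  comp {X Y Z} f g :=
    { toFun := g.toFun ∘ f.toFun
      weaklySmooth := g.weaklySmooth.comp f.weaklySmooth
      smooth := fun x k => by
        rcases g.smooth (f.toFun x) k with ⟨b, hb⟩ | h0
        · by_cases hz : ∃ j, b j ≠ 0 ∧ ∀ᶠ y in 𝓝 x, Y.coord (f.toFun x) (f.toFun y) j = 0
          · right
            obtain ⟨j, hbj, hj⟩ := hz
            obtain ⟨_, G, V, hV, hxV, _, hy⟩ := hb
            filter_upwards [hj, (hV.preimage f.weaklySmooth.continuous).mem_nhds hxV] with y h1 h2
            refine (hy _ h2).2.trans ?_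
            rw [Finset.prod_eq_zero (Finset.mem_univ j) (by rw [h1, zero_pow hbj]), mul_zero]
          · left
            have ha : ∀ j, ∃ a, b j ≠ 0 →
                X.IsMonomialAt x (fun y => Y.coord (f.toFun x) (f.toFun y) j) a := by
              intro j
              rcases f.smooth x j with ⟨a, ha⟩ | h0
              · exact ⟨a, fun _ => ha⟩
              · exact ⟨0, fun hb => absurd ⟨j, hb, h0⟩ hz⟩
            choose a ha using ha
            exact ⟨_, hb.comp f.weaklySmooth ha⟩
        · right
          exact f.weaklySmooth.continuous.continuousAt.eventually h0 }

instance {X Y : ManC} : CoeFun (X ⟶ Y) (fun _ => X → Y) := ⟨fun f => Hom.toFun f⟩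

@[ext] lemma hom_ext {X Y : ManC} {f g : X ⟶ Y} (h : ∀ x, f x = g x) : f = g := by
  have h' : ∀ f g : Hom X Y, f.toFun = g.toFun → f = g := by
    rintro ⟨f, _, _⟩ ⟨g, _, _⟩ rfl
    rfl
  exact h' f g (funext h)

@[simp] lemma id_apply {X : ManC} (x : X) : (𝟙 X : X ⟶ X) x = x := rfl

@[simp] lemma comp_apply {X Y Z : ManC} (f : X ⟶ Y) (g : Y ⟶ Z) (x : X) :
    (f ≫ g) x = g (f x) := rfl

lemma contMDiff {X Y : ManC} (f : X ⟶ Y) : ContMDiff X.model Y.model ∞ f := Hom.weaklySmooth f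

lemma continuous {X Y : ManC} (f : X ⟶ Y) : Continuous f := (contMDiff f).continuous

/-- An étale map: a local diffeomorphism. -/
def IsEtale {X Y : ManC} (f : X ⟶ Y) : Prop := IsLocalDiffeomorph X.model Y.model ∞ f

/-- A simple map: all coordinate functions of `f` are of the form `f_j = F_j · ∏ᵢ uᵢ^{a_{j,i}}` with
`F_j > 0` (that is, `f` is interior) and each coordinate `uᵢ` vanishing at `x` occurs in exactly
one `f_j`, with exponent one. -/
def IsSimple {X Y : ManC} (f : X ⟶ Y) : Prop :=
  ∀ x : X, ∃ a : Fin Y.dim → Fin X.dim → ℕ,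
    (∀ j, X.IsMonomialAt x (fun y => Y.coord (f x) (f y) j) (a j)) ∧
    ∀ i, X.coord x x i = 0 → ∃ j, a j i = 1 ∧ ∀ j', j' ≠ j → a j' i = 0

/-- A perfectly simple map: a simple map which preserves the depth of points. -/
def IsPerfectlySimple {X Y : ManC} (f : X ⟶ Y) : Prop :=
  IsSimple f ∧ ∀ x : X, Y.depth (f x) = X.depth x

lemma IsPerfectlySimple.id (X : ManC) : IsPerfectlySimple (𝟙 X) := by
  refine ⟨fun x => ⟨fun j => if X.coord x x j = 0 then Pi.single j 1 else 0,
    fun j => isMonomialAt_coord x j, fun i hi => ⟨i, by simp [hi], fun j' hj' => ?_⟩⟩,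
    fun x => rfl⟩
  dsimp only
  split_ifs
  · simp [hj'.symm]
  · rfl

lemma IsPerfectlySimple.comp {X Y Z : ManC} {f : X ⟶ Y} {g : Y ⟶ Z} (hf : IsPerfectlySimple f)
    (hg : IsPerfectlySimple g) : IsPerfectlySimple (f ≫ g) := by
  refine ⟨fun x => ?_, fun x => (hg.2 (f x)).trans (hf.2 x)⟩
  obtain ⟨a, ha, ha'⟩ := hf.1 x
  obtain ⟨b, hb, hb'⟩ := hg.1 (f x)
  refine ⟨fun k => ∑ j, b k j • a j, fun k => (hb k).comp (contMDiff f) fun j _ => ha j,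
    fun i hi => ?_⟩
  obtain ⟨j, hj1, hj0⟩ := ha' i hi
  have hsum : ∀ k, (∑ j, b k j • a j) i = b k j := by
    intro k
    rw [Finset.sum_apply, Finset.sum_eq_single j]
    · simp [hj1]
    · intro j' _ hj'
      simp [hj0 j' hj']
    · simp
  have hfj : Y.coord (f x) (f x) j = 0 := by
    obtain ⟨_, G, U, _, hx, _, hy⟩ := ha j
    refine (hy x hx).2.trans ?_
    rw [Finset.prod_eq_zero (Finset.mem_univ i) (by rw [hi, hj1, pow_one]), mul_zero]
  obtain ⟨k, hk1, hk0⟩ := hb' j hfj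
  exact ⟨k, (hsum k).trans hk1, fun k' hk' => (hsum k').trans (hk0 k' hk')⟩

end ManC

/-! ### Groupoids internal to a category, functors and transformations -/

section InternalGroupoids

universe v u

/-- The diagram `X₂ ⟶ X₁ ⇉ X₀` underlying a groupoid: `s`, `t` are source and target, `e` the
units, `i` the inversion, `X₂ = X₁ ×_{t,s} X₁` is the object of composable arrows, with
projections `p` and `q`, and `m` is the composition. -/
structure GroupoidData (C : Type u) [Category.{v} C] where
  X0 : C
  X1 : C
  X2 : C
  s : X1 ⟶ X0
  t : X1 ⟶ X0
  e : X0 ⟶ X1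
  i : X1 ⟶ X1
  p : X2 ⟶ X1
  q : X2 ⟶ X1
  m : X2 ⟶ X1
  isPullback : IsPullback p q t s
  e_s : e ≫ s = 𝟙 X0
  e_t : e ≫ t = 𝟙 X0
  i_s : i ≫ s = t
  i_t : i ≫ t = s
  m_s : m ≫ s = p ≫ s
  m_t : m ≫ t = q ≫ t

variable {C : Type u} [Category.{v} C]

/-- The composition (in diagrammatic order) of composable families of arrows `a`, `b`
parametrized by `T`. -/
def GroupoidData.mul (X : GroupoidData C) {T : C} (a b : T ⟶ X.X1) (h : a ≫ X.t = b ≫ X.s) :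
    T ⟶ X.X1 :=
  X.isPullback.lift a b h ≫ X.m

/-- The groupoid axioms: unit laws, inverses, associativity.  They are stated for families of
arrows parametrized by arbitrary objects `T`. -/
structure GroupoidData.IsGroupoid (X : GroupoidData C) : Prop where
  unit_mul : ∀ {T : C} (a : T ⟶ X.X1), X.mul (a ≫ X.s ≫ X.e) a (by simp [X.e_t]) = a
  mul_unit : ∀ {T : C} (a : T ⟶ X.X1), X.mul a (a ≫ X.t ≫ X.e) (by simp [X.e_s]) = a
  mul_inv : ∀ {T : C} (a : T ⟶ X.X1), X.mul a (a ≫ X.i) (by simp [X.i_s]) = a ≫ X.s ≫ X.e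
  inv_mul : ∀ {T : C} (a : T ⟶ X.X1), X.mul (a ≫ X.i) a (by simp [X.i_t]) = a ≫ X.t ≫ X.e
  assoc : ∀ {T : C} (a b c : T ⟶ X.X1) (hab : a ≫ X.t = b ≫ X.s) (hbc : b ≫ X.t = c ≫ X.s),
    X.mul (X.mul a b hab) c (by simp [GroupoidData.mul, X.m_t, hbc]) =
      X.mul a (X.mul b c hbc) (by simp [GroupoidData.mul, X.m_s, hab])

/-- A groupoid internal to `C`. -/
structure Gpd (C : Type u) [Category.{v} C] extends GroupoidData C where
  isGroupoid : toGroupoidData.IsGroupoid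

namespace Gpd

/-- Composition of families of arrows. -/
def mul (X : Gpd C) {T : C} (a b : T ⟶ X.X1) (h : a ≫ X.t = b ≫ X.s) : T ⟶ X.X1 :=
  X.toGroupoidData.mul a b h

variable {X Y Z : Gpd C}

lemma mul_s {T : C} (a b : T ⟶ X.X1) (h : a ≫ X.t = b ≫ X.s) :
    X.mul a b h ≫ X.s = a ≫ X.s := by
  simp [mul, GroupoidData.mul, X.m_s]

lemma mul_t {T : C} (a b : T ⟶ X.X1) (h : a ≫ X.t = b ≫ X.s) :
    X.mul a b h ≫ X.t = b ≫ X.t := by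
  simp [mul, GroupoidData.mul, X.m_t]

lemma comp_mul {S T : C} (f : S ⟶ T) (a b : T ⟶ X.X1) (h : a ≫ X.t = b ≫ X.s) :
    f ≫ X.mul a b h = X.mul (f ≫ a) (f ≫ b) (by simp [h]) := by
  have : f ≫ X.isPullback.lift a b h = X.isPullback.lift (f ≫ a) (f ≫ b) (by simp [h]) :=
    X.isPullback.hom_ext (by simp) (by simp)
  simp [mul, GroupoidData.mul, ← this]

lemma mul_congr {T : C} {a a' b b' : T ⟶ X.X1} (ha : a = a') (hb : b = b')
    (h : a ≫ X.t = b ≫ X.s) : X.mul a b h = X.mul a' b' (by rw [← ha, ← hb, h]) := by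
  subst ha; subst hb; rfl

lemma mul_assoc' {T : C} (a b c : T ⟶ X.X1) (hab : a ≫ X.t = b ≫ X.s)
    (hbc : b ≫ X.t = c ≫ X.s) :
    X.mul (X.mul a b hab) c (by rw [mul_t, hbc]) = X.mul a (X.mul b c hbc) (by rw [mul_s, hab]) :=
  X.isGroupoid.assoc a b c hab hbc

lemma unit_mul' {T : C} (a : T ⟶ X.X1) (u : T ⟶ X.X0) (h : (u ≫ X.e) ≫ X.t = a ≫ X.s) :
    X.mul (u ≫ X.e) a h = a := by
  have hu : u = a ≫ X.s := by simpa [X.e_t] using h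
  subst hu
  simpa [mul] using X.isGroupoid.unit_mul a

lemma mul_unit' {T : C} (a : T ⟶ X.X1) (u : T ⟶ X.X0) (h : a ≫ X.t = (u ≫ X.e) ≫ X.s) :
    X.mul a (u ≫ X.e) h = a := by
  have hu : u = a ≫ X.t := by simpa [X.e_s] using h.symm
  subst hu
  simpa [mul] using X.isGroupoid.mul_unit a

/-- A functor between internal groupoids. -/
@[ext] structure Fun (X Y : Gpd C) where
  f0 : X.X0 ⟶ Y.X0
  f1 : X.X1 ⟶ Y.X1
  f1_s : f1 ≫ Y.s = X.s ≫ f0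
  f1_t : f1 ≫ Y.t = X.t ≫ f0
  map_e : X.e ≫ f1 = f0 ≫ Y.e
  map_mul : ∀ {T : C} (a b : T ⟶ X.X1) (h : a ≫ X.t = b ≫ X.s),
    X.mul a b h ≫ f1 = Y.mul (a ≫ f1) (b ≫ f1) (by
      rw [Category.assoc, Category.assoc, f1_s, f1_t, ← Category.assoc, h, Category.assoc])

lemma Fun.f1_s_assoc (F : Fun X Y) {Z : C} (h : Y.X0 ⟶ Z) :
    F.f1 ≫ Y.s ≫ h = X.s ≫ F.f0 ≫ h := by
  rw [← Category.assoc, F.f1_s, Category.assoc]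

lemma Fun.f1_t_assoc (F : Fun X Y) {Z : C} (h : Y.X0 ⟶ Z) :
    F.f1 ≫ Y.t ≫ h = X.t ≫ F.f0 ≫ h := by
  rw [← Category.assoc, F.f1_t, Category.assoc]

lemma Fun.map_e_assoc (F : Fun X Y) {Z : C} (h : Y.X1 ⟶ Z) :
    X.e ≫ F.f1 ≫ h = F.f0 ≫ Y.e ≫ h := by
  rw [← Category.assoc, F.map_e, Category.assoc]

instance : CategoryStruct (Gpd C) where
  Hom := Fun
  id X :=
    { f0 := 𝟙 _
      f1 := 𝟙 _
      f1_s := by simp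
      f1_t := by simp
      map_e := by simp
      map_mul := by intros; simp }
  comp {X Y Z} F G :=
    { f0 := F.f0 ≫ G.f0
      f1 := F.f1 ≫ G.f1
      f1_s := by simp [Fun.f1_s, Fun.f1_s_assoc]
      f1_t := by simp [Fun.f1_t, Fun.f1_t_assoc]
      map_e := by simp [Fun.map_e, Fun.map_e_assoc]
      map_mul := by
        intro T a b h
        rw [← Category.assoc, F.map_mul, G.map_mul]
        exact mul_congr (Category.assoc _ _ _) (Category.assoc _ _ _) _ }

@[simp] lemma id_f0 : Fun.f0 (𝟙 X) = 𝟙 _ := rfl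
@[simp] lemma id_f1 : Fun.f1 (𝟙 X) = 𝟙 _ := rfl
@[simp] lemma comp_f0 (F : X ⟶ Y) (G : Y ⟶ Z) : Fun.f0 (F ≫ G) = F.f0 ≫ G.f0 := rfl
@[simp] lemma comp_f1 (F : X ⟶ Y) (G : Y ⟶ Z) : Fun.f1 (F ≫ G) = F.f1 ≫ G.f1 := rfl

lemma fun_ext {F G : X ⟶ Y} (h0 : Fun.f0 F = Fun.f0 G) (h1 : Fun.f1 F = Fun.f1 G) : F = G :=
  Fun.ext h0 h1

/-- A natural transformation between internal functors: a morphism `α : X₀ ⟶ Y₁` assigning to `x`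
an arrow `F x ⟶ G x`, naturally in `x`. -/
@[ext] structure Trans {X Y : Gpd C} (F G : X ⟶ Y) where
  α : X.X0 ⟶ Y.X1
  α_s : α ≫ Y.s = F.f0
  α_t : α ≫ Y.t = G.f0
  naturality : ∀ {T : C} (a : T ⟶ X.X1),
    Y.mul (a ≫ F.f1) (a ≫ X.t ≫ α) (by simp [F.f1_t, α_s]) =
      Y.mul (a ≫ X.s ≫ α) (a ≫ G.f1) (by simp [G.f1_s, α_t])

lemma Trans.α_s_assoc {F G : X ⟶ Y} (η : Trans F G) {Z : C} (h : Y.X0 ⟶ Z) :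
    η.α ≫ Y.s ≫ h = F.f0 ≫ h := by
  rw [← Category.assoc, η.α_s]

lemma Trans.α_t_assoc {F G : X ⟶ Y} (η : Trans F G) {Z : C} (h : Y.X0 ⟶ Z) :
    η.α ≫ Y.t ≫ h = G.f0 ≫ h := by
  rw [← Category.assoc, η.α_t]

instance homCategory (X Y : Gpd C) : Category (X ⟶ Y) where
  Hom F G := Trans F G
  id F :=
    { α := F.f0 ≫ Y.e
      α_s := by simp [Y.e_s]
      α_t := by simp [Y.e_t]
      naturality := by
        intro T a
        have h1 : a ≫ X.t ≫ F.f0 ≫ Y.e = (a ≫ X.t ≫ F.f0) ≫ Y.e := by simp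
        have h2 : a ≫ X.s ≫ F.f0 ≫ Y.e = (a ≫ X.s ≫ F.f0) ≫ Y.e := by simp
        rw [mul_congr rfl h1, mul_congr h2 rfl, unit_mul', mul_unit'] }
  comp {F G H} η θ :=
    { α := Y.mul η.α θ.α (by rw [η.α_t, θ.α_s])
      α_s := by rw [mul_s, η.α_s]
      α_t := by rw [mul_t, θ.α_t]
      naturality := by
        intro T a
        have h1 : ∀ {S : C} (u : S ⟶ X.X0), u ≫ Y.mul η.α θ.α (by rw [η.α_t, θ.α_s]) =
            Y.mul (u ≫ η.α) (u ≫ θ.α) (by simp [η.α_t, θ.α_s]) := fun u => comp_mul u _ _ _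
        rw [mul_congr rfl ((Category.assoc _ _ _).symm.trans (h1 (a ≫ X.t))),
          mul_congr ((Category.assoc _ _ _).symm.trans (h1 (a ≫ X.s))) rfl,
          ← mul_assoc' (a ≫ F.f1) _ _ (by simp [F.f1_t, η.α_s]) (by simp [η.α_t, θ.α_s]),
          mul_assoc' _ _ (a ≫ H.f1) (by simp [η.α_t, θ.α_s]) (by simp [H.f1_s, θ.α_t])]
        have h2 := η.naturality a
        have h3 := θ.naturality a
        rw [mul_congr ((mul_congr rfl (Category.assoc _ _ _) _).trans h2) (Category.assoc _ _ _),
          mul_assoc' _ _ _ (by simp [G.f1_s, η.α_t]) (by simp [G.f1_t, θ.α_s]),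
          mul_congr rfl h3]
        exact mul_congr (Category.assoc _ _ _).symm
          (mul_congr (Category.assoc _ _ _).symm rfl _) _ }
  id_comp η := Trans.ext (unit_mul' _ _ _)
  comp_id η := Trans.ext (mul_unit' _ _ _)
  assoc η θ ι := Trans.ext (mul_assoc' _ _ _ _ _)

lemma trans_ext {F G : X ⟶ Y} {η θ : F ⟶ G} (h : Trans.α η = Trans.α θ) : η = θ :=
  Trans.ext h

lemma id_α (F : X ⟶ Y) : Trans.α (𝟙 F) = F.f0 ≫ Y.e := rfl

lemma comp_α {F G H : X ⟶ Y} (η : F ⟶ G) (θ : G ⟶ H) :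
    Trans.α (η ≫ θ) = Y.mul η.α θ.α (by rw [η.α_t, θ.α_s]) := rfl

lemma eqToHom_α {F G : X ⟶ Y} (h : F = G) : Trans.α (eqToHom h) = F.f0 ≫ Y.e := by
  subst h; rfl

/-- Whiskering of a transformation by a functor on the left. -/
def whiskerL (F : X ⟶ Y) {G H : Y ⟶ Z} (η : G ⟶ H) : (F ≫ G) ⟶ (F ≫ H) :=
  show Trans _ _ from
  { α := F.f0 ≫ η.α
    α_s := by simp [η.α_s]
    α_t := by simp [η.α_t]
    naturality := by
      intro T a
      have h := η.naturality (a ≫ F.f1)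
      refine (mul_congr (by simp) (by simp [F.f1_t_assoc]) _).trans
        (h.trans (mul_congr (by simp [F.f1_s_assoc]) (by simp) _)) }

/-- Whiskering of a transformation by a functor on the right. -/
def whiskerR {F G : X ⟶ Y} (η : F ⟶ G) (H : Y ⟶ Z) : (F ≫ H) ⟶ (G ≫ H) :=
  show Trans _ _ from
  { α := η.α ≫ H.f1
    α_s := by simp [H.f1_s, η.α_s_assoc]
    α_t := by simp [H.f1_t, η.α_t_assoc]
    naturality := by
      intro T a
      have h := congrArg (· ≫ H.f1) (η.naturality a)
      rw [H.map_mul, H.map_mul] at h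
      refine (mul_congr (by simp) (by simp) _).trans (h.trans (mul_congr (by simp) (by simp) _)) }

@[simp] lemma whiskerL_α (F : X ⟶ Y) {G H : Y ⟶ Z} (η : G ⟶ H) :
    Trans.α (whiskerL F η) = F.f0 ≫ η.α := rfl

@[simp] lemma whiskerR_α {F G : X ⟶ Y} (η : F ⟶ G) (H : Y ⟶ Z) :
    Trans.α (whiskerR η H) = η.α ≫ H.f1 := rfl

lemma eqToHom_comp_α {F G H : X ⟶ Y} (h : F = G) (η : G ⟶ H) :
    Trans.α (eqToHom h ≫ η) = η.α := by
  subst h; simp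

lemma comp_eqToHom_α {F G H : X ⟶ Y} (η : F ⟶ G) (h : G = H) :
    Trans.α (η ≫ eqToHom h) = η.α := by
  subst h; simp

section Coherence

variable {W V : Gpd C}

/-- Composition of functors is strictly associative. -/
def assocIso (F : W ⟶ X) (G : X ⟶ Y) (H : Y ⟶ Z) : (F ≫ G) ≫ H ≅ F ≫ G ≫ H :=
  eqToIso (fun_ext (Category.assoc _ _ _) (Category.assoc _ _ _))

/-- Identity functors are strict left units. -/
def leftUnitIso (F : X ⟶ Y) : 𝟙 X ≫ F ≅ F :=
  eqToIso (fun_ext (Category.id_comp _) (Category.id_comp _))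

/-- Identity functors are strict right units. -/
def rightUnitIso (F : X ⟶ Y) : F ≫ 𝟙 Y ≅ F :=
  eqToIso (fun_ext (Category.comp_id _) (Category.comp_id _))

lemma whiskerL_id (F : X ⟶ Y) (G : Y ⟶ Z) : whiskerL F (𝟙 G) = 𝟙 (F ≫ G) :=
  trans_ext (by simp [id_α])

lemma id_whiskerR (F : X ⟶ Y) (G : Y ⟶ Z) : whiskerR (𝟙 F) G = 𝟙 (F ≫ G) :=
  trans_ext (by simp [id_α, Fun.map_e])

lemma id_whiskerL {F G : X ⟶ Y} (η : F ⟶ G) :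
    whiskerL (𝟙 X) η = (leftUnitIso F).hom ≫ η ≫ (leftUnitIso G).inv :=
  trans_ext (by simp [leftUnitIso, eqToHom_comp_α, comp_eqToHom_α])

lemma whiskerR_id {F G : X ⟶ Y} (η : F ⟶ G) :
    whiskerR η (𝟙 Y) = (rightUnitIso F).hom ≫ η ≫ (rightUnitIso G).inv :=
  trans_ext (by simp [rightUnitIso, eqToHom_comp_α, comp_eqToHom_α])

lemma comp_whiskerL (F : W ⟶ X) (G : X ⟶ Y) {H H' : Y ⟶ Z} (η : H ⟶ H') :
    whiskerL (F ≫ G) η =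
      (assocIso F G H).hom ≫ whiskerL F (whiskerL G η) ≫ (assocIso F G H').inv :=
  trans_ext (by simp [assocIso, eqToHom_comp_α, comp_eqToHom_α])

lemma whiskerR_comp {F F' : W ⟶ X} (η : F ⟶ F') (G : X ⟶ Y) (H : Y ⟶ Z) :
    whiskerR η (G ≫ H) =
      (assocIso F G H).inv ≫ whiskerR (whiskerR η G) H ≫ (assocIso F' G H).hom :=
  trans_ext (by simp [assocIso, eqToHom_comp_α, comp_eqToHom_α])

lemma whiskerL_whiskerR (F : W ⟶ X) {G G' : X ⟶ Y} (η : G ⟶ G') (H : Y ⟶ Z) :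
    whiskerR (whiskerL F η) H =
      (assocIso F G H).hom ≫ whiskerL F (whiskerR η H) ≫ (assocIso F G' H).inv :=
  trans_ext (by simp [assocIso, eqToHom_comp_α, comp_eqToHom_α])

lemma whiskerL_exchange {F G : X ⟶ Y} {H I : Y ⟶ Z} (η : F ⟶ G) (θ : H ⟶ I) :
    whiskerL F θ ≫ whiskerR η I = whiskerR η H ≫ whiskerL G θ :=
  trans_ext (by
    have h := θ.naturality η.α
    refine Eq.trans ?_ (h.symm.trans ?_)
    · exact mul_congr (by simp [η.α_s_assoc]) rfl _
    · exact mul_congr rfl (by simp [η.α_t_assoc]) _)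

lemma whiskerR_eqToHom {F G : X ⟶ Y} (h : F = G) (H : Y ⟶ Z) :
    whiskerR (eqToHom h) H = eqToHom (by rw [h]) := by
  subst h; exact id_whiskerR F H

lemma whiskerL_eqToHom (F : X ⟶ Y) {G H : Y ⟶ Z} (h : G = H) :
    whiskerL F (eqToHom h) = eqToHom (by rw [h]) := by
  subst h; exact whiskerL_id F G

lemma assocIso_pentagon (F : V ⟶ W) (G : W ⟶ X) (H : X ⟶ Y) (I : Y ⟶ Z) :
    whiskerR (assocIso F G H).hom I ≫ (assocIso F (G ≫ H) I).hom ≫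
      whiskerL F (assocIso G H I).hom =
      (assocIso (F ≫ G) H I).hom ≫ (assocIso F G (H ≫ I)).hom := by
  simp [assocIso, whiskerR_eqToHom, whiskerL_eqToHom]

lemma assocIso_triangle (F : X ⟶ Y) (G : Y ⟶ Z) :
    (assocIso F (𝟙 Y) G).hom ≫ whiskerL F (leftUnitIso G).hom =
      whiskerR (rightUnitIso F).hom G := by
  simp [assocIso, leftUnitIso, rightUnitIso, whiskerR_eqToHom, whiskerL_eqToHom]

end Coherence

/-- The strict 2-category of groupoids, functors and natural transformations in `C`. -/
instance bicategory : Bicategory (Gpd C) where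
  whiskerLeft F _ _ η := whiskerL F η
  whiskerRight η H := whiskerR η H
  associator F G H := assocIso F G H
  leftUnitor F := leftUnitIso F
  rightUnitor F := rightUnitIso F
  whiskerLeft_id F G := whiskerL_id F G
  whiskerLeft_comp F _ _ _ η θ := trans_ext (comp_mul _ _ _ _)
  id_whiskerLeft η := id_whiskerL η
  comp_whiskerLeft F G _ _ η := comp_whiskerL F G η
  id_whiskerRight F G := id_whiskerR F G
  comp_whiskerRight η θ H := trans_ext (H.map_mul _ _ _)
  whiskerRight_id η := whiskerR_id η
  whiskerRight_comp η G H := whiskerR_comp η G H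
  whisker_assoc F _ _ η H := whiskerL_whiskerR F η H
  whisker_exchange η θ := whiskerL_exchange η θ
  pentagon F G H I := assocIso_pentagon F G H I
  triangle F G := assocIso_triangle F G

instance : Bicategory.Strict (Gpd C) where
  id_comp _ := fun_ext (Category.id_comp _) (Category.id_comp _)
  comp_id _ := fun_ext (Category.comp_id _) (Category.comp_id _)
  assoc _ _ _ := fun_ext (Category.assoc _ _ _) (Category.assoc _ _ _)
  leftUnitor_eqToIso _ := rfl
  rightUnitor_eqToIso _ := rfl
  associator_eqToIso _ _ _ := rfl

end Gpd

end InternalGroupoids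

/-! ### Sub-bicategories, strict transformations, 2-localization -/

section Bicategories

universe w v u u'

open Bicategory

/-- Data describing a locally full sub-bicategory: a family of objects and a class of 1-cells
that contains the identities and is closed under composition; all 2-cells between these 1-cells
are kept. -/
structure LocallyFull (B : Type u) [Bicategory.{w, v} B] where
  Obj : Type u'
  ι : Obj → B
  P : ∀ {a b : Obj}, (ι a ⟶ ι b) → Prop
  id_mem : ∀ a : Obj, P (𝟙 (ι a))
  comp_mem : ∀ {a b c : Obj} {f : ι a ⟶ ι b} {g : ι b ⟶ ι c}, P f → P g → P (f ≫ g)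

namespace LocallyFull

variable {B : Type u} [Bicategory.{w, v} B] (S : LocallyFull.{w, v, u, u'} B)

/-- The objects of the sub-bicategory. -/
structure Cells where
  obj : S.Obj

variable {S}

/-- The 1-cells of the sub-bicategory. -/
@[ext] structure Hom (a b : S.Cells) where
  hom : S.ι a.obj ⟶ S.ι b.obj
  mem : S.P hom

instance : CategoryStruct S.Cells where
  Hom a b := Hom a b
  id a := ⟨𝟙 _, S.id_mem a.obj⟩
  comp f g := ⟨f.hom ≫ g.hom, S.comp_mem f.mem g.mem⟩

lemma hom_ext {a b : S.Cells} {f g : a ⟶ b} (h : f.hom = g.hom) : f = g := Hom.ext h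

@[simp] lemma id_hom (a : S.Cells) : Hom.hom (𝟙 a) = 𝟙 (S.ι a.obj) := rfl

@[simp] lemma comp_hom {a b c : S.Cells} (f : a ⟶ b) (g : b ⟶ c) :
    Hom.hom (f ≫ g) = f.hom ≫ g.hom := rfl

/-- The 2-cells of the sub-bicategory are all the 2-cells of the ambient one. -/
@[ext] structure Hom₂ {a b : S.Cells} (f g : a ⟶ b) where
  hom : f.hom ⟶ g.hom

instance homCategory (a b : S.Cells) : Category (a ⟶ b) where
  Hom f g := Hom₂ f g
  id f := ⟨𝟙 f.hom⟩
  comp η θ := ⟨η.hom ≫ θ.hom⟩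

@[ext] lemma hom₂_ext {a b : S.Cells} {f g : a ⟶ b} {η θ : f ⟶ g} (h : η.hom = θ.hom) : η = θ :=
  Hom₂.ext h

@[simp] lemma id₂_hom {a b : S.Cells} (f : a ⟶ b) : Hom₂.hom (𝟙 f) = 𝟙 f.hom := rfl

@[simp] lemma comp₂_hom {a b : S.Cells} {f g h : a ⟶ b} (η : f ⟶ g) (θ : g ⟶ h) :
    Hom₂.hom (η ≫ θ) = η.hom ≫ θ.hom := rfl

/-- Invertible 2-cells of the ambient bicategory. -/
def isoMk {a b : S.Cells} {f g : a ⟶ b} (φ : f.hom ≅ g.hom) : f ≅ g where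
  hom := Hom₂.mk φ.hom
  inv := Hom₂.mk φ.inv
  hom_inv_id := hom₂_ext φ.hom_inv_id
  inv_hom_id := hom₂_ext φ.inv_hom_id

instance bicategory : Bicategory S.Cells where
  whiskerLeft f _ _ η := Hom₂.mk (Hom.hom f ◁ Hom₂.hom η)
  whiskerRight η h := Hom₂.mk (Hom₂.hom η ▷ Hom.hom h)
  associator f g h := isoMk (α_ (Hom.hom f) (Hom.hom g) (Hom.hom h))
  leftUnitor f := isoMk (λ_ (Hom.hom f))
  rightUnitor f := isoMk (ρ_ (Hom.hom f))
  whiskerLeft_id _ _ := hom₂_ext (Bicategory.whiskerLeft_id _ _)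
  whiskerLeft_comp _ _ _ _ _ _ := hom₂_ext (Bicategory.whiskerLeft_comp _ _ _)
  id_whiskerLeft _ := hom₂_ext (Bicategory.id_whiskerLeft _)
  comp_whiskerLeft _ _ _ _ _ := hom₂_ext (Bicategory.comp_whiskerLeft _ _ _)
  id_whiskerRight _ _ := hom₂_ext (Bicategory.id_whiskerRight _ _)
  comp_whiskerRight _ _ _ := hom₂_ext (Bicategory.comp_whiskerRight _ _ _)
  whiskerRight_id _ := hom₂_ext (Bicategory.whiskerRight_id _)
  whiskerRight_comp _ _ _ := hom₂_ext (Bicategory.whiskerRight_comp _ _ _)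
  whisker_assoc _ _ _ _ _ := hom₂_ext (Bicategory.whisker_assoc _ _ _)
  whisker_exchange _ _ := hom₂_ext (Bicategory.whisker_exchange _ _)
  pentagon _ _ _ _ := hom₂_ext (Bicategory.pentagon _ _ _ _)
  triangle _ _ := hom₂_ext (Bicategory.triangle _ _)

variable (S) in
/-- The inclusion into the ambient bicategory. -/
def incl : StrictPseudofunctor S.Cells B :=
  StrictPseudofunctor.mk'
    { obj := fun a => S.ι a.obj
      map := fun f => Hom.hom f
      map₂ := fun η => Hom₂.hom η
      map₂_id := fun _ => rfl
      map₂_comp := fun _ _ => rfl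
      map_id := fun _ => rfl
      map_comp := fun _ _ => rfl
      map₂_whisker_left := fun _ _ _ _ => by simp; rfl
      map₂_whisker_right := fun _ _ => by simp; rfl
      map₂_left_unitor := fun _ => by simp; rfl
      map₂_right_unitor := fun _ => by simp; rfl
      map₂_associator := fun _ _ _ => by simp; rfl }

lemma isoMk_eqToIso {a b : S.Cells} {f g : a ⟶ b} (h : f.hom = g.hom) :
    isoMk (eqToIso h) = eqToIso (hom_ext h) := by
  have h' := hom_ext h
  subst h'
  rfl

instance [Bicategory.Strict B] : Bicategory.Strict S.Cells where
  id_comp f := hom_ext (Bicategory.Strict.id_comp (Hom.hom f))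
  comp_id f := hom_ext (Bicategory.Strict.comp_id (Hom.hom f))
  assoc f g h := hom_ext (Bicategory.Strict.assoc (Hom.hom f) (Hom.hom g) (Hom.hom h))
  leftUnitor_eqToIso f :=
    (congrArg isoMk (Bicategory.Strict.leftUnitor_eqToIso (Hom.hom f))).trans (isoMk_eqToIso _)
  rightUnitor_eqToIso f :=
    (congrArg isoMk (Bicategory.Strict.rightUnitor_eqToIso (Hom.hom f))).trans (isoMk_eqToIso _)
  associator_eqToIso f g h :=
    (congrArg isoMk (Bicategory.Strict.associator_eqToIso (Hom.hom f) (Hom.hom g) (Hom.hom h))).trans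
      (isoMk_eqToIso _)

end LocallyFull

/-- A strict natural transformation between strict 2-functors: 1-cells `app a : F a ⟶ G a` such that
all naturality squares commute on the nose, for 1-cells as well as for 2-cells. -/
structure StrictTrans {B : Type*} [Bicategory B] {C : Type*} [Bicategory C]
    (F G : StrictPseudofunctor B C) where
  app : ∀ a : B, F.obj a ⟶ G.obj a
  naturality : ∀ {a b : B} (f : a ⟶ b), F.map f ≫ app b = app a ≫ G.map f
  naturality₂ : ∀ {a b : B} {f g : a ⟶ b} (η : f ⟶ g),
    F.map₂ η ▷ app b = eqToHom (naturality f) ≫ (app a ◁ G.map₂ η) ≫ eqToHom (naturality g).symm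

end Bicategories

section Localization

universe w v u

variable {B : Type u} [Bicategory.{w, v} B]

/-- The 2-localization of a bicategory `B` at a class `W` of 1-cells: the bicategory obtained from
`B` by freely adjoining, for each 1-cell `w : a ⟶ b` in `W`, a 1-cell `b ⟶ a` and invertible
2-cells exhibiting it as an adjoint inverse equivalence of `w`.  Its objects are those of `B`. -/
structure TwoLoc (W : ∀ ⦃a b : B⦄, (a ⟶ b) → Prop) where
  as : B

namespace TwoLoc

variable (W : ∀ ⦃a b : B⦄, (a ⟶ b) → Prop)

/-- Formal composites of 1-cells of `B` and of formal inverses of 1-cells in `W`. -/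
inductive Hom : B → B → Type (max u v)
  | of {a b : B} (f : a ⟶ b) : Hom a b
  | inv {a b : B} (w : a ⟶ b) (hw : W w) : Hom b a
  | id (a : B) : Hom a a
  | comp {a b c : B} (f : Hom a b) (g : Hom b c) : Hom a c

/-- Representatives of 2-cells: they are generated by the 2-cells of `B`, by comparison 2-cells
making `B → TwoLoc W` a pseudofunctor, by the units and counits of the adjoined equivalences, and by
the structure 2-cells of a bicategory. -/
inductive Hom₂ : ∀ {a b : B}, Hom W a b → Hom W a b → Type (max u v w)
  | of {a b : B} {f g : a ⟶ b} (η : f ⟶ g) : Hom₂ (Hom.of f) (Hom.of g)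
  | mapId (a : B) : Hom₂ (Hom.of (𝟙 a)) (Hom.id a)
  | mapIdInv (a : B) : Hom₂ (Hom.id a) (Hom.of (𝟙 a))
  | mapComp {a b c : B} (f : a ⟶ b) (g : b ⟶ c) :
      Hom₂ (Hom.of (f ≫ g)) ((Hom.of f).comp (Hom.of g))
  | mapCompInv {a b c : B} (f : a ⟶ b) (g : b ⟶ c) :
      Hom₂ ((Hom.of f).comp (Hom.of g)) (Hom.of (f ≫ g))
  | unit {a b : B} (w : a ⟶ b) (hw : W w) : Hom₂ (Hom.id a) ((Hom.of w).comp (Hom.inv w hw))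
  | unitInv {a b : B} (w : a ⟶ b) (hw : W w) : Hom₂ ((Hom.of w).comp (Hom.inv w hw)) (Hom.id a)
  | counit {a b : B} (w : a ⟶ b) (hw : W w) : Hom₂ ((Hom.inv w hw).comp (Hom.of w)) (Hom.id b)
  | counitInv {a b : B} (w : a ⟶ b) (hw : W w) : Hom₂ (Hom.id b) ((Hom.inv w hw).comp (Hom.of w))
  | id {a b : B} (f : Hom W a b) : Hom₂ f f
  | vcomp {a b : B} {f g h : Hom W a b} (η : Hom₂ f g) (θ : Hom₂ g h) : Hom₂ f h
  | whiskerLeft {a b c : B} (f : Hom W a b) {g h : Hom W b c} (η : Hom₂ g h) :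
      Hom₂ (f.comp g) (f.comp h)
  | whiskerRight {a b c : B} {f g : Hom W a b} (h : Hom W b c) (η : Hom₂ f g) :
      Hom₂ (f.comp h) (g.comp h)
  | associator {a b c d : B} (f : Hom W a b) (g : Hom W b c) (h : Hom W c d) :
      Hom₂ ((f.comp g).comp h) (f.comp (g.comp h))
  | associatorInv {a b c d : B} (f : Hom W a b) (g : Hom W b c) (h : Hom W c d) :
      Hom₂ (f.comp (g.comp h)) ((f.comp g).comp h)
  | leftUnitor {a b : B} (f : Hom W a b) : Hom₂ ((Hom.id a).comp f) f
  | leftUnitorInv {a b : B} (f : Hom W a b) : Hom₂ f ((Hom.id a).comp f)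
  | rightUnitor {a b : B} (f : Hom W a b) : Hom₂ (f.comp (Hom.id b)) f
  | rightUnitorInv {a b : B} (f : Hom W a b) : Hom₂ f (f.comp (Hom.id b))

section

local infixr:80 " ⊚ " => Hom₂.vcomp
local infixr:81 " ◃ " => Hom₂.whiskerLeft
local notation:81 η:81 " ▹ " h:82 => Hom₂.whiskerRight h η

open Hom₂ in
/-- Relations between 2-cells: the axioms of a bicategory, those making `B → TwoLoc W` a
pseudofunctor, and those making the adjoined 2-cells adjoint equivalences. -/
inductive Rel : ∀ {a b : B} {f g : Hom W a b}, Hom₂ W f g → Hom₂ W f g → Prop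
  -- congruence
  | vcomp_right {a b : B} {f g h : Hom W a b} (η : Hom₂ W f g) (θ₁ θ₂ : Hom₂ W g h) :
      Rel θ₁ θ₂ → Rel (η ⊚ θ₁) (η ⊚ θ₂)
  | vcomp_left {a b : B} {f g h : Hom W a b} (η₁ η₂ : Hom₂ W f g) (θ : Hom₂ W g h) :
      Rel η₁ η₂ → Rel (η₁ ⊚ θ) (η₂ ⊚ θ)
  | whiskerLeft {a b c : B} (f : Hom W a b) (g h : Hom W b c) (η η' : Hom₂ W g h) :
      Rel η η' → Rel (f ◃ η) (f ◃ η')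
  | whiskerRight {a b c : B} (f g : Hom W a b) (h : Hom W b c) (η η' : Hom₂ W f g) :
      Rel η η' → Rel (η ▹ h) (η' ▹ h)
  -- bicategory axioms
  | id_comp {a b : B} {f g : Hom W a b} (η : Hom₂ W f g) : Rel (id f ⊚ η) η
  | comp_id {a b : B} {f g : Hom W a b} (η : Hom₂ W f g) : Rel (η ⊚ id g) η
  | assoc {a b : B} {f g h i : Hom W a b} (η : Hom₂ W f g) (θ : Hom₂ W g h) (κ : Hom₂ W h i) :
      Rel ((η ⊚ θ) ⊚ κ) (η ⊚ θ ⊚ κ)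
  | whiskerLeft_id {a b c : B} (f : Hom W a b) (g : Hom W b c) : Rel (f ◃ id g) (id (f.comp g))
  | whiskerLeft_comp {a b c : B} (f : Hom W a b) {g h i : Hom W b c} (η : Hom₂ W g h)
      (θ : Hom₂ W h i) : Rel (f ◃ (η ⊚ θ)) (f ◃ η ⊚ f ◃ θ)
  | id_whiskerLeft {a b : B} {f g : Hom W a b} (η : Hom₂ W f g) :
      Rel (Hom.id a ◃ η) (leftUnitor f ⊚ η ⊚ leftUnitorInv g)
  | comp_whiskerLeft {a b c d : B} (f : Hom W a b) (g : Hom W b c) {h h' : Hom W c d}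
      (η : Hom₂ W h h') :
      Rel (f.comp g ◃ η) (associator f g h ⊚ f ◃ g ◃ η ⊚ associatorInv f g h')
  | id_whiskerRight {a b c : B} (f : Hom W a b) (g : Hom W b c) : Rel (id f ▹ g) (id (f.comp g))
  | comp_whiskerRight {a b c : B} {f g h : Hom W a b} (i : Hom W b c) (η : Hom₂ W f g)
      (θ : Hom₂ W g h) : Rel ((η ⊚ θ) ▹ i) (η ▹ i ⊚ θ ▹ i)
  | whiskerRight_id {a b : B} {f g : Hom W a b} (η : Hom₂ W f g) :
      Rel (η ▹ Hom.id b) (rightUnitor f ⊚ η ⊚ rightUnitorInv g)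
  | whiskerRight_comp {a b c d : B} {f f' : Hom W a b} (g : Hom W b c) (h : Hom W c d)
      (η : Hom₂ W f f') :
      Rel (η ▹ (g.comp h)) (associatorInv f g h ⊚ (η ▹ g) ▹ h ⊚ associator f' g h)
  | whisker_assoc {a b c d : B} (f : Hom W a b) {g g' : Hom W b c} (η : Hom₂ W g g')
      (h : Hom W c d) :
      Rel ((f ◃ η) ▹ h) (associator f g h ⊚ f ◃ (η ▹ h) ⊚ associatorInv f g' h)
  | whisker_exchange {a b c : B} {f g : Hom W a b} {h i : Hom W b c} (η : Hom₂ W f g)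
      (θ : Hom₂ W h i) : Rel (f ◃ θ ⊚ η ▹ i) (η ▹ h ⊚ g ◃ θ)
  | associator_hom_inv {a b c d : B} (f : Hom W a b) (g : Hom W b c) (h : Hom W c d) :
      Rel (associator f g h ⊚ associatorInv f g h) (id ((f.comp g).comp h))
  | associator_inv_hom {a b c d : B} (f : Hom W a b) (g : Hom W b c) (h : Hom W c d) :
      Rel (associatorInv f g h ⊚ associator f g h) (id (f.comp (g.comp h)))
  | leftUnitor_hom_inv {a b : B} (f : Hom W a b) :
      Rel (leftUnitor f ⊚ leftUnitorInv f) (id ((Hom.id a).comp f))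
  | leftUnitor_inv_hom {a b : B} (f : Hom W a b) : Rel (leftUnitorInv f ⊚ leftUnitor f) (id f)
  | rightUnitor_hom_inv {a b : B} (f : Hom W a b) :
      Rel (rightUnitor f ⊚ rightUnitorInv f) (id (f.comp (Hom.id b)))
  | rightUnitor_inv_hom {a b : B} (f : Hom W a b) : Rel (rightUnitorInv f ⊚ rightUnitor f) (id f)
  | pentagon {a b c d e : B} (f : Hom W a b) (g : Hom W b c) (h : Hom W c d) (i : Hom W d e) :
      Rel (associator f g h ▹ i ⊚ associator f (g.comp h) i ⊚ f ◃ associator g h i)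
        (associator (f.comp g) h i ⊚ associator f g (h.comp i))
  | triangle {a b c : B} (f : Hom W a b) (g : Hom W b c) :
      Rel (associator f (Hom.id b) g ⊚ f ◃ leftUnitor g) (rightUnitor f ▹ g)
  -- `B → TwoLoc W` is a pseudofunctor
  | of_id {a b : B} (f : a ⟶ b) : Rel (of (𝟙 f)) (id (Hom.of f))
  | of_comp {a b : B} {f g h : a ⟶ b} (η : f ⟶ g) (θ : g ⟶ h) : Rel (of (η ≫ θ)) (of η ⊚ of θ)
  | mapId_hom_inv (a : B) : Rel (mapId a ⊚ mapIdInv a) (id (Hom.of (𝟙 a)))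
  | mapId_inv_hom (a : B) : Rel (mapIdInv a ⊚ mapId a) (id (Hom.id a))
  | mapComp_hom_inv {a b c : B} (f : a ⟶ b) (g : b ⟶ c) :
      Rel (mapComp f g ⊚ mapCompInv f g) (id (Hom.of (f ≫ g)))
  | mapComp_inv_hom {a b c : B} (f : a ⟶ b) (g : b ⟶ c) :
      Rel (mapCompInv f g ⊚ mapComp f g) (id ((Hom.of f).comp (Hom.of g)))
  | of_whiskerLeft {a b c : B} (f : a ⟶ b) {g h : b ⟶ c} (η : g ⟶ h) :
      Rel (of (Bicategory.whiskerLeft f η)) (mapComp f g ⊚ Hom.of f ◃ of η ⊚ mapCompInv f h)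
  | of_whiskerRight {a b c : B} {f g : a ⟶ b} (η : f ⟶ g) (h : b ⟶ c) :
      Rel (of (Bicategory.whiskerRight η h)) (mapComp f h ⊚ of η ▹ Hom.of h ⊚ mapCompInv g h)
  | of_associator {a b c d : B} (f : a ⟶ b) (g : b ⟶ c) (h : c ⟶ d) :
      Rel (of (Bicategory.associator f g h).hom)
        (mapComp (f ≫ g) h ⊚ mapComp f g ▹ Hom.of h ⊚
          associator (Hom.of f) (Hom.of g) (Hom.of h) ⊚ Hom.of f ◃ mapCompInv g h ⊚
            mapCompInv f (g ≫ h))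
  | of_leftUnitor {a b : B} (f : a ⟶ b) :
      Rel (of (Bicategory.leftUnitor f).hom)
        (mapComp (𝟙 a) f ⊚ mapId a ▹ Hom.of f ⊚ leftUnitor (Hom.of f))
  | of_rightUnitor {a b : B} (f : a ⟶ b) :
      Rel (of (Bicategory.rightUnitor f).hom)
        (mapComp f (𝟙 b) ⊚ Hom.of f ◃ mapId b ⊚ rightUnitor (Hom.of f))
  -- the 1-cells in `W` become adjoint equivalences
  | unit_hom_inv {a b : B} (w : a ⟶ b) (hw : W w) : Rel (unit w hw ⊚ unitInv w hw) (id (Hom.id a))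
  | unit_inv_hom {a b : B} (w : a ⟶ b) (hw : W w) :
      Rel (unitInv w hw ⊚ unit w hw) (id ((Hom.of w).comp (Hom.inv w hw)))
  | counit_hom_inv {a b : B} (w : a ⟶ b) (hw : W w) :
      Rel (counit w hw ⊚ counitInv w hw) (id ((Hom.inv w hw).comp (Hom.of w)))
  | counit_inv_hom {a b : B} (w : a ⟶ b) (hw : W w) :
      Rel (counitInv w hw ⊚ counit w hw) (id (Hom.id b))
  | left_triangle {a b : B} (w : a ⟶ b) (hw : W w) :
      Rel (unit w hw ▹ Hom.of w ⊚ associator (Hom.of w) (Hom.inv w hw) (Hom.of w) ⊚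
          Hom.of w ◃ counit w hw)
        (leftUnitor (Hom.of w) ⊚ rightUnitorInv (Hom.of w))
  | right_triangle {a b : B} (w : a ⟶ b) (hw : W w) :
      Rel (Hom.inv w hw ◃ unit w hw ⊚ associatorInv (Hom.inv w hw) (Hom.of w) (Hom.inv w hw) ⊚
          counit w hw ▹ Hom.inv w hw)
        (rightUnitor (Hom.inv w hw) ⊚ leftUnitorInv (Hom.inv w hw))

end

instance : CategoryStruct (TwoLoc W) where
  Hom a b := Hom W a.as b.as
  id a := Hom.id a.as
  comp f g := Hom.comp f g

instance homCategory (a b : TwoLoc W) : Category (a ⟶ b) where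
  Hom f g := Quot (@Rel _ _ W a.as b.as f g)
  id f := Quot.mk _ (Hom₂.id f)
  comp := Quot.map₂ Hom₂.vcomp Rel.vcomp_right Rel.vcomp_left
  id_comp := by rintro f g ⟨η⟩; exact Quot.sound (Rel.id_comp η)
  comp_id := by rintro f g ⟨η⟩; exact Quot.sound (Rel.comp_id η)
  assoc := by rintro f g h i ⟨η⟩ ⟨θ⟩ ⟨κ⟩; exact Quot.sound (Rel.assoc η θ κ)

/-- The bicategory structure of the 2-localization. -/
instance bicategory : Bicategory (TwoLoc W) where
  whiskerLeft f g h η := Quot.map (Hom₂.whiskerLeft f) (Rel.whiskerLeft f g h) η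
  whiskerRight {_ _ _ f g} η h := Quot.map (Hom₂.whiskerRight h) (Rel.whiskerRight f g h) η
  associator f g h :=
    { hom := Quot.mk _ (Hom₂.associator f g h)
      inv := Quot.mk _ (Hom₂.associatorInv f g h)
      hom_inv_id := Quot.sound (Rel.associator_hom_inv f g h)
      inv_hom_id := Quot.sound (Rel.associator_inv_hom f g h) }
  leftUnitor f :=
    { hom := Quot.mk _ (Hom₂.leftUnitor f)
      inv := Quot.mk _ (Hom₂.leftUnitorInv f)
      hom_inv_id := Quot.sound (Rel.leftUnitor_hom_inv f)
      inv_hom_id := Quot.sound (Rel.leftUnitor_inv_hom f) }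
  rightUnitor f :=
    { hom := Quot.mk _ (Hom₂.rightUnitor f)
      inv := Quot.mk _ (Hom₂.rightUnitorInv f)
      hom_inv_id := Quot.sound (Rel.rightUnitor_hom_inv f)
      inv_hom_id := Quot.sound (Rel.rightUnitor_inv_hom f) }
  whiskerLeft_id f g := Quot.sound (Rel.whiskerLeft_id f g)
  whiskerLeft_comp := by
    rintro a b c f g h i ⟨η⟩ ⟨θ⟩; exact Quot.sound (Rel.whiskerLeft_comp f η θ)
  id_whiskerLeft := by rintro a b f g ⟨η⟩; exact Quot.sound (Rel.id_whiskerLeft η)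
  comp_whiskerLeft := by
    rintro a b c d f g h h' ⟨η⟩; exact Quot.sound (Rel.comp_whiskerLeft f g η)
  id_whiskerRight f g := Quot.sound (Rel.id_whiskerRight f g)
  comp_whiskerRight := by
    rintro a b c f g h ⟨η⟩ ⟨θ⟩ i; exact Quot.sound (Rel.comp_whiskerRight i η θ)
  whiskerRight_id := by rintro a b f g ⟨η⟩; exact Quot.sound (Rel.whiskerRight_id η)
  whiskerRight_comp := by
    rintro a b c d f f' ⟨η⟩ g h; exact Quot.sound (Rel.whiskerRight_comp g h η)
  whisker_assoc := by
    rintro a b c d f g g' ⟨η⟩ h; exact Quot.sound (Rel.whisker_assoc f η h)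
  whisker_exchange := by
    rintro a b c f g h i ⟨η⟩ ⟨θ⟩; exact Quot.sound (Rel.whisker_exchange η θ)
  pentagon f g h i := Quot.sound (Rel.pentagon f g h i)
  triangle f g := Quot.sound (Rel.triangle f g)

/-- The localization pseudofunctor. -/
def L : Pseudofunctor B (TwoLoc W) where
  obj a := ⟨a⟩
  map f := Hom.of f
  map₂ η := Quot.mk _ (Hom₂.of η)
  map₂_id f := Quot.sound (Rel.of_id f)
  map₂_comp η θ := Quot.sound (Rel.of_comp η θ)
  mapId a :=
    { hom := Quot.mk _ (Hom₂.mapId a)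
      inv := Quot.mk _ (Hom₂.mapIdInv a)
      hom_inv_id := Quot.sound (Rel.mapId_hom_inv a)
      inv_hom_id := Quot.sound (Rel.mapId_inv_hom a) }
  mapComp f g :=
    { hom := Quot.mk _ (Hom₂.mapComp f g)
      inv := Quot.mk _ (Hom₂.mapCompInv f g)
      hom_inv_id := Quot.sound (Rel.mapComp_hom_inv f g)
      inv_hom_id := Quot.sound (Rel.mapComp_inv_hom f g) }
  map₂_whisker_left f _ _ η := Quot.sound (Rel.of_whiskerLeft f η)
  map₂_whisker_right η h := Quot.sound (Rel.of_whiskerRight η h)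
  map₂_associator f g h := Quot.sound (Rel.of_associator f g h)
  map₂_left_unitor f := Quot.sound (Rel.of_leftUnitor f)
  map₂_right_unitor f := Quot.sound (Rel.of_rightUnitor f)

end TwoLoc

end Localization

/-! ### Hyper subsets and multi-transversality -/

namespace ManC

/-- The differential of a smooth map at a point; the tangent space at a point is identified with
`ℝⁿ` by the preferred chart there. -/
def tmap {X Y : ManC} (f : X ⟶ Y) (x : X) : X.Vec →L[ℝ] Y.Vec := mfderiv X.model Y.model f x

lemma tmap_id {X : ManC} (x : X) : tmap (𝟙 X) x = ContinuousLinearMap.id ℝ X.Vec :=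
  mfderiv_id

lemma tmap_comp {X Y Z : ManC} (f : X ⟶ Y) (g : Y ⟶ Z) (x : X) :
    tmap (f ≫ g) x = (tmap g (f x)).comp (tmap f x) :=
  mfderiv_comp x ((contMDiff g).mdifferentiable (by simp) (f x))
    ((contMDiff f).mdifferentiable (by simp) x)

/-- The image of the differential `T_w W → T_x X`, `x = h w`. -/
def tangentImage {W X : ManC} (h : W ⟶ X) (w : W) : Submodule ℝ X.Vec :=
  LinearMap.range (tmap h w : W.Vec →ₗ[ℝ] X.Vec)

/-- The conormal space `ker (T_x^∨ X → T_w^∨ W)` of `h : W ⟶ X` at `w`, `x = h w`. -/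
def conormal {W X : ManC} (h : W ⟶ X) (w : W) : Submodule ℝ (Module.Dual ℝ X.Vec) :=
  LinearMap.ker (tmap h w : W.Vec →ₗ[ℝ] X.Vec).dualMap

/-- `h : W ⟶ X` is a hyper map: a proper closed immersion of codimension one between manifolds
without boundary, with transversal self-intersection, that is, for every `x` the map
`⨁_{w ∈ h⁻¹(x)} N_w^∨ → T_x^∨ X` is injective.

Between manifolds without boundary, a closed immersion is the same as an immersion.  The empty
manifold is regarded as having every dimension. -/
structure IsHyperMap {W X : ManC} (h : W ⟶ X) : Prop where
  boundaryless_source : W.IsBoundaryless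
  boundaryless_target : X.IsBoundaryless
  isProper : IsProperMap h
  immersion : ∀ w, Function.Injective (tmap h w)
  codim_one : W.dim + 1 = X.dim ∨ IsEmpty W
  selfTransversal : ∀ x : X, iSupIndep fun w : {w : W // h w = x} => conormal h w.1

/-- A hyper subset: the image of a hyper map. -/
def IsHyperSubset (X : ManC) (E : Set X) : Prop :=
  ∃ (W : ManC) (h : W ⟶ X), IsHyperMap h ∧ range h = E

/-- `f : Y ⟶ X` is transverse to the hyper map `h : W ⟶ X`, and the pullback `Y ×_X W → Y` has
transversal self-intersection.  The tangent space of the pullback at `(y, w)` is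
`T_y Y ×_{T_x X} T_w W`, so that its image in `T_y Y` is the preimage under `df` of the image of `dh`;
the conormal space of the pullback is the annihilator of this subspace. -/
def IsMultiTransverseToMap {Y X W : ManC} (f : Y ⟶ X) (h : W ⟶ X) : Prop :=
  (∀ (y : Y) (w : W), h w = f y →
    LinearMap.range (tmap f y : Y.Vec →ₗ[ℝ] X.Vec) ⊔ tangentImage h w = ⊤) ∧
  ∀ y : Y, iSupIndep fun w : {w : W // h w = f y} =>
    ((tangentImage h w.1).comap (tmap f y : Y.Vec →ₗ[ℝ] X.Vec)).dualAnnihilator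

/-- `f : Y ⟶ X` is multi-transverse to the hyper subset `E` of `X`. -/
def IsMultiTransverse {Y X : ManC} (f : Y ⟶ X) (E : Set X) : Prop :=
  ∃ (W : ManC) (h : W ⟶ X), IsHyperMap h ∧ range h = E ∧ IsMultiTransverseToMap f h

/-! #### Composition of multi-transverse maps -/

section Closure

open Filter Asymptotics

lemma exists_curve {E F : Type*} [NormedAddCommGroup E] [NormedSpace ℝ E] [CompleteSpace E]
    [NormedAddCommGroup F] [NormedSpace ℝ F] [FiniteDimensional ℝ F] {Φ : E → F} {Φ' : E →L[ℝ] F}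
    {a : E} (hΦ : HasStrictFDerivAt Φ Φ' a) (hs : Φ'.range = ⊤) {v : E} (hv : Φ' v = 0) :
    ∃ c : ℝ → E, c 0 = a ∧ HasDerivAt c v 0 ∧ ∀ᶠ t in 𝓝 (0 : ℝ), Φ (c t) = Φ a := by
  let k : Φ'.ker := ⟨v, hv⟩
  refine ⟨fun t => hΦ.implicitFunction Φ Φ' hs (Φ a) (t • k), ?_, ?_, ?_⟩
  · simp
  · have h1 : HasDerivAt (fun t : ℝ => t • k) k 0 := by
      simpa using (hasDerivAt_id (0 : ℝ)).smul_const k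
    have h2 := (hΦ.to_implicitFunction hs).hasFDerivAt
    have h3 : HasFDerivAt (hΦ.implicitFunction Φ Φ' hs (Φ a)) Φ'.ker.subtypeL ((0 : ℝ) • k) := by
      simpa using h2
    exact h3.comp_hasDerivAt (0 : ℝ) h1
  · have h1 : Tendsto (fun t : ℝ => (Φ a, t • k)) (𝓝 0) (𝓝 (Φ a, 0)) := by
      refine tendsto_const_nhds.prodMk_nhds ?_
      have : Continuous fun t : ℝ => t • k := by fun_prop
      simpa using this.tendsto 0
    exact h1.eventually (hΦ.map_implicitFunction_eq hs)

lemma mem_range_of_curve {V U : Type*} [NormedAddCommGroup V] [NormedSpace ℝ V]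
    [FiniteDimensional ℝ V] [NormedAddCommGroup U] [NormedSpace ℝ U] [FiniteDimensional ℝ U]
    {H : V → U} {H' : V →L[ℝ] U} {b₀ : V} (hH : HasFDerivAt H H' b₀)
    (hinj : Function.Injective H') {l : Filter ℝ} [l.NeBot] (hl : l ≤ 𝓝[≠] 0) {b : ℝ → V}
    (hb : Tendsto b l (𝓝 b₀)) {c : ℝ → U} {v : U} (hc : HasDerivAt c v 0) (hc0 : c 0 = H b₀)
    (hbc : ∀ᶠ t in l, H (b t) = c t) : v ∈ LinearMap.range (H' : V →ₗ[ℝ] U) := by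
  obtain ⟨K, -, hK⟩ := (H' : V →ₗ[ℝ] U).exists_antilipschitzWith (LinearMap.ker_eq_bot.2 hinj)
  have hl0 : l ≤ 𝓝 0 := hl.trans nhdsWithin_le_nhds
  have h1 : (fun t => H (b t) - H b₀ - H' (b t - b₀)) =o[l] fun t => b t - b₀ :=
    hH.isLittleO.comp_tendsto hb
  have h2 : (fun t => b t - b₀) =O[l] fun t => H' (b t - b₀) := by
    refine IsBigO.of_bound K (Eventually.of_forall fun t => ?_)
    have := hK.le_mul_dist (b t - b₀) 0
    simpa using this
  have h3 : (fun t => H' (b t - b₀)) =O[l] fun t => H (b t) - H b₀ := by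
    have := (h1.trans_isBigO h2).right_isBigO_add
    simpa using this
  have h4 : (fun t => c t - c 0 - t • v) =o[l] fun t => t := by
    have := hc.hasFDerivAt.isLittleO.mono hl0
    simpa using this
  have h5 : (fun t => c t - c 0) =O[l] fun t => t := by
    have := hc.hasFDerivAt.isBigO_sub.mono hl0
    simpa using this
  have h6 : (fun t => H (b t) - H b₀) =O[l] fun t => t := by
    refine h5.congr' ?_ EventuallyEq.rfl
    filter_upwards [hbc] with t ht
    rw [ht, hc0]
  have h7 : (fun t => H' (b t - b₀) - t • v) =o[l] fun t => t := by
    have h8 := h4.sub (h1.trans_isBigO ((h2.trans h3).trans h6))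
    refine h8.congr' ?_ EventuallyEq.rfl
    filter_upwards [hbc] with t ht
    rw [ht, hc0]; abel
  have h9 : Tendsto (fun t => H' (t⁻¹ • (b t - b₀))) l (𝓝 v) := by
    have h10 : Tendsto (fun t => t⁻¹ • (H' (b t - b₀) - t • v)) l (𝓝 0) := by
      have := h7.tendsto_inv_smul_nhds_zero
      exact this
    have h11 := h10.add_const v
    rw [zero_add] at h11
    refine h11.congr' ?_
    have hne : ∀ᶠ t in l, t ≠ 0 := hl self_mem_nhdsWithin
    filter_upwards [hne] with t ht
    rw [smul_sub, smul_smul, inv_mul_cancel₀ ht, one_smul, map_smul]; abel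
  have hcl : IsClosed (LinearMap.range (H' : V →ₗ[ℝ] U) : Set U) :=
    Submodule.closed_of_finiteDimensional _
  exact hcl.mem_of_tendsto h9 (Eventually.of_forall fun t => ⟨_, rfl⟩)

variable {X Y Z W : ManC}

lemma IsBoundaryless.coord_pos (hX : X.IsBoundaryless) (x : X) (i : Fin X.dim) :
    0 < X.coord x x i := by
  refine lt_of_le_of_ne (X.coord_nonneg x x i) fun h => ?_
  have h1 := (Set.ncard_eq_zero (Set.toFinite _)).1 (hX x)
  have h2 : i ∈ {i | X.coord x x i = 0} := h.symm
  rw [h1] at h2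
  exact h2

lemma IsBoundaryless.range_mem_nhds (hX : X.IsBoundaryless) (x : X) :
    range X.model ∈ 𝓝 (extChartAt X.model x x) := by
  have h1 : IsOpen {y : X.Vec | ∀ i, 0 < y i} := by
    simp only [ofPred_forall]
    exact isOpen_iInter_of_finite fun i => isOpen_lt continuous_const (by fun_prop)
  refine mem_of_superset (h1.mem_nhds fun i => hX.coord_pos x i) fun y hy => ?_
  exact ⟨⟨y, fun i => (hy i).le⟩, rfl⟩

lemma IsBoundaryless.target_mem_nhds (hX : X.IsBoundaryless) (x : X) :
    (extChartAt X.model x).target ∈ 𝓝 (extChartAt X.model x x) := by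
  have := extChartAt_target_mem_nhdsWithin (I := X.model) x
  rwa [nhdsWithin_eq_nhds.2 (hX.range_mem_nhds x)] at this

/-- The expression of a map in the preferred charts. -/
def written (f : X ⟶ Y) (x : X) (y : Y) : X.Vec → Y.Vec :=
  extChartAt Y.model y ∘ f ∘ (extChartAt X.model x).symm

lemma hasStrictFDerivAt_written (hX : X.IsBoundaryless) (f : X ⟶ Y) (x : X) {y : Y}
    (hy : f x = y) : HasStrictFDerivAt (written f x y) (tmap f x) (extChartAt X.model x x) := by
  subst hy
  have h1 := (contMDiffAt_iff.1 (contMDiff f x)).2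
  have h2 := h1.contDiffAt (hX.range_mem_nhds x)
  have h3 := h2.hasStrictFDerivAt (by simp)
  have h4 := ((contMDiff f).mdifferentiable (by simp) x).hasMFDerivAt.2
  have h5 := h4.hasFDerivAt (hX.range_mem_nhds x)
  rw [h3.hasFDerivAt.unique h5] at h3
  exact h3

/-- Every vector which `g` maps to a tangent space of the hyper map `h₃` is tangent to a branch of
the hyper map `h₂` with image `g⁻¹(im h₃)`. -/
lemma exists_mem_tangentImage {W₂ W₃ : ManC} {g : Y ⟶ Z} {h₂ : W₂ ⟶ Y} {h₃ : W₃ ⟶ Z}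
    (H₂ : IsHyperMap h₂) (H₃ : IsHyperMap h₃) (hE : range h₂ = g ⁻¹' range h₃)
    (y : Y) (w : W₃) (hw : h₃ w = g y)
    (ht : LinearMap.range (tmap g y : Y.Vec →ₗ[ℝ] Z.Vec) ⊔ tangentImage h₃ w = ⊤)
    (v : Y.Vec) (hv : tmap g y v ∈ tangentImage h₃ w) :
    ∃ w' : W₂, h₂ w' = y ∧ v ∈ tangentImage h₂ w' := by
  obtain ⟨u, hu⟩ := hv
  replace hu : tmap h₃ w u = tmap g y v := hu
  have hY := H₂.boundaryless_target
  have hG := hasStrictFDerivAt_written hY g y (y := g y) rfl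
  have hK := hasStrictFDerivAt_written H₃.boundaryless_source h₃ w hw
  set a := extChartAt Y.model y y with ha
  set b := extChartAt W₃.model w w with hb
  have hG' : HasStrictFDerivAt (fun r : Y.Vec × W₃.Vec => written g y (g y) r.1)
      ((tmap g y).comp (ContinuousLinearMap.fst ℝ Y.Vec W₃.Vec)) (a, b) :=
    HasStrictFDerivAt.comp (a, b) (f := Prod.fst) hG hasStrictFDerivAt_fst
  have hK' : HasStrictFDerivAt (fun r : Y.Vec × W₃.Vec => written h₃ w (g y) r.2)
      ((tmap h₃ w).comp (ContinuousLinearMap.snd ℝ Y.Vec W₃.Vec)) (a, b) :=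
    HasStrictFDerivAt.comp (a, b) (f := Prod.snd) hK hasStrictFDerivAt_snd
  have hΦ := hG'.sub hK'
  obtain ⟨c, hc0, hc, hcΦ⟩ := exists_curve hΦ (v := (v, u)) (by
      rw [LinearMap.range_eq_top]
      intro z
      have hz : z ∈ LinearMap.range (tmap g y : Y.Vec →ₗ[ℝ] Z.Vec) ⊔ tangentImage h₃ w := by
        rw [ht]; trivial
      obtain ⟨_, ⟨v₁, rfl⟩, _, ⟨u₁, rfl⟩, rfl⟩ := Submodule.mem_sup.1 hz
      exact ⟨(v₁, -u₁), by simp⟩) (by simp [hu])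
  have hc1 : HasDerivAt (fun t => (c t).1) v 0 := by
    exact (hasFDerivAt_fst (p := c 0)).comp_hasDerivAt (0 : ℝ) hc
  have hc1t : Tendsto (fun t => (c t).1) (𝓝 0) (𝓝 a) := by
    have := hc1.continuousAt.tendsto
    simpa [hc0] using this
  have hc2t : Tendsto (fun t => (c t).2) (𝓝 0) (𝓝 b) := by
    have := hc.continuousAt.tendsto
    rw [hc0] at this
    exact (continuous_snd.tendsto _).comp this
  -- the curve in `Y`
  let γ : ℝ → Y := fun t => (extChartAt Y.model y).symm (c t).1
  have hγ : Tendsto γ (𝓝 0) (𝓝 y) := by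
    have := (continuousAt_extChartAt_symm (I := Y.model) y).tendsto
    rw [extChartAt_to_inv] at this
    exact this.comp hc1t
  have hγE : ∀ᶠ t in 𝓝 (0 : ℝ), γ t ∈ range h₂ := by
    have hκ : Tendsto (fun t => (extChartAt W₃.model w).symm (c t).2) (𝓝 0) (𝓝 w) := by
      have := (continuousAt_extChartAt_symm (I := W₃.model) w).tendsto
      rw [extChartAt_to_inv] at this
      exact this.comp hc2t
    have e1 : ∀ᶠ t in 𝓝 (0 : ℝ), g (γ t) ∈ (extChartAt Z.model (g y)).source :=
      ((continuous g).continuousAt.tendsto.comp hγ).eventually (extChartAt_source_mem_nhds _)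
    have e2 : ∀ᶠ t in 𝓝 (0 : ℝ), h₃ ((extChartAt W₃.model w).symm (c t).2) ∈
        (extChartAt Z.model (g y)).source := by
      refine ((continuous h₃).continuousAt.tendsto.comp hκ).eventually ?_
      rw [hw]
      exact extChartAt_source_mem_nhds _
    filter_upwards [e1, e2, hcΦ] with t t1 t2 t3
    rw [hE]
    refine ⟨(extChartAt W₃.model w).symm (c t).2, ?_⟩
    refine (extChartAt Z.model (g y)).injOn t2 t1 ?_
    have t4 : written g y (g y) (c t).1 - written h₃ w (g y) (c t).2 =
        written g y (g y) a - written h₃ w (g y) b := t3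
    have t5 : written g y (g y) a - written h₃ w (g y) b = 0 := by
      simp [written, ha, hb, hw]
    rw [t5, sub_eq_zero] at t4
    exact t4.symm
  classical
  obtain ⟨w₀, hw₀⟩ : ∃ w₀ : W₂, True := by
    obtain ⟨t, ⟨w₀, _⟩⟩ := hγE.exists
    exact ⟨w₀, trivial⟩
  let σ : ℝ → W₂ := fun t => if ht : γ t ∈ range h₂ then ht.choose else w₀
  have hσ : ∀ᶠ t in 𝓝 (0 : ℝ), h₂ (σ t) = γ t := by
    filter_upwards [hγE] with t ht
    simp only [σ, dif_pos ht]
    exact ht.choose_spec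
  let 𝒱 : Ultrafilter ℝ := Ultrafilter.of (𝓝[≠] (0 : ℝ))
  have h𝒱 : (𝒱 : Filter ℝ) ≤ 𝓝[≠] 0 := Ultrafilter.of_le _
  have h𝒱0 : (𝒱 : Filter ℝ) ≤ 𝓝 0 := h𝒱.trans nhdsWithin_le_nhds
  obtain ⟨w', hw', hle⟩ := (isProperMap_iff_ultrafilter.1 H₂.isProper).2 (𝒰 := 𝒱.map σ) (y := y) (by
    have : Tendsto (fun t => h₂ (σ t)) 𝒱 (𝓝 y) :=
      (hγ.mono_left h𝒱0).congr' ((hσ.filter_mono h𝒱0).mono fun t ht => ht.symm)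
    exact this)
  refine ⟨w', hw', ?_⟩
  have hσt : Tendsto σ 𝒱 (𝓝 w') := hle
  have hH := (hasStrictFDerivAt_written H₂.boundaryless_source h₂ w' hw').hasFDerivAt
  refine mem_range_of_curve hH (H₂.immersion w') h𝒱 (b := fun t => extChartAt W₂.model w' (σ t))
    ((continuousAt_extChartAt (I := W₂.model) w').tendsto.comp hσt) hc1 ?_ ?_
  · simp [written, hc0, hw', ha]
  · have e1 : ∀ᶠ t in (𝒱 : Filter ℝ), σ t ∈ (extChartAt W₂.model w').source :=
      hσt.eventually (extChartAt_source_mem_nhds _)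
    have e2 : ∀ᶠ t in (𝒱 : Filter ℝ), (c t).1 ∈ (extChartAt Y.model y).target :=
      (hc1t.eventually (hY.target_mem_nhds y)).filter_mono h𝒱0
    filter_upwards [e1, e2, hσ.filter_mono h𝒱0] with t t1 t2 t3
    simp only [written, Function.comp_apply]
    rw [(extChartAt W₂.model w').left_inv t1, t3]
    exact (extChartAt Y.model y).right_inv t2

lemma conormal_eq {h : W ⟶ X} (w : W) : conormal h w = (tangentImage h w).dualAnnihilator :=
  LinearMap.ker_dualMap_eq_dualAnnihilator_range _

lemma IsHyperMap.finrank_tangentImage {h : W ⟶ X} (H : IsHyperMap h) (w : W) :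
    Module.finrank ℝ (tangentImage h w) + 1 = X.dim := by
  have h1 : Module.finrank ℝ (tangentImage h w) = Module.finrank ℝ W.Vec :=
    LinearMap.finrank_range_of_inj (H.immersion w)
  rcases H.codim_one with h2 | h2
  · rw [h1]; simpa using h2
  · exact (h2.false w).elim

lemma IsHyperMap.tangentImage_ne_top {h : W ⟶ X} (H : IsHyperMap h) (w : W) :
    tangentImage h w ≠ ⊤ := by
  intro h1
  have h2 := H.finrank_tangentImage w
  rw [h1, finrank_top] at h2
  simp at h2

lemma dualAnnihilator_ne_bot {p : Submodule ℝ X.Vec} (hp : p ≠ ⊤) : p.dualAnnihilator ≠ ⊥ := by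
  intro h
  exact hp (Subspace.dualAnnihilator_inj.1 (h.trans Submodule.dualAnnihilator_top.symm))

lemma IsHyperMap.finite_fiber {h : W ⟶ X} (H : IsHyperMap h) (x : X) :
    Finite {w : W // h w = x} :=
  WellFoundedGT.finite_of_iSupIndep (H.selfTransversal x) fun w => by
    rw [conormal_eq]; exact dualAnnihilator_ne_bot (H.tangentImage_ne_top w.1)

lemma exists_comap_eq {W₂ W₃ : ManC} {g : Y ⟶ Z} {h₂ : W₂ ⟶ Y} {h₃ : W₃ ⟶ Z}
    (H₂ : IsHyperMap h₂) (H₃ : IsHyperMap h₃) (hE : range h₂ = g ⁻¹' range h₃)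
    (hg : IsMultiTransverseToMap g h₃) (y : Y) (w : W₃) (hw : h₃ w = g y) :
    ∃ w' : W₂, h₂ w' = y ∧
      (tangentImage h₃ w).comap (tmap g y : Y.Vec →ₗ[ℝ] Z.Vec) = tangentImage h₂ w' := by
  have := H₂.finite_fiber y
  set H := (tangentImage h₃ w).comap (tmap g y : Y.Vec →ₗ[ℝ] Z.Vec) with hH
  obtain ⟨w', hw'⟩ := Subspace.exists_eq_top_of_iUnion_eq_univ
    (p := fun w' : {w' : W₂ // h₂ w' = y} => (tangentImage h₂ w'.1).comap H.subtype) (by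
      refine eq_univ_of_forall fun v => mem_iUnion.2 ?_
      obtain ⟨w', h1, h2⟩ := exists_mem_tangentImage H₂ H₃ hE y w hw (hg.1 y w hw) v.1 v.2
      exact ⟨⟨w', h1⟩, h2⟩)
  refine ⟨w'.1, w'.2, ?_⟩
  have hle : H ≤ tangentImage h₂ w'.1 := by
    intro v hv
    have : (⟨v, hv⟩ : H) ∈ (tangentImage h₂ w'.1).comap H.subtype := by rw [hw']; trivial
    exact this
  refine Submodule.eq_of_le_of_finrank_le hle ?_
  have h1 := H₂.finrank_tangentImage w'.1
  have h2 := H₃.finrank_tangentImage w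
  let q : Y.Vec →ₗ[ℝ] Z.Vec ⧸ tangentImage h₃ w :=
    (tangentImage h₃ w).mkQ ∘ₗ (tmap g y : Y.Vec →ₗ[ℝ] Z.Vec)
  have h3 : LinearMap.ker q = H := by rw [LinearMap.ker_comp, Submodule.ker_mkQ]
  have h4 := LinearMap.finrank_range_add_finrank_ker q
  have h5 := Submodule.finrank_le (LinearMap.range q)
  have h6 := Submodule.finrank_quotient_add_finrank (tangentImage h₃ w)
  rw [h3] at h4
  simp only [finrank_euclideanSpace, Fintype.card_fin] at h4 h6
  omega

lemma isMultiTransverse_id {E : Set X} (hE : X.IsHyperSubset E) : IsMultiTransverse (𝟙 X) E := by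
  obtain ⟨W, h, H, hr⟩ := hE
  refine ⟨W, h, H, hr, fun y w _ => ?_, fun y => ?_⟩
  · rw [tmap_id]
    have : LinearMap.range (ContinuousLinearMap.id ℝ X.Vec : X.Vec →ₗ[ℝ] X.Vec) = ⊤ :=
      LinearMap.range_id
    rw [this, top_sup_eq]
  · have h1 := H.selfTransversal y
    simp only [conormal_eq] at h1
    rw [tmap_id]
    exact h1

lemma IsMultiTransverse.comp {f : X ⟶ Y} {g : Y ⟶ Z} {E : Set Y} {E' : Set Z}
    (hf : IsMultiTransverse f E) (hg : IsMultiTransverse g E') (hE : E = g ⁻¹' E') :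
    IsMultiTransverse (f ≫ g) E' := by
  obtain ⟨W₂, h₂, H₂, hr₂, hf⟩ := hf
  obtain ⟨W₃, h₃, H₃, hr₃, hg⟩ := hg
  have hr : range h₂ = g ⁻¹' range h₃ := by rw [hr₂, hr₃, hE]
  refine ⟨W₃, h₃, H₃, hr₃, fun x w hw => ?_, fun x => ?_⟩
  · obtain ⟨w', hw', h1⟩ := exists_comap_eq H₂ H₃ hr hg (f x) w hw
    have h2 := hf.1 x w' hw'
    have h3 := hg.1 (f x) w hw
    rw [eq_top_iff]
    rintro z -
    rw [← h1] at h2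
    have hz : z ∈ LinearMap.range (tmap g (f x) : Y.Vec →ₗ[ℝ] Z.Vec) ⊔ tangentImage h₃ w := by
      rw [h3]; trivial
    obtain ⟨_, ⟨y, rfl⟩, r, hr, rfl⟩ := Submodule.mem_sup.1 hz
    have hy : y ∈ LinearMap.range (tmap f x : X.Vec →ₗ[ℝ] Y.Vec) ⊔
        (tangentImage h₃ w).comap (tmap g (f x) : Y.Vec →ₗ[ℝ] Z.Vec) := by rw [h2]; trivial
    obtain ⟨_, ⟨v, rfl⟩, r', hr', rfl⟩ := Submodule.mem_sup.1 hy
    refine Submodule.mem_sup.2 ⟨_, ⟨v, rfl⟩, tmap g (f x) r' + r, add_mem hr' hr, ?_⟩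
    simp [tmap_comp, add_assoc]
  · choose σ hσ hσ' using fun w : {w : W₃ // h₃ w = g (f x)} =>
      exists_comap_eq H₂ H₃ hr hg (f x) w.1 w.2
    have hinj : Function.Injective fun w => (⟨σ w, hσ w⟩ : {w : W₂ // h₂ w = f x}) := by
      intro w w' hww
      have h1 : σ w = σ w' := congrArg Subtype.val hww
      refine (hg.2 (f x)).injective (fun w => ?_) ?_
      · rw [hσ' w]
        exact dualAnnihilator_ne_bot (H₂.tangentImage_ne_top _)
      · dsimp only
        rw [hσ' w, hσ' w', h1]
    refine ((hf.2 x).comp hinj).mono fun w => le_of_eq ?_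
    simp only [Function.comp_apply]
    rw [← hσ' w, tmap_comp]
    rfl

end Closure

end ManC

/-! ### Charts and rectilinear maps -/

namespace ManC

/-- The model `ℝⁿₖ = [0,∞)ᵏ × ℝⁿ⁻ᵏ`. -/
def orthant (n k : ℕ) : Set (EuclideanSpace ℝ (Fin n)) := {v | ∀ i : Fin n, i.1 < k → 0 ≤ v i}

/-- `φ` restricts to a coordinate chart on the open set `U` of `C`: a diffeomorphism of `U` onto a
relatively open subset of `ℝⁿₖ`.  (Values of `φ` outside `U` are irrelevant.) -/
structure IsChart (C : ManC) {n : ℕ} (k : ℕ) (U : Set C) (φ : C → EuclideanSpace ℝ (Fin n)) :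
    Prop where
  isOpen_source : IsOpen U
  isOpen_image : ∃ O, IsOpen O ∧ φ '' U = O ∩ orthant n k
  contMDiffOn : ContMDiffOn C.model 𝓘(ℝ, EuclideanSpace ℝ (Fin n)) ∞ φ U
  contMDiffOn_inv : ∃ ψ : EuclideanSpace ℝ (Fin n) → C,
    ContMDiffOn 𝓘(ℝ, EuclideanSpace ℝ (Fin n)) C.model ∞ ψ (φ '' U) ∧ ∀ c ∈ U, ψ (φ c) = c

/-- A map from a manifold with corners `C` to a manifold without boundary `M` is rectilinear if it is
injective on the points of depth zero and, in suitable charts centred at any `c` and at `f c`,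
it is the inclusion of (an open subset of) `ℝⁿₖ` in `ℝⁿ`. -/
def IsRectilinear {C M : ManC} (f : C → M) : Prop :=
  InjOn f {c | C.depth c = 0} ∧
  ∀ c : C, ∃ (k : ℕ) (U : Set C) (φ : C → M.Vec) (V : Set M) (ψ : M → M.Vec),
    c ∈ U ∧ C.IsChart k U φ ∧ φ c = 0 ∧ f c ∈ V ∧ M.IsChart 0 V ψ ∧ ψ (f c) = 0 ∧
    ∀ c' ∈ U, f c' ∈ V ∧ ψ (f c') = φ c'

end ManC

/-! ### Germs of connected components and the blowup -/

open TopologicalSpace (Opens)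

/-- The set `I(X, U)` of pairs of a point `x` of `X` and a germ at `x` of connected components of `U`,
i.e. an element of the inverse limit, over the open neighbourhoods `V` of `x`, of the sets of those
connected components of `V ∩ U` that have `x` in their closure.

Here `comp V` is the component belonging to `V`; for the sake of extensionality it is `∅` when
`V` is not a neighbourhood of the point. -/
@[ext] structure GermSpace (X : Type) [TopologicalSpace X] (U : Set X) where
  pt : X
  comp : Opens X → Set X
  isComponent : ∀ V : Opens X, pt ∈ V →
    ∃ x ∈ (V : Set X) ∩ U, comp V = connectedComponentIn ((V : Set X) ∩ U) x
  mem_closure : ∀ V : Opens X, pt ∈ V → pt ∈ closure (comp V)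
  compatible : ∀ V₁ V₂ : Opens X, pt ∈ V₁ → V₁ ≤ V₂ → comp V₁ ⊆ comp V₂
  comp_eq_empty : ∀ V : Opens X, pt ∉ V → comp V = ∅

namespace GermSpace

variable {X Y : Type} [TopologicalSpace X] [TopologicalSpace Y] {U : Set X} {U' : Set Y}

/-- The topology on `I(X, U)` generated by the sets of all germs which are based in an open set `V` and
contained in a given connected component `C` of `V ∩ U`. -/
instance : TopologicalSpace (GermSpace X U) :=
  TopologicalSpace.generateFrom
    {N | ∃ (V : Opens X) (C : Set X), N = {g | g.pt ∈ V ∧ g.comp V = C}}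

lemma comp_preconnected (g : GermSpace X U) (V : Opens X) : IsPreconnected (g.comp V) := by
  by_cases h : g.pt ∈ V
  · obtain ⟨x, _, hx⟩ := g.isComponent V h
    rw [hx]; exact isPreconnected_connectedComponentIn
  · rw [g.comp_eq_empty V h]; exact isPreconnected_empty

lemma comp_subset (g : GermSpace X U) (V : Opens X) : g.comp V ⊆ (V : Set X) ∩ U := by
  by_cases h : g.pt ∈ V
  · obtain ⟨x, _, hx⟩ := g.isComponent V h
    rw [hx]; exact connectedComponentIn_subset _ _
  · rw [g.comp_eq_empty V h]; exact empty_subset _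

lemma comp_nonempty (g : GermSpace X U) (V : Opens X) (h : g.pt ∈ V) : (g.comp V).Nonempty := by
  obtain ⟨x, hx, hx'⟩ := g.isComponent V h
  exact ⟨x, hx' ▸ mem_connectedComponentIn hx⟩

/-- A continuous map of pairs `(X, U) → (Y, U')` induces a map `I(X, U) → I(Y, U')`: the component of
the image germ belonging to `V` is the component of `V ∩ U'` which contains the image of
the component belonging to `f⁻¹(V)`. -/
def map (f : X → Y) (hf : Continuous f) (h : MapsTo f U U') (g : GermSpace X U) :
    GermSpace Y U' where
  pt := f g.pt
  comp V := ⋃ x ∈ g.comp ⟨f ⁻¹' V, V.isOpen.preimage hf⟩,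
    connectedComponentIn ((V : Set Y) ∩ U') (f x)
  isComponent V hV := by
    obtain ⟨x, hx⟩ := g.comp_nonempty ⟨f ⁻¹' V, V.isOpen.preimage hf⟩ hV
    have hsub : ∀ x ∈ g.comp ⟨f ⁻¹' V, V.isOpen.preimage hf⟩, f x ∈ (V : Set Y) ∩ U' :=
      fun x hx => ⟨(g.comp_subset _ hx).1, h (g.comp_subset _ hx).2⟩
    refine ⟨f x, hsub x hx, Subset.antisymm (iUnion₂_subset fun y hy => ?_) fun z hz =>
      mem_iUnion₂.2 ⟨x, hx, hz⟩⟩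
    refine (connectedComponentIn_eq ?_).symm.subset
    refine ((g.comp_preconnected _).image f hf.continuousOn).subset_connectedComponentIn
      (mem_image_of_mem f hx) ?_ (mem_image_of_mem f hy)
    rintro _ ⟨z, hz, rfl⟩
    exact hsub z hz
  mem_closure V hV := by
    have h1 := g.mem_closure ⟨f ⁻¹' V, V.isOpen.preimage hf⟩ hV
    refine closure_mono ?_ (image_closure_subset_closure_image hf (mem_image_of_mem f h1))
    rintro _ ⟨x, hx, rfl⟩
    refine mem_iUnion₂.2 ⟨x, hx, mem_connectedComponentIn ?_⟩
    exact ⟨(g.comp_subset _ hx).1, h (g.comp_subset _ hx).2⟩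
  compatible V₁ V₂ h1 h12 := by
    refine iUnion₂_subset fun x hx => ?_
    have hx' := g.compatible ⟨f ⁻¹' V₁, V₁.isOpen.preimage hf⟩ ⟨f ⁻¹' V₂, V₂.isOpen.preimage hf⟩ h1
      (fun y hy => h12 hy) hx
    exact fun z hz => mem_iUnion₂.2
      ⟨x, hx', connectedComponentIn_mono _ (inter_subset_inter_left _ h12) hz⟩
  comp_eq_empty V hV := by
    rw [g.comp_eq_empty ⟨f ⁻¹' V, V.isOpen.preimage hf⟩ hV]
    simp

end GermSpace

/-- The blowup `B(X, E) = I(X, X ∖ E)` of a manifold at a subset, as a topological space. -/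
abbrev Blowup (X : ManC) (E : Set X) : Type := GermSpace X Eᶜ

/-- The map `B(f) : B(X, E) → B(Y, E')` induced by a map `f : X ⟶ Y` with `f⁻¹(E') = E`. -/
def Blowup.map {X Y : ManC} {E : Set X} {E' : Set Y} (f : X ⟶ Y) (h : f ⁻¹' E' = E) :
    Blowup X E → Blowup Y E' :=
  GermSpace.map f (ManC.continuous f) fun _ hx hx' => hx (h.subset hx')

/-! ### Proper étale groupoids -/

/-- A proper étale groupoid (with corners). -/
structure PEG extends Gpd ManC where
  etale_s : ManC.IsEtale s
  etale_t : ManC.IsEtale t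
  etale_e : ManC.IsEtale e
  etale_i : ManC.IsEtale i
  etale_m : ManC.IsEtale m
  proper : IsProperMap fun a : X1 => (s a, t a)

/-- A refinement: a smooth functor which is an equivalence of categories (it is fully faithful and
essentially surjective) and étale on objects. -/
structure IsRefinement {X Y : Gpd ManC} (F : X ⟶ Y) : Prop where
  etale : ManC.IsEtale F.f0
  fullyFaithful : ∀ (x x' : X.X0) (b : Y.X1), Y.s b = F.f0 x → Y.t b = F.f0 x' →
    ∃! a : X.X1, X.s a = x ∧ X.t a = x' ∧ F.f1 a = b
  essSurj : ∀ y : Y.X0, ∃ (x : X.X0) (b : Y.X1), Y.s b = F.f0 x ∧ Y.t b = y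

/-- The proper étale groupoids with corners, with those smooth functors which are perfectly simple
on objects, and all smooth natural transformations. -/
def perfectlySimpleCells : LocallyFull (Gpd ManC) where
  Obj := PEG
  ι X := X.toGpd
  P F := ManC.IsPerfectlySimple F.f0
  id_mem X := ManC.IsPerfectlySimple.id X.X0
  comp_mem hF hG := hF.comp hG

/-- The bicategory of proper étale groupoids with corners and perfectly simple maps. -/
abbrev PEGps := perfectlySimpleCells.Cells

/-- A marked proper étale groupoid: a proper étale groupoid without boundary together with a hyper
subset of the objects which is a union of orbits. -/
structure MarkedPEG extends PEG where
  boundaryless : X0.IsBoundaryless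
  E : Set X0
  hyper : X0.IsHyperSubset E
  invariant : s ⁻¹' E = t ⁻¹' E

/-- The marked proper étale groupoids without boundary, with those smooth functors which on objects
are multi-transverse to the marking of the codomain and pull it back to the marking of the
domain, and all smooth natural transformations. -/
def markedCells : LocallyFull (Gpd ManC) where
  Obj := MarkedPEG
  ι X := X.toGpd
  P {X Y} F := ManC.IsMultiTransverse F.f0 Y.E ∧ F.f0 ⁻¹' Y.E = X.E
  id_mem X := ⟨ManC.isMultiTransverse_id X.hyper, rfl⟩
  comp_mem hF hG := ⟨hF.1.comp hG.1 hG.2.symm, by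
    rw [← hF.2, ← hG.2]; rfl⟩

/-- The bicategory of marked proper étale groupoids without boundary. -/
abbrev PEGplus := markedCells.Cells

namespace MarkedPEG

variable (X : MarkedPEG)

/-- The marking `s⁻¹(E)` of the manifold of arrows. -/
abbrev E1 : Set X.X1 := X.s ⁻¹' X.E

/-- The marking of the manifold of composable arrows: the preimage of `E` under the first object. -/
abbrev E2 : Set X.X2 := (X.p ≫ X.s) ⁻¹' X.E

lemma preimage_s : X.s ⁻¹' X.E = X.E1 := rfl

lemma preimage_t : X.t ⁻¹' X.E = X.E1 := X.invariant.symm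

lemma preimage_e : X.e ⁻¹' X.E1 = X.E := by
  change (X.e ≫ X.s) ⁻¹' X.E = X.E
  rw [X.e_s]; rfl

lemma preimage_i : X.i ⁻¹' X.E1 = X.E1 := by
  change (X.i ≫ X.s) ⁻¹' X.E = X.E1
  rw [X.i_s]; exact X.preimage_t

lemma preimage_p : X.p ⁻¹' X.E1 = X.E2 := rfl

lemma preimage_q : X.q ⁻¹' X.E1 = X.E2 := by
  change (X.q ≫ X.s) ⁻¹' X.E = X.E2
  rw [← X.isPullback.w]
  change X.p ⁻¹' (X.t ⁻¹' X.E) = X.E2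
  rw [X.preimage_t]; rfl

lemma preimage_m : X.m ⁻¹' X.E1 = X.E2 := by
  change (X.m ≫ X.s) ⁻¹' X.E = X.E2
  rw [X.m_s]

end MarkedPEG

namespace PEGplus

variable {X Y : PEGplus}

/-- The underlying smooth functor of a 1-cell. -/
abbrev functor (F : X ⟶ Y) : X.obj.toGpd ⟶ Y.obj.toGpd := LocallyFull.Hom.hom F

/-- The underlying smooth natural transformation of a 2-cell. -/
abbrev trans {F G : X ⟶ Y} (η : F ⟶ G) : functor F ⟶ functor G := LocallyFull.Hom₂.hom η

lemma preimage_f0 (F : X ⟶ Y) : (functor F).f0 ⁻¹' Y.obj.E = X.obj.E :=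
  (LocallyFull.Hom.mem F).2

lemma preimage_f1 (F : X ⟶ Y) : (functor F).f1 ⁻¹' Y.obj.E1 = X.obj.E1 := by
  change ((functor F).f1 ≫ Y.obj.s) ⁻¹' Y.obj.E = X.obj.E1
  rw [(functor F).f1_s]
  change X.obj.s ⁻¹' ((functor F).f0 ⁻¹' Y.obj.E) = _
  rw [preimage_f0]

lemma preimage_α {F G : X ⟶ Y} (η : F ⟶ G) : (trans η).α ⁻¹' Y.obj.E1 = X.obj.E := by
  change ((trans η).α ≫ Y.obj.s) ⁻¹' Y.obj.E = X.obj.E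
  rw [(trans η).α_s]; exact preimage_f0 F

end PEGplus

namespace PEGps

variable {X Y : PEGps}

/-- The underlying smooth functor of a 1-cell. -/
abbrev functor (F : X ⟶ Y) : X.obj.toGpd ⟶ Y.obj.toGpd := LocallyFull.Hom.hom F

/-- The underlying smooth natural transformation of a 2-cell. -/
abbrev trans {F G : X ⟶ Y} (η : F ⟶ G) : functor F ⟶ functor G := LocallyFull.Hom₂.hom η

end PEGps

/-- The refinements among the 1-cells of `PEGplus`. -/
def refinementsPlus : ∀ ⦃X Y : PEGplus⦄, (X ⟶ Y) → Prop :=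
  fun _ _ F => IsRefinement (PEGplus.functor F)

/-- The refinements among the 1-cells of `PEGps`. -/
def refinementsPs : ∀ ⦃X Y : PEGps⦄, (X ⟶ Y) → Prop :=
  fun _ _ F => IsRefinement (PEGps.functor F)

/-- Marked orbifolds without boundary. -/
abbrev OrbPlus := TwoLoc refinementsPlus

/-- Orbifolds with corners and perfectly simple maps. -/
abbrev OrbPs := TwoLoc refinementsPs

/-- The strict 2-functor `𝔹` is given by applying the blowup `B` to the manifolds of objects, arrows and
composable arrows, to all structure maps, to functors and to natural transformations.

The homeomorphisms `φ₀`, `φ₁`, `φ₂` identify the manifolds occurring in `𝔹(X, E)` with the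
blowups `B(X₀, E)`, `B(X₁, s⁻¹E)`, `B(X₂, p₁⁻¹E)`, in such a way that the canonical maps to `X₀`, `X₁`,
`X₂` are rectilinear. -/
structure ExtendsBlowup (𝔹 : StrictPseudofunctor PEGplus PEGps) where
  φ₀ : ∀ X : PEGplus, (𝔹.obj X).obj.X0 ≃ₜ Blowup X.obj.X0 X.obj.E
  φ₁ : ∀ X : PEGplus, (𝔹.obj X).obj.X1 ≃ₜ Blowup X.obj.X1 X.obj.E1
  φ₂ : ∀ X : PEGplus, (𝔹.obj X).obj.X2 ≃ₜ Blowup X.obj.X2 X.obj.E2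
  rectilinear₀ : ∀ X : PEGplus, ManC.IsRectilinear fun b => (φ₀ X b).pt
  rectilinear₁ : ∀ X : PEGplus, ManC.IsRectilinear fun b => (φ₁ X b).pt
  rectilinear₂ : ∀ X : PEGplus, ManC.IsRectilinear fun b => (φ₂ X b).pt
  map_s : ∀ (X : PEGplus) b,
    φ₀ X ((𝔹.obj X).obj.s b) = Blowup.map X.obj.s X.obj.preimage_s (φ₁ X b)
  map_t : ∀ (X : PEGplus) b,
    φ₀ X ((𝔹.obj X).obj.t b) = Blowup.map X.obj.t X.obj.preimage_t (φ₁ X b)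
  map_e : ∀ (X : PEGplus) b,
    φ₁ X ((𝔹.obj X).obj.e b) = Blowup.map X.obj.e X.obj.preimage_e (φ₀ X b)
  map_i : ∀ (X : PEGplus) b,
    φ₁ X ((𝔹.obj X).obj.i b) = Blowup.map X.obj.i X.obj.preimage_i (φ₁ X b)
  map_p : ∀ (X : PEGplus) b,
    φ₁ X ((𝔹.obj X).obj.p b) = Blowup.map X.obj.p X.obj.preimage_p (φ₂ X b)
  map_q : ∀ (X : PEGplus) b,
    φ₁ X ((𝔹.obj X).obj.q b) = Blowup.map X.obj.q X.obj.preimage_q (φ₂ X b)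
  map_m : ∀ (X : PEGplus) b,
    φ₁ X ((𝔹.obj X).obj.m b) = Blowup.map X.obj.m X.obj.preimage_m (φ₂ X b)
  map_f0 : ∀ {X Y : PEGplus} (F : X ⟶ Y) b,
    φ₀ Y ((PEGps.functor (𝔹.map F)).f0 b) =
      Blowup.map (PEGplus.functor F).f0 (PEGplus.preimage_f0 F) (φ₀ X b)
  map_f1 : ∀ {X Y : PEGplus} (F : X ⟶ Y) b,
    φ₁ Y ((PEGps.functor (𝔹.map F)).f1 b) =
      Blowup.map (PEGplus.functor F).f1 (PEGplus.preimage_f1 F) (φ₁ X b)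
  map_α : ∀ {X Y : PEGplus} {F G : X ⟶ Y} (η : F ⟶ G) b,
    φ₁ Y ((PEGps.trans (𝔹.map₂ η)).α b) =
      Blowup.map (PEGplus.trans η).α (PEGplus.preimage_α η) (φ₀ X b)

/-- The canonical maps `B(X_i, E_i) → X_i` are the components of the strict natural transformation
`β`, from `𝔹` to the forgetful 2-functor, both regarded as 2-functors to smooth groupoids. -/
def IsCanonical {𝔹 : StrictPseudofunctor PEGplus PEGps} (φ : ExtendsBlowup 𝔹)
    (β : StrictTrans (𝔹.comp perfectlySimpleCells.incl) markedCells.incl) : Prop :=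
  ∀ X : PEGplus,
    (∀ b : (𝔹.obj X).obj.X0, (Gpd.Fun.f0 (β.app X) : (𝔹.obj X).obj.X0 ⟶ X.obj.X0) b =
      (φ.φ₀ X b).pt) ∧
    ∀ b : (𝔹.obj X).obj.X1, (Gpd.Fun.f1 (β.app X) : (𝔹.obj X).obj.X1 ⟶ X.obj.X1) b =
      (φ.φ₁ X b).pt

end HyperBlowup

end

noncomputable section

namespace HyperBlowup

open TopologicalSpace (Opens)
open Filter

/-! ### Germs of components: topology -/

namespace GermSpace

variable {X Y Z : Type} [TopologicalSpace X] [TopologicalSpace Y] [TopologicalSpace Z]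
  {U : Set X} {U' : Set Y} {U'' : Set Z}

/-! A hyper subset is locally a union of coordinate hyperplanes. Each branch of a hyper map is cut
out near its image point by a function with nonzero differential (`IsHyperMap.exists_equation`).
Properness shows that near $x$ the image consists only of the branches through $x$, and the
injectivity condition makes the differentials of their equations independent
(`IsHyperMap.isSystem`). By the inverse function theorem these equations are part of a coordinate
system (`IsSystem.exists_box`). In the resulting `Box` the components of the complement of $E$ are
open orthants, and a germ of components is a point together with an orthant that has it in its
closure. Hence the blowup is locally a closed orthant, and its changes of charts are restrictions of
those of $X$.

A map into the blowup is weakly smooth once it is continuous and its projection is smooth; the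
monomial form of the boundary coordinates needs an argument. Along a transversal $f$, the
coordinates that cut out $E$ pull back to functions that have independent differentials and cut out
$f^{-1}E$. Two such systems agree up to order and invertible factors (`IsSystem.compare`): a
submersion whose zeros lie in coordinate hyperplanes vanishes on the whole of one of them, and
Hadamard's lemma divides it by that coordinate. The factors are positive because $B(f)$ carries the
chosen orthant into the chosen orthant. So the exponents form a permutation matrix, and $B(f)$ is
perfectly simple.

If $f$ is étale, a germ in the source is the same as a point $x$ and a germ at $f(x)$
(`GermSpace.map_injOn_fibre`, `GermSpace.exists_map_eq`, `GermSpace.tendsto_of_tendsto_map`), so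
that the blowup of the source is the pullback of the blowup of the target (`IsNC.isPullback`).
Applied to the source map of a groupoid, this says that an arrow of the blowup is an arrow of
$X_\bullet$ with a germ at its source: the projection $\beta$ is a discrete fibration. The groupoid
axioms, functoriality and naturality are inherited from $X_\bullet$ because arrows are determined by
projection and source; properness and the refinement property follow by lifting points along étale
maps.

The 2-localization is presented by generators and relations. A pseudofunctor that turns refinements
into adjoint equivalences therefore extends to it by recursion (`AdjointInverses.lift`), and this
applies to $B$ followed by the localization of the target. -/

lemma comp_eq_of_mem (g : GermSpace X U) {V : Opens X} {x : X} (hx : x ∈ g.comp V) :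
    g.comp V = connectedComponentIn ((V : Set X) ∩ U) x := by
  have h : g.pt ∈ V := by
    by_contra h
    rw [g.comp_eq_empty V h] at hx
    exact hx
  obtain ⟨y, _, hy⟩ := g.isComponent V h
  rw [hy] at hx ⊢
  exact connectedComponentIn_eq hx

/-- A preconnected subset of `V ∩ U` which meets the component of a germ is contained in it. -/
lemma subset_comp (g : GermSpace X U) {V : Opens X} {A : Set X} (hA : IsPreconnected A)
    (hAV : A ⊆ (V : Set X) ∩ U) (h : (A ∩ g.comp V).Nonempty) : A ⊆ g.comp V := by
  obtain ⟨x, hxA, hx⟩ := h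
  rw [g.comp_eq_of_mem hx]
  exact hA.subset_connectedComponentIn hxA hAV

lemma comp_eq_of_inter_nonempty (g g' : GermSpace X U) {V : Opens X}
    (h : (g.comp V ∩ g'.comp V).Nonempty) : g.comp V = g'.comp V := by
  obtain ⟨x, hx, hx'⟩ := h
  rw [g.comp_eq_of_mem hx, g'.comp_eq_of_mem hx']

/-- Components over a smaller neighbourhood lie in those over a larger one, and components that meet
are equal. Germs at one point can therefore be compared on a neighbourhood basis. -/
lemma ext_of_inter {g g' : GermSpace X U} (hpt : g.pt = g'.pt)
    (h : ∀ V : Opens X, g.pt ∈ V → ∃ V' ≤ V, g.pt ∈ V' ∧ (g.comp V' ∩ g'.comp V').Nonempty) :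
    g = g' := by
  refine GermSpace.ext hpt (funext fun V => ?_)
  by_cases hV : g.pt ∈ V
  · obtain ⟨V', hV', hg, x, hx, hx'⟩ := h V hV
    exact comp_eq_of_inter_nonempty g g'
      ⟨x, g.compatible _ _ hg hV' hx, g'.compatible _ _ (hpt ▸ hg) hV' hx'⟩
  · rw [g.comp_eq_empty V hV, g'.comp_eq_empty V (hpt ▸ hV)]

/-- The basic neighbourhoods of germs. -/
lemma isOpen_basic (V : Opens X) (C : Set X) :
    IsOpen {g : GermSpace X U | g.pt ∈ V ∧ g.comp V = C} :=
  TopologicalSpace.isOpen_generateFrom_of_mem ⟨V, C, rfl⟩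

lemma continuous_pt : Continuous (pt : GermSpace X U → X) := by
  refine continuous_def.2 fun O hO => ?_
  have : (pt : GermSpace X U → X) ⁻¹' O =
      ⋃ C : Set X, {g : GermSpace X U | g.pt ∈ (⟨O, hO⟩ : Opens X) ∧ g.comp ⟨O, hO⟩ = C} := by
    ext g
    simp
  rw [this]
  exact isOpen_iUnion fun C => isOpen_basic _ _

/-- A generating open set contains `g` only if its prescribed component is that of `g`. Convergence
thus means that over each neighbourhood the component is eventually constant. -/
lemma tendsto_nhds_iff {α : Type*} {l : Filter α} {F : α → GermSpace X U} {g : GermSpace X U} :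
    Tendsto F l (𝓝 g) ↔ ∀ V : Opens X, g.pt ∈ V →
      ∀ᶠ a in l, (F a).pt ∈ V ∧ (F a).comp V = g.comp V := by
  rw [TopologicalSpace.tendsto_nhds_generateFrom_iff]
  constructor
  · intro h V hV
    exact h _ ⟨V, g.comp V, rfl⟩ ⟨hV, rfl⟩
  · rintro h _ ⟨V, C, rfl⟩ ⟨hV, rfl⟩
    exact h V hV

lemma mem_map_comp {f : X → Y} {hf : Continuous f} {h : MapsTo f U U'} (g : GermSpace X U)
    {V : Opens Y} {x : X} (hx : x ∈ g.comp ⟨f ⁻¹' V, V.isOpen.preimage hf⟩) :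
    f x ∈ (map f hf h g).comp V :=
  mem_iUnion₂.2 ⟨x, hx, mem_connectedComponentIn
    ⟨(g.comp_subset _ hx).1, h (g.comp_subset _ hx).2⟩⟩

/-- The component of the image germ over `V` depends only on the component over `f⁻¹(V)`; this is
what makes induced maps continuous. -/
lemma map_comp_eq {f : X → Y} {hf : Continuous f} {h : MapsTo f U U'} {g g' : GermSpace X U}
    {V : Opens Y} (hV : g.comp ⟨f ⁻¹' V, V.isOpen.preimage hf⟩ =
      g'.comp ⟨f ⁻¹' V, V.isOpen.preimage hf⟩) :
    (map f hf h g).comp V = (map f hf h g').comp V := by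
  change (⋃ x ∈ g.comp _, _) = ⋃ x ∈ g'.comp _, _
  rw [hV]

lemma continuous_map {f : X → Y} (hf : Continuous f) (h : MapsTo f U U') :
    Continuous (map f hf h) := by
  refine continuous_iff_continuousAt.2 fun g => tendsto_nhds_iff.2 fun V hV => ?_
  let W : Opens X := ⟨f ⁻¹' V, V.isOpen.preimage hf⟩
  have hg : g ∈ {g' : GermSpace X U | g'.pt ∈ W ∧ g'.comp W = g.comp W} := ⟨hV, rfl⟩
  filter_upwards [(isOpen_basic W (g.comp W)).mem_nhds hg] with g' hg'
  exact ⟨hg'.1, map_comp_eq hg'.2⟩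

lemma map_id (h : MapsTo id U U) (g : GermSpace X U) : map id continuous_id h g = g := by
  refine ext_of_inter rfl fun V hV => ⟨V, le_rfl, hV, ?_⟩
  obtain ⟨x, hx⟩ := g.comp_nonempty V hV
  exact ⟨x, mem_map_comp (f := id) g hx, hx⟩

lemma map_map {f : X → Y} (hf : Continuous f) (h : MapsTo f U U') {f' : Y → Z}
    (hf' : Continuous f') (h' : MapsTo f' U' U'') (g : GermSpace X U) :
    map f' hf' h' (map f hf h g) = map (f' ∘ f) (hf'.comp hf) (h'.comp h) g := by
  refine ext_of_inter rfl fun V hV => ⟨V, le_rfl, hV, ?_⟩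
  obtain ⟨x, hx⟩ := g.comp_nonempty ⟨f ⁻¹' (f' ⁻¹' V), (V.isOpen.preimage hf').preimage hf⟩ hV
  exact ⟨f' (f x), mem_map_comp _ (mem_map_comp _ hx), mem_map_comp (f := f' ∘ f) g hx⟩

/-- The germ determined by a filter with a basis of connected subsets of `U`. -/
def ofFilter (x : X) (F : Filter X) [F.NeBot] (hx : F ≤ 𝓝 x) (hU : U ∈ F)
    (hF : ∀ A ∈ F, ∃ B ∈ F, B ⊆ A ∧ IsPreconnected B) : GermSpace X U where
  pt := x
  -- All points of a connected member of `F` inside `V ∩ U` lie in one component, so the condition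
  -- on `y` selects a single component. The clause `x ∈ V` produces the default value `∅`.
  comp V := {z | x ∈ V ∧ ∀ᶠ y in F, z ∈ connectedComponentIn ((V : Set X) ∩ U) y}
  isComponent V hV := by
    obtain ⟨B, hB, hBV, hBc⟩ := hF ((V : Set X) ∩ U) (inter_mem (hx (V.isOpen.mem_nhds hV)) hU)
    obtain ⟨y, hy⟩ := F.nonempty_of_mem hB
    refine ⟨y, hBV hy, Subset.antisymm ?_ fun z hz => ⟨hV, ?_⟩⟩
    · rintro z ⟨_, hz⟩
      obtain ⟨y', hy'B, hy'⟩ := F.nonempty_of_mem (inter_mem hB hz)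
      rw [connectedComponentIn_eq (hBc.subset_connectedComponentIn hy hBV hy'B)]
      exact hy'
    · filter_upwards [hB] with y' hy'
      rw [← connectedComponentIn_eq (hBc.subset_connectedComponentIn hy hBV hy')]
      exact hz
  mem_closure V hV := by
    obtain ⟨B, hB, hBV, hBc⟩ := hF ((V : Set X) ∩ U) (inter_mem (hx (V.isOpen.mem_nhds hV)) hU)
    refine mem_closure_iff_nhds.2 fun N hN => ?_
    obtain ⟨y, hyN, hyB⟩ := F.nonempty_of_mem (inter_mem (hx hN) hB)
    refine ⟨y, hyN, hV, ?_⟩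
    filter_upwards [hB] with y' hy'
    exact hBc.subset_connectedComponentIn hy' hBV hyB
  compatible V₁ V₂ h1 h12 := by
    rintro z ⟨_, hz⟩
    exact ⟨h12 h1, hz.mono fun y hy =>
      connectedComponentIn_mono _ (inter_subset_inter_left _ h12) hy⟩
  comp_eq_empty V hV := by
    ext z
    simp [hV]

lemma ofFilter_comp {x : X} {F : Filter X} [F.NeBot] {hx : F ≤ 𝓝 x} {hU : U ∈ F}
    {hF : ∀ A ∈ F, ∃ B ∈ F, B ⊆ A ∧ IsPreconnected B} {V : Opens X} (hV : x ∈ V) {B : Set X}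
    (hB : B ∈ F) (hBV : B ⊆ (V : Set X) ∩ U) (hBc : IsPreconnected B) :
    B ⊆ (ofFilter x F hx hU hF).comp V := by
  refine fun y hy => ⟨hV, ?_⟩
  filter_upwards [hB] with y' hy'
  exact hBc.subset_connectedComponentIn hy' hBV hy

/-! Germs and local homeomorphisms -/

section LocalHomeomorph

variable {f : X → Y} (hf : Continuous f) (h : f ⁻¹' U' = U)

/-- The neighbourhood of `V` in the source of a local inverse. -/
lemma exists_opens (Φ : OpenPartialHomeomorph X Y) (V : Opens X) :
    ∃ V' : Opens Y, (V' : Set Y) = Φ '' ((V : Set X) ∩ Φ.source) := by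
  refine ⟨⟨_, Φ.isOpen_image_of_subset_source (V.isOpen.inter Φ.open_source)
    inter_subset_right⟩, rfl⟩

/-- Near a point of the source of a local homeomorphism, a germ is determined by its image. -/
lemma comp_eq_of_map_comp_eq (Φ : OpenPartialHomeomorph X Y) (hΦ : EqOn f Φ Φ.source)
    {V : Opens X} {V' : Opens Y} (hV' : (V' : Set Y) = Φ '' ((V : Set X) ∩ Φ.source))
    {g g' : GermSpace X U} (hg : g.pt ∈ V) (hg' : g'.pt ∈ V) (hgs : g.pt ∈ Φ.source)
    (hgs' : g'.pt ∈ Φ.source)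
    (he : (map (U' := U') f hf h.symm.subset g).comp V' =
      (map (U' := U') f hf h.symm.subset g').comp V') :
    g.comp V = g'.comp V := by
  -- The component over `V` may leave the source of `Φ`. A point of the component over a smaller
  -- neighbourhood `O` lies in the source and is mapped into the image component over `V'`.
  have key : ∀ g : GermSpace X U, g.pt ∈ V → g.pt ∈ Φ.source →
      ∃ x ∈ g.comp V, f x ∈ (map (U' := U') f hf h.symm.subset g).comp V' ∧
        x ∈ Φ.source := by
    intro g hg hgs
    have hm : g.pt ∈ f ⁻¹' V' := by
      change f g.pt ∈ (V' : Set Y)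
      rw [hV', hΦ hgs]
      exact mem_image_of_mem Φ ⟨hg, hgs⟩
    let O : Opens X := ⟨(V : Set X) ∩ Φ.source ∩ f ⁻¹' V',
      (V.isOpen.inter Φ.open_source).inter (V'.isOpen.preimage hf)⟩
    have hO : g.pt ∈ O := ⟨⟨hg, hgs⟩, hm⟩
    obtain ⟨x, hx⟩ := g.comp_nonempty O hO
    refine ⟨x, g.compatible O V hO (fun y hy => hy.1.1) hx, mem_map_comp _
      (g.compatible O ⟨_, V'.isOpen.preimage hf⟩ hO (fun y hy => hy.2) hx), ?_⟩
    exact (g.comp_subset _ hx).1.1.2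
  obtain ⟨x, hx, hx1, hxs⟩ := key g hg hgs
  obtain ⟨x', hx', hx1', hxs'⟩ := key g' hg' hgs'
  set C := (map (U' := U') f hf h.symm.subset g).comp V' with hC
  have hCsub : C ⊆ (V' : Set Y) ∩ U' := comp_subset _ _
  have hCt : C ⊆ Φ.target := by
    intro y hy
    have := (hCsub hy).1
    rw [hV'] at this
    obtain ⟨z, hz, rfl⟩ := this
    exact Φ.map_source hz.2
  -- The image component `C` lies in `V' = Φ(V ∩ source)`, hence the local inverse carries it to a
  -- connected subset of `V ∩ U`. This subset contains both `x` and `x'` and so joins the two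
  -- components.
  have hA : IsPreconnected (Φ.symm '' C) :=
    (comp_preconnected _ _).image _ (Φ.continuousOn_symm.mono hCt)
  have hAV : Φ.symm '' C ⊆ (V : Set X) ∩ U := by
    rintro _ ⟨y, hy, rfl⟩
    have h1 := hCsub hy
    rw [hV'] at h1
    obtain ⟨⟨z, hz, rfl⟩, h2⟩ := h1
    rw [Φ.left_inv hz.2]
    refine ⟨hz.1, h.subset ?_⟩
    change f z ∈ U'
    rw [hΦ hz.2]
    exact h2
  have e1 : x ∈ Φ.symm '' C := ⟨f x, hx1, by rw [hΦ hxs, Φ.left_inv hxs]⟩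
  have e2 : x' ∈ Φ.symm '' C := ⟨f x', by rw [he]; exact hx1', by rw [hΦ hxs', Φ.left_inv hxs']⟩
  refine comp_eq_of_inter_nonempty _ _ ⟨x, hx, ?_⟩
  exact g'.subset_comp hA hAV ⟨x', e2, hx'⟩ e1

/-- A local inverse recovers the component over each `V` from the image germ. This is the uniqueness
half of the description of germs in the source as pairs of a point and a germ in the target. -/
lemma map_injOn_fibre (hl : IsLocalHomeomorph f) {g g' : GermSpace X U} (hpt : g.pt = g'.pt)
    (he : map (U' := U') f hf h.symm.subset g =
      map (U' := U') f hf h.symm.subset g') : g = g' := by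
  obtain ⟨Φ, hs, hΦ⟩ := hl g.pt
  refine ext_of_inter hpt fun V hV => ⟨V, le_rfl, hV, ?_⟩
  obtain ⟨V', hV'⟩ := exists_opens Φ V
  have := comp_eq_of_map_comp_eq hf h Φ (fun x _ => by rw [hΦ]) hV' hV (hpt ▸ hV) hs (hpt ▸ hs)
    (by rw [he])
  rw [← this, inter_self]
  exact g.comp_nonempty V hV

/-- The existence half: the components of `g'` generate a filter at `f x`, and a local inverse
transports it to a filter at `x` that still has a basis of connected sets, now contained in `U`. -/
lemma exists_map_eq (hl : IsLocalHomeomorph f) (x : X) (g' : GermSpace Y U')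
    (hx : g'.pt = f x) : ∃ g : GermSpace X U, g.pt = x ∧
      map (U' := U') f hf h.symm.subset g = g' := by
  obtain ⟨Φ, hs, hΦ⟩ := hl x
  have hxt : g'.pt ∈ Φ.target := by rw [hx, hΦ]; exact Φ.map_source hs
  have hxinv : Φ.symm g'.pt = x := by rw [hx, hΦ]; exact Φ.left_inv hs
  let ι := {V : Opens Y // g'.pt ∈ V}
  have : Nonempty ι := ⟨⟨⊤, trivial⟩⟩
  have : Nonempty Y := ⟨g'.pt⟩
  have hdir : Directed (· ≥ ·) fun V : ι => 𝓟 (g'.comp V.1) := by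
    intro V V'
    refine ⟨⟨V.1 ⊓ V'.1, V.2, V'.2⟩, ?_, ?_⟩
    · exact principal_mono.2 (g'.compatible _ _ ⟨V.2, V'.2⟩ inf_le_left)
    · exact principal_mono.2 (g'.compatible _ _ ⟨V.2, V'.2⟩ inf_le_right)
  let G : Filter Y := ⨅ V : ι, 𝓟 (g'.comp V.1)
  have hG : ∀ A, A ∈ G ↔ ∃ V : Opens Y, g'.pt ∈ V ∧ g'.comp V ⊆ A := by
    intro A
    rw [mem_iInf_of_directed hdir]
    simp [ι]
  have hGne : G.NeBot := by
    rw [iInf_neBot_iff_of_directed hdir]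
    intro V
    rw [principal_neBot_iff]
    exact g'.comp_nonempty V.1 V.2
  have hGle : G ≤ 𝓝 g'.pt := by
    intro A hA
    obtain ⟨O, hO, hOo, hO'⟩ := mem_nhds_iff.1 hA
    exact (hG A).2 ⟨⟨O, hOo⟩, hO', fun y hy => hO (g'.comp_subset _ hy).1⟩
  let F : Filter X := G.map Φ.symm
  have hFle : F ≤ 𝓝 x := by
    have h1 : Tendsto Φ.symm (𝓝 g'.pt) (𝓝 x) := by
      have := Φ.continuousAt_symm hxt
      rwa [ContinuousAt, hxinv] at this
    exact h1.mono_left hGle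
  -- Only neighbourhoods `W` inside the target of `Φ` are used, because there `Φ.symm` is continuous
  -- and inverse to `f`.
  have hsmall : ∀ W : Opens Y, g'.pt ∈ W → (W : Set Y) ⊆ Φ.target →
      IsPreconnected (Φ.symm '' g'.comp W) ∧ Φ.symm '' g'.comp W ∈ F ∧
        Φ.symm '' g'.comp W ⊆ f ⁻¹' W ∩ U := by
    intro W hW hWt
    refine ⟨(g'.comp_preconnected W).image _
      (Φ.continuousOn_symm.mono fun y hy => hWt (g'.comp_subset _ hy).1),
      image_mem_map ((hG _).2 ⟨W, hW, Subset.rfl⟩), ?_⟩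
    rintro _ ⟨y, hy, rfl⟩
    have h1 := g'.comp_subset _ hy
    have h2 : f (Φ.symm y) = y := by rw [hΦ]; exact Φ.right_inv (hWt h1.1)
    refine ⟨?_, h.subset ?_⟩
    · change f (Φ.symm y) ∈ (W : Set Y)
      rw [h2]; exact h1.1
    · change f (Φ.symm y) ∈ U'
      rw [h2]; exact h1.2
  let T : Opens Y := ⟨Φ.target, Φ.open_target⟩
  have hFU : U ∈ F := mem_of_superset (hsmall T hxt Subset.rfl).2.1
    fun z hz => ((hsmall T hxt Subset.rfl).2.2 hz).2
  have hFc : ∀ A ∈ F, ∃ B ∈ F, B ⊆ A ∧ IsPreconnected B := by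
    intro A hA
    obtain ⟨V, hV, hVA⟩ := (hG _).1 (mem_map.1 hA)
    have h1 := hsmall (V ⊓ T) ⟨hV, hxt⟩ fun y hy => hy.2
    refine ⟨_, h1.2.1, ?_, h1.1⟩
    rintro _ ⟨y, hy, rfl⟩
    exact hVA (g'.compatible (V ⊓ T) V ⟨hV, hxt⟩ inf_le_left hy)
  refine ⟨ofFilter x F hFle hFU hFc, rfl, ext_of_inter hx.symm fun V hV => ⟨V, le_rfl, hV, ?_⟩⟩
  have hV' : g'.pt ∈ V := by rw [hx]; exact hV
  have h1 := hsmall (V ⊓ T) ⟨hV', hxt⟩ fun y hy => hy.2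
  obtain ⟨y, hy⟩ := g'.comp_nonempty (V ⊓ T) ⟨hV', hxt⟩
  refine ⟨y, ?_, g'.compatible (V ⊓ T) V ⟨hV', hxt⟩ inf_le_left hy⟩
  have h2 : Φ.symm y ∈ (ofFilter x F hFle hFU hFc).comp ⟨f ⁻¹' V, V.isOpen.preimage hf⟩ :=
    ofFilter_comp (F := F) (B := Φ.symm '' g'.comp (V ⊓ T)) hV h1.2.1 (fun z hz => ⟨((h1.2.2 hz).1 : f z ∈ (V ⊓ T : Opens Y)).1, (h1.2.2 hz).2⟩) h1.1
      (mem_image_of_mem _ hy)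
  have h3 := mem_map_comp (hf := hf) (h := (h.symm.subset : MapsTo f U U')) _ h2
  have h4 : f (Φ.symm y) = y := by
    rw [hΦ]
    exact Φ.right_inv (g'.comp_subset _ hy).1.2
  rwa [h4] at h3

/-- Near the limit point a local inverse recovers components from their images. Together with
existence and uniqueness of lifts, this exhibits the germ space of the source as the topological
pullback of that of the target. -/
lemma tendsto_of_tendsto_map (hl : IsLocalHomeomorph f) {α : Type*} {l : Filter α}
    {F : α → GermSpace X U} {g : GermSpace X U} (h1 : Tendsto (fun a => (F a).pt) l (𝓝 g.pt))
    (h2 : Tendsto (fun a => map (U' := U') f hf h.symm.subset (F a)) l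
      (𝓝 (map (U' := U') f hf h.symm.subset g))) : Tendsto F l (𝓝 g) := by
  refine tendsto_nhds_iff.2 fun V hV => ?_
  obtain ⟨Φ, hs, hΦ⟩ := hl g.pt
  obtain ⟨V', hV'⟩ := exists_opens Φ V
  have hm : (map (U' := U') f hf h.symm.subset g).pt ∈ V' := by
    change f g.pt ∈ (V' : Set Y)
    rw [hV', hΦ]
    exact mem_image_of_mem Φ ⟨hV, hs⟩
  filter_upwards [tendsto_nhds_iff.1 h2 V' hm, h1 (V.isOpen.mem_nhds hV),
    h1 (Φ.open_source.mem_nhds hs)] with a ha ha1 ha2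
  exact ⟨ha1, comp_eq_of_map_comp_eq hf h Φ (fun x _ => by rw [hΦ]) hV' ha1 hV ha2 hs ha.2⟩

end LocalHomeomorph

end GermSpace

end HyperBlowup

namespace HyperBlowup

open Filter

/-! ### Division of smooth functions by a coordinate -/

section Division

/-- Induction by differentiation under the integral. The derivative is an integral of the same kind
with values in `E →L[ℝ] V`, which is why `V` is quantified inside the induction. -/
lemma contDiff_nat_integral {E : Type} [NormedAddCommGroup E] [NormedSpace ℝ E] [ProperSpace E]
    (m : ℕ) : ∀ {V : Type} [NormedAddCommGroup V] [NormedSpace ℝ V] [CompleteSpace V]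
      {F : E × ℝ → V}, ContDiff ℝ ∞ F → ContDiff ℝ m fun x => ∫ t in (0 : ℝ)..1, F (x, t) := by
  have hcont : ∀ {V : Type} [NormedAddCommGroup V] [NormedSpace ℝ V] {F : E × ℝ → V},
      Continuous F → Continuous fun x => ∫ t in (0 : ℝ)..1, F (x, t) := fun {V} _ _ {F} hF =>
    intervalIntegral.continuous_parametric_intervalIntegral_of_continuous'
      (f := fun x t => F (x, t)) hF 0 1
  induction m with
  | zero => exact fun hF => contDiff_zero.2 (hcont hF.continuous)
  | succ m ih =>
    intro V _ _ _ F hF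
    let F' : E × ℝ → E →L[ℝ] V := fun z => (fderiv ℝ F z).comp (ContinuousLinearMap.inl ℝ E ℝ)
    have hF' : ContDiff ℝ ∞ F' :=
      (hF.fderiv_right (m := ∞) le_rfl).clm_comp contDiff_const
    refine contDiff_succ_iff_hasFDerivAt.2 ⟨_, ih hF', fun x => ?_⟩
    -- A dominating constant for the derivative exists because closed balls of `E` are compact.
    obtain ⟨K, hK⟩ := ((isCompact_closedBall x 1).prod isCompact_Icc
      (t := Icc (0 : ℝ) 1)).exists_bound_of_continuousOn hF'.continuous.continuousOn
    refine intervalIntegral.hasFDerivAt_integral_of_dominated_of_fderiv_le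
      (F := fun x t => F (x, t)) (F' := fun x t => F' (x, t)) (bound := fun _ => K)
      (Metric.closedBall_mem_nhds x one_pos)
      (Eventually.of_forall fun y => ?_) ?_ ?_ (Eventually.of_forall fun t ht y hy => ?_) ?_
      (Eventually.of_forall fun t ht y hy => ?_)
    · exact (hF.continuous.comp (by fun_prop : Continuous fun t : ℝ => (y, t))).aestronglyMeasurable
    · exact (hF.continuous.comp
        (by fun_prop : Continuous fun t : ℝ => (x, t))).intervalIntegrable _ _
    · exact (hF'.continuous.comp
        (by fun_prop : Continuous fun t : ℝ => (x, t))).aestronglyMeasurable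
    · rw [uIoc_of_le zero_le_one] at ht
      exact hK (y, t) ⟨hy, Ioc_subset_Icc_self ht⟩
    · exact intervalIntegrable_const
    · have h1 : HasFDerivAt F (fderiv ℝ F (y, t)) (y, t) :=
        (hF.differentiable (by simp) _).hasFDerivAt
      exact h1.comp y (hasFDerivAt_prodMk_left y t)

/-- Multiplication by a bump function supported where `u` is smooth. A globally smooth function can
be integrated along segments regardless of where they run. -/
lemma exists_contDiff_extension {E : Type} [NormedAddCommGroup E] [NormedSpace ℝ E]
    [FiniteDimensional ℝ E] {u : E → ℝ} {a : E}
    (h1 : ∀ᶠ x in 𝓝 a, ContDiffAt ℝ ∞ u x) :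
    ∃ v : E → ℝ, ContDiff ℝ ∞ v ∧ v =ᶠ[𝓝 a] u := by
  obtain ⟨r, hr, hball⟩ := Metric.eventually_nhds_iff_ball.1 h1
  let φ : ContDiffBump a := ⟨r / 4, r / 2, by linarith, by linarith⟩
  refine ⟨fun x => φ x * u x, contDiff_iff_contDiffAt.2 fun x => ?_, ?_⟩
  · by_cases hx : x ∈ Metric.ball a r
    · exact φ.contDiff.contDiffAt.mul (hball x hx)
    · have hx' : x ∉ tsupport φ := by
        rw [φ.tsupport_eq]
        intro hx'
        exact hx (Metric.closedBall_subset_ball (by change r / 2 < r; linarith) hx')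
      have h2 : (fun x => φ x * u x) =ᶠ[𝓝 x] fun _ => 0 := by
        filter_upwards [notMem_tsupport_iff_eventuallyEq.1 hx'] with y hy
        simp [hy]
      exact contDiffAt_const.congr_of_eventuallyEq h2
  · filter_upwards [φ.eventuallyEq_one] with x hx
    simp [hx]

variable {n : ℕ}

local notation "𝔼" => EuclideanSpace ℝ (Fin n)

/-- Hadamard's lemma: a smooth function which vanishes on a coordinate hyperplane is divisible by
the coordinate. -/
lemma exists_eq_coord_mul {u : 𝔼 → ℝ} (hu : ∀ᶠ v in 𝓝 0, ContDiffAt ℝ ∞ u v) (i : Fin n)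
    (h0 : ∀ᶠ v : 𝔼 in 𝓝 0, v i = 0 → u v = 0) :
    ∃ G : 𝔼 → ℝ, ContDiff ℝ ∞ G ∧ ∀ᶠ v in 𝓝 0, u v = G v * v i := by
  obtain ⟨f, hf, hfu⟩ := exists_contDiff_extension hu
  let e : 𝔼 := EuclideanSpace.single i 1
  have hp : ContDiff ℝ ∞ fun v : 𝔼 => v i := (EuclideanSpace.proj (𝕜 := ℝ) i : 𝔼 →L[ℝ] ℝ).contDiff
  -- The segment from the projection of `v` to the hyperplane (`t = 0`) to `v` itself (`t = 1`). Its
  -- velocity is `v i • e`, so integrating the derivative of `f` along it produces the factor `v i`.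
  let γ : 𝔼 × ℝ → 𝔼 := fun z => z.1 - ((1 - z.2) * z.1 i) • e
  have hγ : ContDiff ℝ ∞ γ := by
    have h1 : ContDiff ℝ ∞ fun z : 𝔼 × ℝ => z.1 i := hp.comp contDiff_fst
    exact contDiff_fst.sub (((contDiff_const.sub contDiff_snd).mul h1).smul contDiff_const)
  let D : 𝔼 × ℝ → ℝ := fun z => fderiv ℝ f (γ z) e
  have hD : ContDiff ℝ ∞ D :=
    ((hf.fderiv_right (m := ∞) le_rfl).comp hγ).clm_apply contDiff_const
  refine ⟨fun v => ∫ t in (0 : ℝ)..1, D (v, t),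
    contDiff_infty.2 fun m => contDiff_nat_integral m hD, ?_⟩
  have hγ0 : Tendsto (fun v : 𝔼 => v - v i • e) (𝓝 0) (𝓝 0) := by
    have : Continuous fun v : 𝔼 => v - v i • e := continuous_id.sub (hp.continuous.smul continuous_const)
    simpa using this.tendsto 0
  filter_upwards [hfu, hγ0.eventually hfu, hγ0.eventually h0] with v h1 h2 h3
  have h4 : u (v - v i • e) = 0 := h3 (by simp [e])
  have h5 : ∀ t ∈ uIcc (0 : ℝ) 1, HasDerivAt (fun t => f (γ (v, t))) (D (v, t) * v i) t := by
    intro t _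
    have h6 : HasDerivAt (fun t : ℝ => γ (v, t)) (v i • e) t := by
      have h7 : HasDerivAt (fun t : ℝ => (1 - t) * v i) (-1 * v i) t :=
        ((hasDerivAt_id t).const_sub 1).mul_const (v i)
      have h8 := (h7.smul_const e).const_sub v
      rw [neg_one_mul, neg_smul, neg_neg] at h8
      exact h8
    have h9 := ((hf.differentiable (by simp) (γ (v, t))).hasFDerivAt).comp_hasDerivAt t h6
    rw [map_smul, smul_eq_mul, mul_comm] at h9
    exact h9
  have h6 := intervalIntegral.integral_eq_sub_of_hasDerivAt h5 (by
    refine Continuous.intervalIntegrable ?_ _ _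
    exact (hD.continuous.comp (by fun_prop : Continuous fun t : ℝ => (v, t))).mul continuous_const)
  rw [intervalIntegral.integral_mul_const] at h6
  rw [h6]
  simp [γ, h1, h2, h4]

/-- If the zero set of a submersion `u` is contained in a union of coordinate hyperplanes, then the
differential of `u` is proportional to one of these coordinates. -/
lemma exists_fderiv_eq_coord {u : 𝔼 → ℝ} {u' : 𝔼 →L[ℝ] ℝ} (hu : HasStrictFDerivAt u u' 0)
    (hu0 : u 0 = 0) (hu' : u' ≠ 0) (S : Set (Fin n))
    (hS : ∀ᶠ v : 𝔼 in 𝓝 0, u v = 0 → ∃ i ∈ S, v i = 0) :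
    ∃ i ∈ S, ∃ c : ℝ, c ≠ 0 ∧ ∀ v, u' v = c * v i := by
  have hsurj : Function.Surjective u' :=
    LinearMap.surjective_of_ne_zero (f := (u' : 𝔼 →ₗ[ℝ] ℝ)) fun h => hu' (by
      ext v; exact LinearMap.congr_fun h v)
  -- A vector killed by `u'` is the velocity of a curve in the zero set of `u`. If none of its
  -- coordinates in `S` vanished, the curve would leave all these hyperplanes for small `t ≠ 0`.
  have key : ∀ v, u' v = 0 → ∃ i ∈ S, v i = 0 := by
    intro v hv
    by_contra! hcon
    obtain ⟨c, hc0, hc, hcu⟩ := ManC.exists_curve hu (LinearMap.range_eq_top.2 hsurj) hv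
    have hct : Tendsto c (𝓝 0) (𝓝 0) := by
      have := hc.continuousAt.tendsto
      rwa [hc0] at this
    have h1 : ∀ᶠ t in 𝓝[≠] (0 : ℝ), ∃ i ∈ S, c t i = 0 := by
      refine Eventually.filter_mono nhdsWithin_le_nhds ?_
      filter_upwards [hcu, hct.eventually hS] with t h1 h2
      exact h2 (by rw [h1, hu0])
    have h2 : ∀ᶠ t in 𝓝[≠] (0 : ℝ), ∀ i : Fin n, i ∈ S → c t i ≠ 0 := by
      refine eventually_all.2 fun i => ?_
      by_cases hi : i ∈ S
      · have h3 : HasDerivAt (fun t => c t i) (v i) 0 :=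
          (EuclideanSpace.proj (𝕜 := ℝ) i : 𝔼 →L[ℝ] ℝ).hasFDerivAt.comp_hasDerivAt (0 : ℝ) hc
        exact (h3.eventually_ne (hcon i hi)).mono fun t ht _ => ht
      · exact Eventually.of_forall fun t h => absurd h hi
    obtain ⟨t, ⟨i, hi, h3⟩, h4⟩ := (h1.and h2).exists
    exact h4 i hi h3
  -- A real vector space is not a finite union of proper subspaces, so the kernel of `u'` lies in a
  -- single hyperplane.
  obtain ⟨i, hi⟩ := Subspace.exists_eq_top_of_iUnion_eq_univ
    (p := fun i : S => (LinearMap.ker ((EuclideanSpace.proj (𝕜 := ℝ) i.1 : 𝔼 →L[ℝ] ℝ) :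
      𝔼 →ₗ[ℝ] ℝ)).comap (LinearMap.ker (u' : 𝔼 →ₗ[ℝ] ℝ)).subtype) (by
      refine eq_univ_of_forall fun v => mem_iUnion.2 ?_
      obtain ⟨i, hi, h⟩ := key v.1 v.2
      exact ⟨⟨i, hi⟩, h⟩)
  have hker : ∀ v, u' v = 0 → v i.1 = 0 := by
    intro v hv
    have : (⟨v, hv⟩ : LinearMap.ker (u' : 𝔼 →ₗ[ℝ] ℝ)) ∈ (⊤ : Submodule ℝ _) := trivial
    rw [← hi] at this
    exact this
  obtain ⟨w, hw⟩ := hsurj 1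
  have h1 : ∀ v, v i.1 = u' v * w i.1 := by
    intro v
    have := hker (v - u' v • w) (by simp [hw])
    simpa [sub_eq_zero] using this
  have h2 := h1 (EuclideanSpace.single i.1 1)
  simp only [PiLp.single_apply, if_true] at h2
  refine ⟨i.1, i.2, u' (EuclideanSpace.single i.1 1), fun h => ?_, fun v => ?_⟩
  · rw [h, zero_mul] at h2
    exact one_ne_zero h2
  · rw [h1 v, mul_left_comm, ← h2, mul_one]

/-- A submersion `u` whose zero set is contained in a union of coordinate hyperplanes is the product of
one of these coordinates and a unit. -/
lemma exists_eq_unit_mul_coord {u : 𝔼 → ℝ} (hu : ∀ᶠ v in 𝓝 0, ContDiffAt ℝ ∞ u v) (hu0 : u 0 = 0)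
    (hu' : fderiv ℝ u 0 ≠ 0) (S : Set (Fin n))
    (hS : ∀ᶠ v : 𝔼 in 𝓝 0, u v = 0 → ∃ i ∈ S, v i = 0) :
    ∃ i ∈ S, ∃ G : 𝔼 → ℝ, ContDiff ℝ ∞ G ∧ G 0 ≠ 0 ∧ ∀ᶠ v in 𝓝 0, u v = G v * v i := by
  have hst : HasStrictFDerivAt u (fderiv ℝ u 0) 0 :=
    hu.self_of_nhds.hasStrictFDerivAt (by simp)
  obtain ⟨i, hi, c, hc, hd⟩ := exists_fderiv_eq_coord hst hu0 hu' S hS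
  let e : 𝔼 := EuclideanSpace.single i 1
  have hline : HasDerivAt (fun t : ℝ => u (t • e)) c 0 := by
    have h1 : HasDerivAt (fun t : ℝ => t • e) e 0 := by
      simpa using (hasDerivAt_id (0 : ℝ)).smul_const e
    have h2 : HasFDerivAt u (fderiv ℝ u 0) ((0 : ℝ) • e) := by
      rw [zero_smul]; exact hst.hasFDerivAt
    have h3 := h2.comp_hasDerivAt (0 : ℝ) h1
    have h4 : e i = 1 := by simp [e]
    rw [hd e, h4, mul_one] at h3
    exact h3
  -- the function vanishes on the hyperplane
  have hvan : ∀ᶠ v : 𝔼 in 𝓝 0, v i = 0 → u v = 0 := by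
    have hcont : ∀ᶠ v in 𝓝 (0 : 𝔼), ContinuousAt u v :=
      hu.mono fun v hv => hv.continuousAt
    obtain ⟨r, hr, hball⟩ := Metric.eventually_nhds_iff_ball.1 (hcont.and hS)
    have he : ‖e‖ = 1 := by simp [e]
    have hslope : ∀ᶠ t in 𝓝[≠] (0 : ℝ), 0 < c * (t⁻¹ * u (t • e)) := by
      have h1 := hasDerivAt_iff_tendsto_slope_zero.1 hline
      simp only [zero_add, zero_smul, hu0, sub_zero, smul_eq_mul] at h1
      exact (h1.const_mul c).eventually (lt_mem_nhds (mul_self_pos.2 hc))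
    -- The derivative along `e` is `c ≠ 0`, so `c * u` is positive on the positive side of the axis
    -- and negative on the other. The bound `r / 2` keeps segments starting near `0` inside the ball
    -- of radius `r`.
    obtain ⟨δ, hδ, hδr, hpos, hneg⟩ : ∃ δ > 0, δ < r / 2 ∧ 0 < c * u (δ • e) ∧
        c * u ((-δ) • e) < 0 := by
      obtain ⟨ε, hε, h1⟩ := Metric.mem_nhdsWithin_iff.1 hslope
      have hm : 0 < min ε r / 4 := by have := lt_min hε hr; linarith
      have hm1 : min ε r ≤ ε := min_le_left _ _
      have hm2 : min ε r ≤ r := min_le_right _ _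
      have hmem : ∀ s : ℝ, |s| < ε → s ∈ Metric.ball (0 : ℝ) ε := fun s hs => by
        rwa [Metric.mem_ball, dist_zero_right, Real.norm_eq_abs]
      refine ⟨min ε r / 4, hm, by linarith, ?_, ?_⟩
      · have h2 : 0 < c * ((min ε r / 4)⁻¹ * u ((min ε r / 4) • e)) :=
          h1 ⟨hmem _ (by simp only [abs_of_pos hm]; linarith), hm.ne'⟩
        have h3 := mul_pos hm h2
        have h4 : (min ε r / 4) * (c * ((min ε r / 4)⁻¹ * u ((min ε r / 4) • e))) =
            c * u ((min ε r / 4) • e) := by field_simp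
        rwa [h4] at h3
      · have h2 : 0 < c * ((-(min ε r / 4))⁻¹ * u ((-(min ε r / 4)) • e)) :=
          h1 ⟨hmem _ (by simp only [abs_neg, abs_of_pos hm]; linarith), by simp only [mem_compl_iff, mem_singleton_iff]; linarith⟩
        have h3 := mul_pos hm h2
        have h4 : (min ε r / 4) * (c * ((-(min ε r / 4))⁻¹ * u ((-(min ε r / 4)) • e))) =
            -(c * u ((-(min ε r / 4)) • e)) := by field_simp
        rw [h4] at h3
        linarith
    have hnear : ∀ s : ℝ, |s| ≤ δ → ∀ᶠ v in 𝓝 (0 : 𝔼), ContinuousAt u (v + s • e) := by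
      intro s hs
      filter_upwards [Metric.ball_mem_nhds (0 : 𝔼) (half_pos hr)] with v hv
      refine (hball _ ?_).1
      rw [mem_ball_zero_iff] at hv ⊢
      calc ‖v + s • e‖ ≤ ‖v‖ + ‖s • e‖ := norm_add_le _ _
        _ < r := by rw [norm_smul, he, mul_one, Real.norm_eq_abs]; linarith
    have hsgn : ∀ᶠ v in 𝓝 (0 : 𝔼), 0 < c * u (v + δ • e) ∧ c * u (v + (-δ) • e) < 0 := by
      have hc1 : ∀ s : ℝ, |s| ≤ δ → Tendsto (fun v : 𝔼 => c * u (v + s • e)) (𝓝 0)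
          (𝓝 (c * u (s • e))) := by
        intro s hs
        have h1 : ContinuousAt u (0 + s • e) := (hnear s hs).self_of_nhds
        have h2 : Tendsto (fun v : 𝔼 => v + s • e) (𝓝 0) (𝓝 (0 + s • e)) :=
          (by fun_prop : Continuous fun v : 𝔼 => v + s • e).tendsto 0
        have h3 := (h1.tendsto.comp h2).const_mul c
        rwa [zero_add] at h3
      exact ((hc1 δ (abs_of_pos hδ).le).eventually (lt_mem_nhds hpos)).and
        ((hc1 (-δ) (by rw [abs_neg, abs_of_pos hδ])).eventually (gt_mem_nhds hneg))
    -- By the intermediate value theorem `u` vanishes somewhere on the segment through `v` in the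
    -- direction `e`. The zero lies on a coordinate hyperplane, and only the `i`-th coordinate
    -- varies along the segment, so the zero is `v`.
    have hgen : ∀ᶠ v in 𝓝 (0 : 𝔼), v i = 0 → (∀ j ≠ i, v j ≠ 0) → u v = 0 := by
      filter_upwards [hsgn, Metric.ball_mem_nhds (0 : 𝔼) (half_pos hr)] with v hv hvr hvi hvj
      have hin : ∀ s ∈ Icc (-δ) δ, v + s • e ∈ Metric.ball (0 : 𝔼) r := by
        intro s hs
        rw [mem_ball_zero_iff] at hvr ⊢
        calc ‖v + s • e‖ ≤ ‖v‖ + ‖s • e‖ := norm_add_le _ _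
          _ < r := by
            rw [norm_smul, he, mul_one, Real.norm_eq_abs]
            have := abs_le.2 hs
            linarith
      have hcs : ContinuousOn (fun s : ℝ => c * u (v + s • e)) (Icc (-δ) δ) := by
        intro s hs
        refine ContinuousAt.continuousWithinAt ?_
        have h1 : ContinuousAt u (v + s • e) := (hball _ (hin s hs)).1
        have h2 : ContinuousAt (fun s : ℝ => v + s • e) s := by fun_prop
        exact continuousAt_const.mul (ContinuousAt.comp (f := fun s : ℝ => v + s • e) h1 h2)
      obtain ⟨s, hs, hs0⟩ := intermediate_value_Icc (by linarith) hcs ⟨hv.2.le, hv.1.le⟩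
      have hs1 : u (v + s • e) = 0 := (mul_eq_zero.1 hs0).resolve_left hc
      obtain ⟨j, -, hj⟩ := (hball _ (hin s hs)).2 hs1
      by_cases hji : j = i
      · subst hji
        have hs2 : s = 0 := by simpa [e, hvi] using hj
        simpa [hs2] using hs1
      · exact absurd (by simpa [e, hji] using hj) (hvj j hji)
    have hgen' := hgen.eventually_nhds
    filter_upwards [hgen', hcont] with v h1 h2 hvi
    -- Moving along `d` stays in the hyperplane and makes the other coordinates nonzero. Continuity
    -- of `u` then settles all points of the hyperplane.
    let d : 𝔼 := WithLp.toLp 2 fun j => if j = i then 0 else 1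
    have h3 : Tendsto (fun t : ℝ => v + t • d) (𝓝 0) (𝓝 v) := by
      simpa using (by fun_prop : Continuous fun t : ℝ => v + t • d).tendsto 0
    have h4 : ∀ᶠ t in 𝓝[≠] (0 : ℝ), ∀ j ≠ i, (v + t • d) j ≠ 0 := by
      refine eventually_all.2 fun j => ?_
      by_cases hj : j = i
      · exact Eventually.of_forall fun t h => absurd hj h
      · have h5 : HasDerivAt (fun t : ℝ => v j + t) 1 0 := (hasDerivAt_id _).const_add _
        refine (h5.eventually_ne one_ne_zero (c := 0)).mono fun t ht _ => ?_
        simpa [d, hj] using ht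
    have h5 : ∀ᶠ t in 𝓝[≠] (0 : ℝ), u (v + t • d) = 0 := by
      filter_upwards [h4, (h3.mono_left nhdsWithin_le_nhds).eventually h1] with t h6 h7
      exact h7 (by simp [d, hvi]) h6
    have h6 : Tendsto (fun t : ℝ => u (v + t • d)) (𝓝[≠] 0) (𝓝 (u v)) :=
      h2.tendsto.comp (h3.mono_left nhdsWithin_le_nhds)
    exact tendsto_nhds_unique h6 (tendsto_const_nhds.congr' (h5.mono fun t ht => ht.symm))
  obtain ⟨G, hG, hGu⟩ := exists_eq_coord_mul hu i hvan
  refine ⟨i, hi, G, hG, fun hG0 => hc ?_, hGu⟩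
  have h1 : Tendsto (fun t : ℝ => t • e) (𝓝 0) (𝓝 0) := by
    simpa using (by fun_prop : Continuous fun t : ℝ => t • e).tendsto 0
  -- If `G 0 = 0`, the product rule makes the derivative of `u` along `e` vanish, although it equals
  -- `c`.
  have h2 : HasDerivAt (fun t : ℝ => G (t • e) * t) 0 0 := by
    have hGe : HasFDerivAt G (fderiv ℝ G 0) ((0 : ℝ) • e) := by
      rw [zero_smul]; exact (hG.differentiable (by simp) 0).hasFDerivAt
    have h3 : HasDerivAt (fun t : ℝ => t • e) e 0 := by
      simpa using (hasDerivAt_id (0 : ℝ)).smul_const e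
    have h4 := (hGe.comp_hasDerivAt (0 : ℝ) h3).mul (hasDerivAt_id (0 : ℝ))
    have h5 : ∀ x : ℝ, x * id 0 + G ((0 : ℝ) • e) * 1 = 0 := by simp [hG0]
    have h6 := h5 (fderiv ℝ G 0 e)
    change HasDerivAt _ (fderiv ℝ G 0 e * id 0 + G ((0 : ℝ) • e) * 1) 0 at h4
    rw [h6] at h4
    exact h4
  refine hline.unique (h2.congr_of_eventuallyEq ?_)
  filter_upwards [h1.eventually hGu] with t ht
  simpa [e] using ht

end Division

end HyperBlowup

namespace HyperBlowup

open TopologicalSpace (Opens)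
open Filter

/-! ### Cubical charts adapted to a union of coordinate hyperplanes -/

/-- A chart of `X` onto the open unit cube in which `E` is the union of the first `k` coordinate
hyperplanes. -/
structure Box (X : ManC) (E : Set X) where
  e : OpenPartialHomeomorph X X.Vec
  target_eq : e.target = {v | ∀ i, |v i| < 1}
  contMDiffOn : ContMDiffOn X.model 𝓘(ℝ, X.Vec) ∞ e e.source
  contMDiffOn_symm : ContMDiffOn 𝓘(ℝ, X.Vec) X.model ∞ e.symm e.target
  k : ℕ
  mem_iff : ∀ y ∈ e.source, y ∈ E ↔ ∃ i : Fin X.dim, i.1 < k ∧ e y i = 0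

namespace Box

variable {X : ManC} {E : Set X} (b : Box X E)

/-- The source of the chart. -/
def src : Opens X := ⟨b.e.source, b.e.open_source⟩

/-- The points at which the first `k` coordinates are positive. -/
def pos : Set X := {y | y ∈ b.e.source ∧ ∀ i : Fin X.dim, i.1 < b.k → 0 < b.e y i}

/-- The points at which the first `k` coordinates are nonnegative. -/
def nonneg : Set X := {y | y ∈ b.e.source ∧ ∀ i : Fin X.dim, i.1 < b.k → 0 ≤ b.e y i}

lemma pos_subset : b.pos ⊆ (b.src : Set X) ∩ Eᶜ := fun y hy => ⟨hy.1, fun hE => by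
  obtain ⟨i, hi, h0⟩ := (b.mem_iff y hy.1).1 hE
  exact (hy.2 i hi).ne' h0⟩

lemma convex_cube : Convex ℝ b.e.target := by
  rw [b.target_eq]
  have h : {v : X.Vec | ∀ i, |v i| < 1} = ⋂ i, (EuclideanSpace.proj (𝕜 := ℝ) i : X.Vec →L[ℝ] ℝ) ⁻¹'
      Ioo (-1) 1 := by
    ext v
    simp [abs_lt]
  rw [h]
  exact convex_iInter fun i => (convex_Ioo (-1 : ℝ) 1).linear_preimage
    (EuclideanSpace.proj (𝕜 := ℝ) i : X.Vec →L[ℝ] ℝ).toLinearMap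

lemma convex_posOrthant (k n : ℕ) :
    Convex ℝ {v : EuclideanSpace ℝ (Fin n) | ∀ i : Fin n, i.1 < k → 0 < v i} := by
  have h : {v : EuclideanSpace ℝ (Fin n) | ∀ i : Fin n, i.1 < k → 0 < v i} =
      ⋂ i : Fin n, ⋂ _ : i.1 < k,
        (EuclideanSpace.proj (𝕜 := ℝ) i : EuclideanSpace ℝ (Fin n) →L[ℝ] ℝ) ⁻¹' Ioi 0 := by
    ext v
    simp
  rw [h]
  exact convex_iInter fun i => convex_iInter fun _ => (convex_Ioi (0 : ℝ)).linear_preimage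
    (EuclideanSpace.proj (𝕜 := ℝ) i : EuclideanSpace ℝ (Fin n) →L[ℝ] ℝ).toLinearMap

lemma isPreconnected_symm_image {K : Set X.Vec} (hK : Convex ℝ K) (hKt : K ⊆ b.e.target) :
    IsPreconnected (b.e.symm '' (K ∩ {v | ∀ i : Fin X.dim, i.1 < b.k → 0 < v i})) :=
  (hK.inter (convex_posOrthant _ _)).isPreconnected.image _
    (b.e.continuousOn_symm.mono (inter_subset_left.trans hKt))

lemma symm_image_eq {K : Set X.Vec} (hKt : K ⊆ b.e.target) :
    b.e.symm '' (K ∩ {v | ∀ i : Fin X.dim, i.1 < b.k → 0 < v i}) =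
      b.e.source ∩ b.e ⁻¹' K ∩ b.pos := by
  ext y
  constructor
  · rintro ⟨v, ⟨hv, hv'⟩, rfl⟩
    have h1 := b.e.map_target (hKt hv)
    have h2 := b.e.right_inv (hKt hv)
    exact ⟨⟨h1, by rwa [mem_preimage, h2]⟩, h1, fun i hi => by rw [h2]; exact hv' i hi⟩
  · rintro ⟨⟨h1, h2⟩, h3⟩
    exact ⟨b.e y, ⟨h2, h3.2⟩, b.e.left_inv h1⟩

lemma isPreconnected_pos : IsPreconnected b.pos := by
  have h := b.isPreconnected_symm_image b.convex_cube Subset.rfl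
  rw [b.symm_image_eq Subset.rfl] at h
  convert h using 1
  ext y
  exact ⟨fun hy => ⟨⟨hy.1, b.e.map_source hy.1⟩, hy⟩, fun hy => hy.2⟩

lemma nonempty_inter_pos {y : X} (hy : y ∈ b.nonneg) {N : Set X} (hN : N ∈ 𝓝 y) :
    (N ∩ b.pos).Nonempty := by
  -- A small step in the direction `(1, …, 1)` makes nonnegative coordinates positive.
  let d : X.Vec := WithLp.toLp 2 fun _ => 1
  have h1 : Tendsto (fun t : ℝ => b.e y + t • d) (𝓝[>] 0) (𝓝 (b.e y)) := by
    have : Tendsto (fun t : ℝ => b.e y + t • d) (𝓝 0) (𝓝 (b.e y)) := by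
      simpa using (by fun_prop : Continuous fun t : ℝ => b.e y + t • d).tendsto 0
    exact this.mono_left nhdsWithin_le_nhds
  have hyt := b.e.map_source hy.1
  have h2 : Tendsto (fun t : ℝ => b.e.symm (b.e y + t • d)) (𝓝[>] 0) (𝓝 y) := by
    have := (b.e.continuousAt_symm hyt).tendsto.comp h1
    rwa [b.e.left_inv hy.1] at this
  obtain ⟨t, ⟨h3, h4⟩, h5⟩ := ((h2.eventually hN).and
    (h1.eventually (b.e.open_target.mem_nhds hyt)) |>.and self_mem_nhdsWithin).exists
  refine ⟨_, h3, b.e.map_target h4, fun i hi => ?_⟩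
  rw [b.e.right_inv h4]
  have h6 : 0 ≤ b.e y i := hy.2 i hi
  have h7 : (0 : ℝ) < t := h5
  simp only [PiLp.add_apply, PiLp.smul_apply, smul_eq_mul, d, mul_one]
  linarith

/-- Small neighbourhoods intersect the positive part in a connected set. -/
lemma exists_nhd {y : X} (hy : y ∈ b.e.source) (V : Opens X) (hV : y ∈ V) :
    ∃ Q : Opens X, y ∈ Q ∧ Q ≤ V ∧ Q ≤ b.src ∧ IsPreconnected ((Q : Set X) ∩ b.pos) := by
  have h1 : b.e.target ∩ b.e.symm ⁻¹' V ∈ 𝓝 (b.e y) := by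
    refine inter_mem (b.e.open_target.mem_nhds (b.e.map_source hy)) ?_
    refine (b.e.continuousAt_symm (b.e.map_source hy)).preimage_mem_nhds ?_
    rw [b.e.left_inv hy]
    exact V.isOpen.mem_nhds hV
  obtain ⟨r, hr, hball⟩ := Metric.mem_nhds_iff.1 h1
  have hKt : Metric.ball (b.e y) r ⊆ b.e.target := hball.trans inter_subset_left
  refine ⟨⟨b.e.source ∩ b.e ⁻¹' Metric.ball (b.e y) r, b.e.isOpen_inter_preimage Metric.isOpen_ball⟩,
    ⟨hy, Metric.mem_ball_self hr⟩, fun z hz => ?_, fun z hz => hz.1, ?_⟩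
  · have := (hball hz.2).2
    rw [mem_preimage, b.e.left_inv hz.1] at this
    exact this
  -- In the chart this is a ball intersected with an orthant, hence convex.
  · have h := b.isPreconnected_symm_image (convex_ball (b.e y) r) hKt
    rw [b.symm_image_eq hKt] at h
    exact h

/-- A connected subset of the complement of `E` which meets the positive part is contained in it. -/
lemma subset_pos {A : Set X} (hA : IsPreconnected A) (hAs : A ⊆ (b.src : Set X) ∩ Eᶜ)
    (h : (A ∩ b.pos).Nonempty) : A ⊆ b.pos := by
  obtain ⟨x, hxA, hx⟩ := h
  refine fun y hy => ⟨(hAs hy).1, fun i hi => ?_⟩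
  by_contra! hneg
  have hcont : ContinuousOn (fun z => b.e z i) A := by
    have h1 : ContinuousOn b.e A := b.e.continuousOn.mono fun z hz => (hAs hz).1
    exact (EuclideanSpace.proj (𝕜 := ℝ) i : X.Vec →L[ℝ] ℝ).continuous.comp_continuousOn h1
  -- A coordinate that changes sign on the connected set `A` vanishes somewhere on it, and there `A`
  -- would meet `E`.
  obtain ⟨z, hz, hz0⟩ := hA.intermediate_value hy hxA hcont ⟨hneg, (hx.2 i hi).le⟩
  exact (hAs hz).2 ((b.mem_iff z (hAs hz).1).2 ⟨i, hi, hz0⟩)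

/-- The germs of the positive part. -/
def cell : Set (Blowup X E) := {g | g.pt ∈ b.src ∧ g.comp b.src = b.pos}

lemma isOpen_cell : IsOpen b.cell := GermSpace.isOpen_basic _ _

variable {b}

/-- The base point is in the closure of the component, and weak inequalities pass to the closure. -/
lemma mem_nonneg_of_mem_cell {g : Blowup X E} (hg : g ∈ b.cell) : g.pt ∈ b.nonneg := by
  refine ⟨hg.1, fun i hi => ?_⟩
  by_contra! hneg
  have h1 : ContinuousAt (fun z => b.e z i) g.pt :=
    (EuclideanSpace.proj (𝕜 := ℝ) i : X.Vec →L[ℝ] ℝ).continuous.continuousAt.comp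
      (b.e.continuousAt hg.1)
  have h2 := g.mem_closure b.src hg.1
  rw [hg.2, mem_closure_iff_nhds] at h2
  obtain ⟨z, hz, hz'⟩ := h2 _ (h1.eventually (gt_mem_nhds hneg))
  exact (hz'.2 i hi).not_gt hz

/-- The component over `Q` lies in the component over the whole box, which is the positive part. It
therefore meets the connected set `Q ∩ b.pos` and absorbs it. -/
lemma inter_pos_subset_comp {g : Blowup X E} (hg : g ∈ b.cell) {Q : Opens X} (hgQ : g.pt ∈ Q)
    (hQ : Q ≤ b.src) (hc : IsPreconnected ((Q : Set X) ∩ b.pos)) :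
    (Q : Set X) ∩ b.pos ⊆ g.comp Q := by
  refine g.subset_comp hc (fun z hz => ⟨hz.1, (b.pos_subset hz.2).2⟩) ?_
  obtain ⟨z, hz⟩ := g.comp_nonempty Q hgQ
  have h1 := g.compatible Q b.src hgQ hQ hz
  rw [hg.2] at h1
  exact ⟨z, ⟨(g.comp_subset _ hz).1, h1⟩, hz⟩

/-- Over small `Q` both components contain the nonempty set `Q ∩ b.pos`. Injectivity of the
projection on a cell is what allows the coordinates of the box to serve as a chart of the blowup. -/
lemma ext_of_mem_cell {g g' : Blowup X E} (hg : g ∈ b.cell) (hg' : g' ∈ b.cell)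
    (hpt : g.pt = g'.pt) : g = g' := by
  refine GermSpace.ext_of_inter hpt fun V hV => ?_
  obtain ⟨Q, hyQ, hQV, hQs, hc⟩ := b.exists_nhd hg.1 V hV
  refine ⟨Q, hQV, hyQ, ?_⟩
  obtain ⟨z, hz⟩ := b.nonempty_inter_pos (mem_nonneg_of_mem_cell hg) (Q.isOpen.mem_nhds hyQ)
  exact ⟨z, inter_pos_subset_comp hg hyQ hQs hc hz,
    inter_pos_subset_comp hg' (hpt ▸ hyQ) hQs hc hz⟩

variable (b)

lemma nhdsWithin_pos_neBot {y : X} (hy : y ∈ b.nonneg) : (𝓝[b.pos] y).NeBot := by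
  rw [← mem_closure_iff_nhdsWithin_neBot, mem_closure_iff_nhds]
  exact fun N hN => b.nonempty_inter_pos hy hN

lemma compl_mem_nhdsWithin_pos (y : X) : Eᶜ ∈ 𝓝[b.pos] y :=
  mem_of_superset self_mem_nhdsWithin fun _ hz => (b.pos_subset hz).2

lemma exists_preconnected_mem {y : X} (hy : y ∈ b.nonneg) (A : Set X) (hA : A ∈ 𝓝[b.pos] y) :
    ∃ B ∈ 𝓝[b.pos] y, B ⊆ A ∧ IsPreconnected B := by
  obtain ⟨O, hO, hyO, hOA⟩ := mem_nhdsWithin.1 hA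
  obtain ⟨Q, hyQ, hQV, -, hc⟩ := b.exists_nhd hy.1 ⟨O, hO⟩ hyO
  exact ⟨_, inter_mem (nhdsWithin_le_nhds (Q.isOpen.mem_nhds hyQ)) self_mem_nhdsWithin,
    fun z hz => hOA ⟨hQV hz.1, hz.2⟩, hc⟩

/-- The germ of the positive part at a point of its closure. -/
def germAt (y : X) (hy : y ∈ b.nonneg) : Blowup X E :=
  have := b.nhdsWithin_pos_neBot hy
  GermSpace.ofFilter y (𝓝[b.pos] y) nhdsWithin_le_nhds
    (b.compl_mem_nhdsWithin_pos y) (b.exists_preconnected_mem hy)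

lemma inter_pos_subset_germAt_comp {y : X} (hy : y ∈ b.nonneg) {Q V : Opens X} (hyQ : y ∈ Q)
    (hQV : Q ≤ V) (hc : IsPreconnected ((Q : Set X) ∩ b.pos)) :
    (Q : Set X) ∩ b.pos ⊆ (b.germAt y hy).comp V :=
  have := b.nhdsWithin_pos_neBot hy
  GermSpace.ofFilter_comp (hx := nhdsWithin_le_nhds) (hU := b.compl_mem_nhdsWithin_pos y)
    (hF := b.exists_preconnected_mem hy) (hQV hyQ)
    (inter_mem (nhdsWithin_le_nhds (Q.isOpen.mem_nhds hyQ)) self_mem_nhdsWithin)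
    (fun _ hz => ⟨hQV hz.1, (b.pos_subset hz.2).2⟩) hc

lemma germAt_mem_cell (y : X) (hy : y ∈ b.nonneg) : b.germAt y hy ∈ b.cell := by
  refine ⟨hy.1, ?_⟩
  have h1 : (b.src : Set X) ∩ b.pos = b.pos := inter_eq_right.2 fun z hz => hz.1
  have h2 := b.inter_pos_subset_germAt_comp hy (Q := b.src) hy.1 le_rfl
    (by rw [h1]; exact b.isPreconnected_pos)
  rw [h1] at h2
  obtain ⟨z, -, hz⟩ := b.nonempty_inter_pos hy univ_mem
  exact Subset.antisymm (b.subset_pos (GermSpace.comp_preconnected _ _) (GermSpace.comp_subset _ _)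
    ⟨z, h2 hz, hz⟩) h2

/-- Germs at nearby points have the same components. -/
lemma eventually_germAt_comp_eq {y : X} (hy : y ∈ b.nonneg) {V : Opens X} (hV : y ∈ V) :
    ∀ᶠ z in 𝓝 y, ∀ hz : z ∈ b.nonneg, z ∈ V ∧ (b.germAt z hz).comp V = (b.germAt y hy).comp V := by
  obtain ⟨Q, hyQ, hQV, -, hc⟩ := b.exists_nhd hy.1 V hV
  filter_upwards [Q.isOpen.mem_nhds hyQ] with z hzQ hz
  refine ⟨hQV hzQ, GermSpace.comp_eq_of_inter_nonempty _ _ ?_⟩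
  -- One point of `Q ∩ b.pos` belongs to the components of both germs over `V`.
  obtain ⟨w, hw⟩ := b.nonempty_inter_pos hy (Q.isOpen.mem_nhds hyQ)
  exact ⟨w, b.inter_pos_subset_germAt_comp hz hzQ hQV hc hw,
    b.inter_pos_subset_germAt_comp hy hyQ hQV hc hw⟩

/-! Changing signs of coordinates -/

/-- Multiplication of the coordinates by signs. -/
def signHomeo {n : ℕ} (s : Fin n → ℤˣ) :
    EuclideanSpace ℝ (Fin n) ≃ₜ EuclideanSpace ℝ (Fin n) where
  toFun v := WithLp.toLp 2 fun i => ((s i : ℤ) : ℝ) * v i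
  invFun v := WithLp.toLp 2 fun i => ((s i : ℤ) : ℝ) * v i
  left_inv v := by
    ext i
    rcases Int.units_eq_one_or (s i) with h | h <;> simp [h]
  right_inv v := by
    ext i
    rcases Int.units_eq_one_or (s i) with h | h <;> simp [h]
  continuous_toFun := by fun_prop
  continuous_invFun := by fun_prop

lemma contDiff_signHomeo {n : ℕ} (s : Fin n → ℤˣ) : ContDiff ℝ ∞ (signHomeo s) := by
  refine contDiff_euclidean.2 fun i => ?_
  exact contDiff_const.mul (EuclideanSpace.proj (𝕜 := ℝ) i :
    EuclideanSpace ℝ (Fin n) →L[ℝ] ℝ).contDiff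

lemma signHomeo_symm {n : ℕ} (s : Fin n → ℤˣ) : (signHomeo s).symm = signHomeo s := rfl

lemma signHomeo_apply {n : ℕ} (s : Fin n → ℤˣ) (v : EuclideanSpace ℝ (Fin n)) (i : Fin n) :
    signHomeo s v i = ((s i : ℤ) : ℝ) * v i := rfl

/-- The box with the signs of some coordinates changed. -/
def flip (s : Fin X.dim → ℤˣ) : Box X E where
  e := b.e.transHomeomorph (signHomeo s)
  target_eq := by
    change (signHomeo s).symm ⁻¹' b.e.target = _
    rw [b.target_eq]
    ext v
    refine forall_congr' fun i => ?_
    rw [signHomeo_symm, signHomeo_apply]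
    rcases Int.units_eq_one_or (s i) with h | h <;> simp [h]
  contMDiffOn := (contDiff_signHomeo s).contMDiff.comp_contMDiffOn b.contMDiffOn
  contMDiffOn_symm := b.contMDiffOn_symm.comp
    ((contDiff_signHomeo s).contMDiff.contMDiffOn) fun _ hv => hv
  k := b.k
  mem_iff y hy := by
    refine (b.mem_iff y hy).trans (exists_congr fun i => and_congr_right fun _ => ?_)
    change _ ↔ signHomeo s (b.e y) i = 0
    rw [signHomeo_apply]
    rcases Int.units_eq_one_or (s i) with h | h <;> simp [h]

lemma flip_apply (s : Fin X.dim → ℤˣ) (y : X) (i : Fin X.dim) :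
    (b.flip s).e y i = ((s i : ℤ) : ℝ) * b.e y i := rfl

/-- The signs of the coordinates at one point of the component determine the orthant. The cells of
the flipped boxes thus cover all germs over a box, and only finitely many choices of signs are
needed. -/
lemma exists_flip (g : Blowup X E) (hg : g.pt ∈ b.src) : ∃ s, g ∈ (b.flip s).cell := by
  obtain ⟨y, hy⟩ := g.comp_nonempty b.src hg
  have hy' := g.comp_subset _ hy
  -- Only the signs of the first `k` coordinates matter; the others are chosen by the same rule.
  let s : Fin X.dim → ℤˣ := fun i => if 0 < b.e y i then 1 else -1
  have hpos : y ∈ (b.flip s).pos := by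
    refine ⟨hy'.1, fun i hi => ?_⟩
    have h0 : b.e y i ≠ 0 := fun h0 => hy'.2 ((b.mem_iff y hy'.1).2 ⟨i, hi, h0⟩)
    rw [flip_apply]
    by_cases h : 0 < b.e y i
    · simp [s, h]
    · simp only [s, h, if_false, Units.val_neg, Units.val_one, Int.cast_neg, Int.cast_one, neg_mul,
        one_mul, neg_pos]
      exact lt_of_le_of_ne (not_lt.1 h) h0
  refine ⟨s, hg, Subset.antisymm ?_ ?_⟩
  · exact (b.flip s).subset_pos (GermSpace.comp_preconnected _ _) (GermSpace.comp_subset _ _)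
      ⟨y, hy, hpos⟩
  · exact g.subset_comp (b.flip s).isPreconnected_pos (b.flip s).pos_subset ⟨y, hpos, hy⟩

/-! Charts of the blowup -/

/-- The translation vector which makes the last coordinates positive. -/
def offset : X.Vec := WithLp.toLp 2 fun i => if i.1 < b.k then 0 else 1

lemma symm_zero_mem_nonneg : b.e.symm 0 ∈ b.nonneg := by
  have h : (0 : X.Vec) ∈ b.e.target := by rw [b.target_eq]; simp
  exact ⟨b.e.map_target h, fun i _ => by rw [b.e.right_inv h]; simp⟩

open Classical in
/-- The germ of the positive part at the point with given coordinates. -/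
def germ (y : X) : Blowup X E :=
  -- Outside `b.nonneg` the value is an arbitrary germ; the chart evaluates the function only on
  -- `b.nonneg`.
  if hy : y ∈ b.nonneg then b.germAt y hy else b.germAt _ b.symm_zero_mem_nonneg

lemma germ_eq {y : X} (hy : y ∈ b.nonneg) : b.germ y = b.germAt y hy := dif_pos hy

lemma continuousOn_germ : ContinuousOn b.germ b.nonneg := by
  intro y hy
  refine GermSpace.tendsto_nhds_iff.2 fun V hV => ?_
  rw [b.germ_eq hy] at hV
  filter_upwards [nhdsWithin_le_nhds (b.eventually_germAt_comp_eq hy hV), self_mem_nhdsWithin]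
    with z hz hz'
  rw [b.germ_eq hy, b.germ_eq hz']
  exact hz hz'

lemma germ_mem_cell {y : X} (hy : y ∈ b.nonneg) : b.germ y ∈ b.cell := by
  rw [b.germ_eq hy]
  exact b.germAt_mem_cell y hy

lemma germ_pt_of_mem {y : X} (hy : y ∈ b.nonneg) : (b.germ y).pt = y := by
  rw [b.germ_eq hy]; rfl

lemma germ_pt {g : Blowup X E} (hg : g ∈ b.cell) : b.germ g.pt = g :=
  ext_of_mem_cell (b.germ_mem_cell (mem_nonneg_of_mem_cell hg)) hg
    (b.germ_pt_of_mem (mem_nonneg_of_mem_cell hg))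

variable {b} in
lemma add_offset_nonneg {y : X} (hy : y ∈ b.nonneg) (i : Fin X.dim) :
    0 ≤ (b.e y + b.offset) i := by
  have h1 := b.e.map_source hy.1
  rw [b.target_eq] at h1
  have h2 := abs_lt.1 (h1 i)
  simp only [PiLp.add_apply, offset]
  split_ifs with hi
  · simpa using hy.2 i hi
  · linarith

lemma model_symm_coe {v : X.Vec} (hv : ∀ i, 0 ≤ v i) : (X.model.symm v).1 = v := by
  have : v ∈ range X.model := ⟨⟨v, hv⟩, rfl⟩
  exact X.model.right_inv this

lemma symm_sub_offset_mem_nonneg {q : EuclideanQuadrant X.dim} (hq : q.1 - b.offset ∈ b.e.target) :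
    b.e.symm (q.1 - b.offset) ∈ b.nonneg := by
  refine ⟨b.e.map_target hq, fun i hi => ?_⟩
  rw [b.e.right_inv hq]
  simpa [offset, hi] using q.2 i

/-- The chart of the blowup on the cell of a box. -/
def toChart : OpenPartialHomeomorph (Blowup X E) (EuclideanQuadrant X.dim) where
  -- The model is a full quadrant. The coordinates that do not cut out `E` lie in `(-1, 1)`, so
  -- adding `1` makes them positive and they do not contribute to the boundary.
  toFun g := X.model.symm (b.e g.pt + b.offset)
  invFun q := b.germ (b.e.symm (q.1 - b.offset))
  source := b.cell
  target := {q | q.1 - b.offset ∈ b.e.target}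
  map_source' g hg := by
    have h := mem_nonneg_of_mem_cell hg
    change (X.model.symm (b.e g.pt + b.offset)).1 - b.offset ∈ b.e.target
    rw [model_symm_coe (add_offset_nonneg h), add_sub_cancel_right]
    exact b.e.map_source h.1
  map_target' q hq := b.germ_mem_cell (b.symm_sub_offset_mem_nonneg hq)
  left_inv' g hg := by
    have h := mem_nonneg_of_mem_cell hg
    dsimp only
    rw [model_symm_coe (add_offset_nonneg h), add_sub_cancel_right, b.e.left_inv h.1, b.germ_pt hg]
  right_inv' q hq := by
    dsimp only
    rw [b.germ_pt_of_mem (b.symm_sub_offset_mem_nonneg hq), b.e.right_inv hq, sub_add_cancel]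
    exact X.model.left_inv q
  open_source := b.isOpen_cell
  open_target := b.e.open_target.preimage (continuous_subtype_val.sub continuous_const)
  continuousOn_toFun := by
    refine X.model.continuous_symm.comp_continuousOn (ContinuousOn.add ?_ continuousOn_const)
    exact b.e.continuousOn.comp GermSpace.continuous_pt.continuousOn fun g hg => hg.1
  continuousOn_invFun := by
    refine b.continuousOn_germ.comp ?_ fun q hq => b.symm_sub_offset_mem_nonneg hq
    exact b.e.continuousOn_symm.comp
      (continuous_subtype_val.sub continuous_const).continuousOn fun q hq => hq

lemma toChart_coe {g : Blowup X E} (hg : g ∈ b.cell) : (b.toChart g).1 = b.e g.pt + b.offset :=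
  model_symm_coe (add_offset_nonneg (mem_nonneg_of_mem_cell hg))

end Box

end HyperBlowup

namespace HyperBlowup

open TopologicalSpace (Opens)
open Filter

/-! ### The blowup as a manifold with corners -/

/-- `E` is locally a union of coordinate hyperplanes. -/
structure IsNC (X : ManC) (E : Set X) : Prop where
  boundaryless : X.IsBoundaryless
  exists_box : ∀ x : X, ∃ b : Box X E, x ∈ b.e.source ∧ b.e x = 0

/-- Up to the translations by the offsets, a change of charts is the restriction of the change of
coordinates between two boxes of `X`, which is smooth on an open subset of $\mathbb R^n$. -/
lemma Box.contDiffOn_transition {X : ManC} {E : Set X} (b b' : Box X E) :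
    ContDiffOn ℝ ∞ (X.model ∘ (b.toChart.symm ≫ₕ b'.toChart) ∘ X.model.symm)
      (X.model.symm ⁻¹' (b.toChart.symm ≫ₕ b'.toChart).source ∩ range X.model) := by
  have h1 : ContDiffOn ℝ ∞ (fun v => b'.e (b.e.symm (v - b.offset)) + b'.offset)
      {v | v - b.offset ∈ b.e.target ∧ b.e.symm (v - b.offset) ∈ b'.e.source} := by
    refine ContDiffOn.add ?_ contDiffOn_const
    have h2 : ContDiffOn ℝ ∞ (b'.e ∘ b.e.symm) (b.e.target ∩ b.e.symm ⁻¹' b'.e.source) :=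
      contMDiffOn_iff_contDiffOn.1 (b'.contMDiffOn.comp
        (b.contMDiffOn_symm.mono inter_subset_left) fun v hv => hv.2)
    exact h2.comp (contDiff_id.sub contDiff_const).contDiffOn fun v hv => hv
  refine (h1.mono ?_).congr ?_
  · rintro _ ⟨hv, q, rfl⟩
    have hq : X.model.symm (X.model q) = q := X.model.left_inv q
    rw [mem_preimage, hq] at hv
    have h3 : q.1 - b.offset ∈ b.e.target := hv.1
    have h4 : b.germ (b.e.symm (q.1 - b.offset)) ∈ b'.cell := hv.2
    have h5 := (Box.mem_nonneg_of_mem_cell h4).1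
    rw [b.germ_pt_of_mem (b.symm_sub_offset_mem_nonneg h3)] at h5
    exact ⟨h3, h5⟩
  · rintro _ ⟨hv, q, rfl⟩
    have hq : X.model.symm (X.model q) = q := X.model.left_inv q
    rw [mem_preimage, hq] at hv
    have h3 : q.1 - b.offset ∈ b.e.target := hv.1
    have h4 : b.germ (b.e.symm (q.1 - b.offset)) ∈ b'.cell := hv.2
    simp only [Function.comp_apply, hq]
    refine (b'.toChart_coe h4).trans ?_
    rw [b.germ_pt_of_mem (b.symm_sub_offset_mem_nonneg h3)]
    rfl

namespace IsNC

variable {X : ManC} {E : Set X}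


lemma exists_box_cell (h : IsNC X E) (g : Blowup X E) : ∃ b : Box X E, g ∈ b.cell ∧ b.e g.pt = 0 := by
  obtain ⟨b, hb, hb0⟩ := h.exists_box g.pt
  obtain ⟨s, hs⟩ := b.exists_flip g hb
  refine ⟨b.flip s, hs, ?_⟩
  ext i
  rw [Box.flip_apply, hb0]
  simp

/-- A box centred at the base point of a germ. -/
def box (h : IsNC X E) (g : Blowup X E) : Box X E := (h.exists_box_cell g).choose

lemma mem_cell (h : IsNC X E) (g : Blowup X E) : g ∈ (h.box g).cell := (h.exists_box_cell g).choose_spec.1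

lemma box_pt (h : IsNC X E) (g : Blowup X E) : (h.box g).e g.pt = 0 := (h.exists_box_cell g).choose_spec.2

lemma pt_mem_source (h : IsNC X E) (g : Blowup X E) : g.pt ∈ (h.box g).e.source := (h.mem_cell g).1

/-- The atlas of the blowup. -/
@[reducible] def chartedSpace (h : IsNC X E) : ChartedSpace (EuclideanQuadrant X.dim) (Blowup X E) where
  atlas := range Box.toChart
  chartAt := fun g => (h.box g).toChart
  mem_chart_source g := h.mem_cell g
  chart_mem_atlas _ := mem_range_self _

lemma isManifold (h : IsNC X E) : @IsManifold _ _ _ _ _ _ _ X.model ∞ (Blowup X E) _ h.chartedSpace := by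
  let _ := h.chartedSpace
  refine isManifold_of_contDiffOn X.model ∞ (Blowup X E) ?_
  rintro _ _ ⟨b, rfl⟩ ⟨b', rfl⟩
  exact b.contDiffOn_transition b'

/-- Germs at different points are separated by the projection. Germs at the same point are separated
by their components over a single box, since a cell contains at most one germ over each point. -/
lemma t2Space (h : IsNC X E) : T2Space (Blowup X E) := by
  refine ⟨fun g g' hne => ?_⟩
  by_cases hpt : g.pt = g'.pt
  · let b := h.box g
    refine ⟨b.cell, {g'' | g''.pt ∈ b.src ∧ g''.comp b.src = g'.comp b.src}, b.isOpen_cell,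
      GermSpace.isOpen_basic _ _, h.mem_cell g, ⟨hpt ▸ h.pt_mem_source g, rfl⟩, ?_⟩
    refine disjoint_left.2 fun g'' h1 h2 => hne ?_
    refine Box.ext_of_mem_cell (h.mem_cell g) ⟨hpt ▸ h.pt_mem_source g, ?_⟩ hpt
    rw [← h2.2, h1.2]
  · obtain ⟨O, O', hO, hO', hg, hg', hd⟩ := t2_separation hpt
    exact ⟨_, _, hO.preimage GermSpace.continuous_pt, hO'.preimage GermSpace.continuous_pt, hg, hg',
      hd.preimage _⟩

lemma secondCountable (h : IsNC X E) : SecondCountableTopology (Blowup X E) := by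
  choose b hb _ using h.exists_box
  -- Countably many boxes cover `X`, and over each of them finitely many cells cover the blowup.
  obtain ⟨s, hs, hcov⟩ := TopologicalSpace.countable_cover_nhds
    (f := fun x => (b x).e.source) fun x => (b x).e.open_source.mem_nhds (hb x)
  have : Countable s := hs
  let U : s × (Fin X.dim → ℤˣ) → Set (Blowup X E) := fun z => ((b z.1).flip z.2).cell
  have : SecondCountableTopology (EuclideanQuadrant X.dim) :=
    TopologicalSpace.Subtype.secondCountableTopology _
  have : ∀ z, SecondCountableTopology (U z) := fun z =>
    ((b z.1).flip z.2).toChart.toHomeomorphSourceTarget.secondCountableTopology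
  refine TopologicalSpace.secondCountableTopology_of_countable_cover (U := U)
    (fun z => Box.isOpen_cell _) (eq_univ_of_forall fun g => ?_)
  have hg : g.pt ∈ ⋃ x ∈ s, (b x).e.source := by rw [hcov]; trivial
  obtain ⟨x, hx, hgx⟩ := mem_iUnion₂.1 hg
  obtain ⟨σ, hσ⟩ := (b x).exists_flip g hgx
  exact mem_iUnion.2 ⟨(⟨x, hx⟩, σ), hσ⟩

/-- The blowup of `X` at `E`, as a manifold with corners. -/
def blowup (h : IsNC X E) : ManC :=
  letI := h.chartedSpace
  haveI := h.t2Space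
  haveI := h.secondCountable
  haveI := h.isManifold
  { carrier := Blowup X E
    dim := X.dim }

lemma extChartAt_coe (h : IsNC X E) {g g' : h.blowup} (hg' : g' ∈ (h.box g).cell) :
    extChartAt h.blowup.model g g' = (h.box g).e g'.pt + (h.box g).offset :=
  (h.box g).toChart_coe hg'

lemma coord_eq (h : IsNC X E) {g g' : h.blowup} (hg' : g' ∈ (h.box g).cell) (i : Fin X.dim) :
    h.blowup.coord g g' i = (h.box g).e g'.pt i + if i.1 < (h.box g).k then 0 else 1 :=
  congrArg (fun v : X.Vec => v i) ((h.box g).toChart_coe hg')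

/-- The box is centred at the base point, so exactly the coordinates that cut out `E` vanish. -/
lemma coord_self (h : IsNC X E) (g : h.blowup) (i : Fin X.dim) :
    h.blowup.coord g g i = if i.1 < (h.box g).k then 0 else 1 := by
  have h1 : (h.box g).e (GermSpace.pt g) i = 0 := congrArg (fun v : X.Vec => v i) (h.box_pt g)
  exact (h.coord_eq (h.mem_cell g) i).trans (by rw [h1, zero_add])

lemma cell_mem_nhds (h : IsNC X E) (g : h.blowup) : (h.box g).cell ∈ 𝓝 g :=
  (h.box g).isOpen_cell.mem_nhds (h.mem_cell g)

lemma continuous_pt (h : IsNC X E) : Continuous fun g : h.blowup => GermSpace.pt g :=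
  GermSpace.continuous_pt

/-- A map to the blowup is smooth if its composition with the projection is. -/
lemma contMDiffWithinAt_of_pt (h : IsNC X E) {V : Type*} [NormedAddCommGroup V] [NormedSpace ℝ V] {H : Type*}
    [TopologicalSpace H] {I : ModelWithCorners ℝ V H} {M : Type*} [TopologicalSpace M]
    [ChartedSpace H M] {F : M → h.blowup} {s : Set M} {x : M}
    (hF : ContinuousWithinAt F s x)
    (hpt : ContMDiffWithinAt I X.model ∞ (fun y => GermSpace.pt (F y)) s x) :
    ContMDiffWithinAt I h.blowup.model ∞ F s x := by
  refine contMDiffWithinAt_iff_target.2 ⟨hF, ?_⟩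
  have h1 : ContMDiffAt X.model 𝓘(ℝ, X.Vec) ∞
      (fun y => ((h.box (F x)).e y + (h.box (F x)).offset : X.Vec)) (GermSpace.pt (F x)) :=
    ((h.box (F x)).contMDiffOn.contMDiffAt
      ((h.box (F x)).e.open_source.mem_nhds (h.pt_mem_source (F x)))).add contMDiffAt_const
  have h2 : ContMDiffWithinAt I 𝓘(ℝ, X.Vec) ∞
      (fun y => ((h.box (F x)).e (GermSpace.pt (F y)) + (h.box (F x)).offset : X.Vec)) s x :=
    ContMDiffAt.comp_contMDiffWithinAt (g := fun y => ((h.box (F x)).e y + (h.box (F x)).offset : X.Vec))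
      x h1 hpt
  refine h2.congr_of_eventuallyEq ?_ (h.extChartAt_coe (h.mem_cell (F x)))
  filter_upwards [hF (h.cell_mem_nhds (F x))] with y hy
  exact h.extChartAt_coe hy

lemma contMDiff_of_pt (h : IsNC X E) {M : ManC} {F : M → h.blowup} (hF : Continuous F)
    (hpt : ContMDiff M.model X.model ∞ fun y => GermSpace.pt (F y)) :
    ContMDiff M.model h.blowup.model ∞ F := fun x =>
  h.contMDiffWithinAt_of_pt hF.continuousWithinAt (hpt x)

/-- The projection is smooth. -/
lemma contMDiff_pt (h : IsNC X E) :
    ContMDiff h.blowup.model X.model ∞ fun g : h.blowup => GermSpace.pt g := by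
  intro g
  let b := h.box g
  let sub : X.Vec → X.Vec := fun v => v - b.offset
  let c : h.blowup → X.Vec := fun g' => sub (extChartAt h.blowup.model g g')
  have h1 : ContMDiffAt h.blowup.model 𝓘(ℝ, X.Vec) ∞ c g :=
    (contDiff_id.sub contDiff_const : ContDiff ℝ ∞ sub).contMDiff.contMDiffAt.comp g
      contMDiffAt_extChartAt
  have h2 : ∀ g' ∈ b.cell, c g' = b.e g'.pt := fun g' hg' =>
    (congrArg sub (h.extChartAt_coe hg')).trans
      (add_sub_cancel_right _ _)
  have h3 : ContMDiffAt 𝓘(ℝ, X.Vec) X.model ∞ b.e.symm (c g) := by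
    rw [h2 g (h.mem_cell g)]
    exact b.contMDiffOn_symm.contMDiffAt
      (b.e.open_target.mem_nhds (b.e.map_source (h.pt_mem_source g)))
  refine (h3.comp g h1).congr_of_eventuallyEq ?_
  filter_upwards [h.cell_mem_nhds g] with g' hg'
  simp only [Function.comp_apply]
  rw [h2 g' hg']
  exact (b.e.left_inv (Box.mem_nonneg_of_mem_cell hg').1).symm

/-- The coordinates of a boundaryless target are positive near the image point and hence are
monomials with exponent zero. The monomial condition on maps into such manifolds is therefore
automatic. -/
lemma isMonomialAt_of_contMDiff_of_boundaryless {M X : ManC} (hX : X.IsBoundaryless) {f : M → X}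
    (hf : ContMDiff M.model X.model ∞ f) (c : M) (j : Fin X.dim) :
    M.IsMonomialAt c (fun y => X.coord (f c) (f y) j) 0 := by
  have h1 : ContMDiffOn M.model 𝓘(ℝ, ℝ) ∞ (fun y => X.coord (f c) (f y) j)
      (f ⁻¹' (chartAt (EuclideanQuadrant X.dim) (f c)).source) :=
    (X.contMDiffOn_coord (f c) j).comp hf.contMDiffOn fun _ h => h
  have ho := h1.continuousOn.isOpen_inter_preimage
    ((chartAt (EuclideanQuadrant X.dim) (f c)).open_source.preimage hf.continuous)
    (isOpen_Ioi (a := (0 : ℝ)))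
  exact ManC.isMonomialAt_of_pos ho ⟨mem_chart_source _ (f c), hX.coord_pos (f c) j⟩
    (h1.mono inter_subset_left) fun y hy => hy.2

/-- The projection from the blowup. -/
def β (h : IsNC X E) : h.blowup ⟶ X :=
  show ManC.Hom _ _ from
  { toFun := fun g => GermSpace.pt g
    weaklySmooth := h.contMDiff_pt
    smooth := fun c j => Or.inl ⟨0,
      isMonomialAt_of_contMDiff_of_boundaryless h.boundaryless h.contMDiff_pt c j⟩ }

/-- The cardinality is kept in this form because `k` is not required to be at most the dimension. -/
lemma depth_eq (h : IsNC X E) (g : h.blowup) : h.blowup.depth g = {i : Fin X.dim | i.1 < (h.box g).k}.ncard := by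
  change {i | h.blowup.coord g g i = 0}.ncard = _
  congr 1
  ext i
  have h1 := h.coord_self g i
  change h.blowup.coord g g i = 0 ↔ i.1 < (h.box g).k
  refine (Eq.congr_left h1).trans ?_
  simp

/-- Depth zero means that no coordinate of the box cuts out `E`. Then the component over the box is
the whole box, and the base point carries only one germ. In general the coordinates of the box,
without the offset, serve as charts both of the cell and of `X`. -/
lemma isRectilinear (h : IsNC X E) : ManC.IsRectilinear fun g : h.blowup => GermSpace.pt g := by
  constructor
  · intro g hg g' hg' hpt
    change GermSpace.pt g = GermSpace.pt g' at hpt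
    have hk : ∀ i : Fin X.dim, ¬ i.1 < (h.box g).k := by
      have h1 : h.blowup.depth g = 0 := hg
      rw [h.depth_eq, Set.ncard_eq_zero (Set.toFinite _)] at h1
      intro i hi
      have : i ∈ {i : Fin X.dim | i.1 < (h.box g).k} := hi
      rw [h1] at this
      exact this
    have hpos : (h.box g).pos = (h.box g).e.source := by
      ext y
      exact ⟨fun hy => hy.1, fun hy => ⟨hy, fun i hi => absurd hi (hk i)⟩⟩
    have hs : GermSpace.pt g' ∈ (h.box g).src := hpt ▸ h.pt_mem_source g
    refine Box.ext_of_mem_cell (h.mem_cell g) ⟨hs, ?_⟩ hpt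
    obtain ⟨y, hy⟩ := GermSpace.comp_nonempty g' _ hs
    have hy' : y ∈ (h.box g).pos := by
      rw [hpos]
      exact (GermSpace.comp_subset _ _ hy).1
    exact Subset.antisymm ((h.box g).subset_pos (GermSpace.comp_preconnected _ _)
      (GermSpace.comp_subset _ _) ⟨y, hy, hy'⟩)
      (GermSpace.subset_comp _ (h.box g).isPreconnected_pos (h.box g).pos_subset ⟨y, hy', hy⟩)
  · intro c
    let b := h.box c
    have himg : (fun g : h.blowup => b.e (GermSpace.pt g)) '' b.cell =
        b.e.target ∩ ManC.orthant X.dim b.k := by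
      ext v
      constructor
      · rintro ⟨g, hg, rfl⟩
        have h1 := Box.mem_nonneg_of_mem_cell hg
        exact ⟨b.e.map_source h1.1, h1.2⟩
      · rintro ⟨hv, hv'⟩
        have h1 : b.e.symm v ∈ b.nonneg :=
          ⟨b.e.map_target hv, fun i hi => by rw [b.e.right_inv hv]; exact hv' i hi⟩
        refine ⟨b.germ (b.e.symm v), b.germ_mem_cell h1, ?_⟩
        dsimp only
        rw [b.germ_pt_of_mem h1, b.e.right_inv hv]
    refine ⟨b.k, b.cell, fun g => b.e (GermSpace.pt g), b.e.source, b.e, h.mem_cell c, ?_,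
      h.box_pt c, h.pt_mem_source c, ?_, h.box_pt c,
      fun g hg => ⟨(Box.mem_nonneg_of_mem_cell hg).1, rfl⟩⟩
    · refine ⟨b.isOpen_cell, ⟨b.e.target, b.e.open_target, himg⟩, ?_, ?_⟩
      · exact b.contMDiffOn.comp h.contMDiff_pt.contMDiffOn
          fun g hg => (Box.mem_nonneg_of_mem_cell hg).1
      · refine ⟨fun v => b.germ (b.e.symm v), ?_, fun g hg => ?_⟩
        · rw [himg]
          have hn : ∀ v ∈ b.e.target ∩ ManC.orthant X.dim b.k, b.e.symm v ∈ b.nonneg :=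
            fun v hv => ⟨b.e.map_target hv.1, fun i hi => by
              rw [b.e.right_inv hv.1]; exact hv.2 i hi⟩
          have hcont : ContinuousOn (fun v => b.germ (b.e.symm v))
              (b.e.target ∩ ManC.orthant X.dim b.k) :=
            b.continuousOn_germ.comp (b.e.continuousOn_symm.mono inter_subset_left) hn
          refine fun v hv => h.contMDiffWithinAt_of_pt (hcont v hv) ?_
          refine ((b.contMDiffOn_symm v hv.1).mono inter_subset_left).congr (fun w hw => ?_) ?_
          · exact b.germ_pt_of_mem (hn w hw)
          · exact b.germ_pt_of_mem (hn v hv)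
        · dsimp only
          rw [b.e.left_inv (Box.mem_nonneg_of_mem_cell hg).1]
          exact b.germ_pt hg
    · have himg' : b.e '' b.e.source = b.e.target := b.e.image_source_eq_target
      refine ⟨b.e.open_source, ⟨b.e.target, b.e.open_target, ?_⟩, b.contMDiffOn,
        ⟨b.e.symm, ?_, fun x hx => b.e.left_inv hx⟩⟩
      · rw [himg']
        refine (inter_eq_left.2 fun v _ i hi => absurd hi (Nat.not_lt_zero _)).symm
      · rw [himg']
        exact b.contMDiffOn_symm

end IsNC

end HyperBlowup

namespace HyperBlowup

open Filter

/-! ### Differentials of functions and the inverse function theorem -/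

section InverseFunction

variable {V U : Type*} [NormedAddCommGroup V] [NormedSpace ℝ V] [CompleteSpace V]
  [NormedAddCommGroup U] [NormedSpace ℝ U]

/-- The inverse function theorem for maps which are smooth near a point. -/
lemma exists_openPartialHomeomorph {F : V → U} {a : V} (hF : ∀ᶠ v in 𝓝 a, ContDiffAt ℝ ∞ F v)
    (F' : V ≃L[ℝ] U) (hF' : HasFDerivAt F (F' : V →L[ℝ] U) a) :
    ∃ e : OpenPartialHomeomorph V U, a ∈ e.source ∧ (e : V → U) = F ∧
      ContDiffOn ℝ ∞ e e.source ∧ ContDiffOn ℝ ∞ e.symm e.target := by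
  have hFa := hF.self_of_nhds
  have h1 : ∀ᶠ v in 𝓝 a, fderiv ℝ F v ∈ range ((↑) : (V ≃L[ℝ] U) → V →L[ℝ] U) := by
    have h2 : ContinuousAt (fderiv ℝ F) a := (hFa.fderiv_right (m := 0) (by simp)).continuousAt
    refine h2.eventually_mem ?_
    rw [hF'.fderiv]
    exact ContinuousLinearEquiv.nhds F'
  -- Restricting to the points where `F` is smooth with invertible differential makes the inverse
  -- smooth on the entire target.
  obtain ⟨O, hO, hOo, haO⟩ := mem_nhds_iff.1 (hF.and h1)
  let e₀ := hFa.toOpenPartialHomeomorph F hF' (by simp)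
  have he₀ : (e₀ : V → U) = F := rfl
  refine ⟨e₀.restrOpen O hOo, ⟨hFa.mem_toOpenPartialHomeomorph_source hF' (by simp), haO⟩, rfl,
    fun v hv => ?_, fun w hw => ?_⟩
  · exact (hO hv.2).1.contDiffWithinAt
  · have h3 : e₀.symm w ∈ O := hw.2
    obtain ⟨A, hA⟩ := (hO h3).2
    refine (e₀.contDiffAt_symm hw.1 (f₀' := A) ?_ (hO h3).1).contDiffWithinAt
    rw [hA]
    exact ((hO h3).1.differentiableAt (by simp)).hasFDerivAt

end InverseFunction

section Coordinates

variable {n : ℕ}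

local notation "𝔼" => EuclideanSpace ℝ (Fin n)

/-- Functions with independent differentials are part of a coordinate system. -/
lemma exists_coordinates {ι : Type} [Finite ι] {u : ι → 𝔼 → ℝ} {a : 𝔼}
    (hu : ∀ j, ∀ᶠ v in 𝓝 a, ContDiffAt ℝ ∞ (u j) v) (hu0 : ∀ j, u j a = 0)
    (hli : LinearIndependent ℝ fun j => ((fderiv ℝ (u j) a : 𝔼 →L[ℝ] ℝ) : 𝔼 →ₗ[ℝ] ℝ)) :
    ∃ (e : OpenPartialHomeomorph 𝔼 𝔼) (k : ℕ) (σ : ι → Fin n), a ∈ e.source ∧ e a = 0 ∧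
      ContDiffOn ℝ ∞ e e.source ∧ ContDiffOn ℝ ∞ e.symm e.target ∧
      (∀ i : Fin n, i.1 < k ↔ ∃ j, σ j = i) ∧ ∀ v j, e v (σ j) = u j v := by
  classical
  have := Fintype.ofFinite ι
  -- The differentials are completed to a basis of the dual space; the added linear forms,
  -- normalized to vanish at `a`, supply the missing coordinates.
  let B := Module.Basis.sumExtend hli
  have hB : ∀ j, B (Sum.inl j) = ((fderiv ℝ (u j) a : 𝔼 →L[ℝ] ℝ) : 𝔼 →ₗ[ℝ] ℝ) := fun j => by
    simp only [B, Module.Basis.sumExtend, Module.Basis.reindex_apply, Module.Basis.extend_apply_self]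
    exact congrArg Subtype.val (@Equiv.Set.sumDiffSubset_apply_inl _ _ _
      (hli.linearIndepOn_id.subset_extend (subset_univ _)) (Classical.decPred _) (Equiv.ofInjective _ hli.injective j))
  have hfin : Finite (ι ⊕ Module.Basis.sumExtendIndex hli) := Module.Finite.finite_basis B
  have : Finite (Module.Basis.sumExtendIndex hli) := Finite.sum_right ι
  have := Fintype.ofFinite (Module.Basis.sumExtendIndex hli)
  have hcard : Fintype.card ι + Fintype.card (Module.Basis.sumExtendIndex hli) = n := by
    have h1 := Module.finrank_eq_card_basis B
    rw [Subspace.dual_finrank_eq, finrank_euclideanSpace, Fintype.card_fin, Fintype.card_sum] at h1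
    exact h1.symm
  -- The given functions are numbered first, so that they become the coordinates with index below `k
  -- = card ι`.
  let τ : ι ⊕ Module.Basis.sumExtendIndex hli ≃ Fin n :=
    ((Fintype.equivFin ι).sumCongr (Fintype.equivFin _)).trans
      (finSumFinEquiv.trans (finCongr hcard))
  have hτl : ∀ j, (τ (Sum.inl j)).1 < Fintype.card ι := fun j => by
    simp [τ]
  have hτr : ∀ j, Fintype.card ι ≤ (τ (Sum.inr j)).1 := fun j => by
    simp [τ]
  let w : ι ⊕ Module.Basis.sumExtendIndex hli → 𝔼 → ℝ :=
    Sum.elim u fun m v => B (Sum.inr m) v - B (Sum.inr m) a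
  have hlin : ∀ m, ContDiff ℝ ∞ fun v => B m v := fun m =>
    (LinearMap.toContinuousLinearMap (B m)).contDiff
  have hw : ∀ m, ∀ᶠ v in 𝓝 a, ContDiffAt ℝ ∞ (w m) v := by
    rintro (j | m)
    · exact hu j
    · exact Eventually.of_forall fun v => ((hlin (Sum.inr m)).sub contDiff_const).contDiffAt
  have hw' : ∀ m, HasFDerivAt (w m) (LinearMap.toContinuousLinearMap (B m)) a := by
    rintro (j | m)
    · have h1 : LinearMap.toContinuousLinearMap (B (Sum.inl j)) = fderiv ℝ (u j) a := by
        rw [hB]; rfl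
      rw [h1]
      exact ((hu j).self_of_nhds.differentiableAt (by simp)).hasFDerivAt
    · exact (LinearMap.toContinuousLinearMap (B (Sum.inr m))).hasFDerivAt.sub_const _
  let F : 𝔼 → 𝔼 := fun v => WithLp.toLp 2 fun i => w (τ.symm i) v
  have hF : ∀ᶠ v in 𝓝 a, ContDiffAt ℝ ∞ F v := by
    filter_upwards [eventually_all.2 hw] with v hv
    exact contDiffAt_euclidean.2 fun i => hv (τ.symm i)
  let L : 𝔼 →ₗ[ℝ] 𝔼 :=
    (WithLp.linearEquiv 2 ℝ (Fin n → ℝ)).symm.toLinearMap ∘ₗ LinearMap.pi fun i => B (τ.symm i)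
  have hLi : ∀ v i, L v i = B (τ.symm i) v := fun v i => rfl
  -- A basis of the dual space separates vectors.
  have hinj : Function.Injective L := by
    rw [← LinearMap.ker_eq_bot, LinearMap.ker_eq_bot']
    intro v hv
    have h1 : ∀ m, B m v = 0 := fun m => by
      have := hLi v (τ m)
      rw [hv, τ.symm_apply_apply] at this
      simpa using this.symm
    refine (Module.forall_dual_apply_eq_zero_iff ℝ v).1 fun φ => ?_
    rw [← B.sum_repr φ, LinearMap.sum_apply]
    exact Finset.sum_eq_zero fun m _ => by rw [LinearMap.smul_apply, h1 m, smul_zero]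
  let L' : 𝔼 ≃L[ℝ] 𝔼 := (LinearEquiv.ofInjectiveEndo L hinj).toContinuousLinearEquiv
  have hF' : HasFDerivAt F (L' : 𝔼 →L[ℝ] 𝔼) a := by
    refine hasFDerivWithinAt_univ.1 (hasFDerivWithinAt_euclidean.2 fun i => ?_)
    exact (hw' (τ.symm i)).hasFDerivWithinAt
  obtain ⟨e, hae, heF, he, he'⟩ := exists_openPartialHomeomorph hF L' hF'
  refine ⟨e, Fintype.card ι, fun j => τ (Sum.inl j), hae, ?_, he, he', fun i => ⟨fun hi => ?_, ?_⟩,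
    fun v j => ?_⟩
  · rw [heF]
    ext i
    change w (τ.symm i) a = 0
    rcases τ.symm i with j | m
    · exact hu0 j
    · exact sub_self _
  · rcases h : τ.symm i with j | m
    · exact ⟨j, by dsimp only; rw [← h, τ.apply_symm_apply]⟩
    · have h1 := hτr m
      rw [← h, τ.apply_symm_apply] at h1
      omega
  · rintro ⟨j, rfl⟩
    exact hτl j
  · rw [heF]
    change w (τ.symm (τ (Sum.inl j))) v = u j v
    rw [τ.symm_apply_apply]
    rfl

lemma exists_cube_subset {N : Set 𝔼} (hN : N ∈ 𝓝 0) : ∃ ε > 0, {v : 𝔼 | ∀ i, |v i| < ε} ⊆ N := by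
  have h1 : Tendsto (fun w : Fin n → ℝ => (WithLp.toLp 2 w : 𝔼)) (𝓝 0) (𝓝 0) := by
    have : Continuous fun w : Fin n → ℝ => (WithLp.toLp 2 w : 𝔼) := by fun_prop
    exact this.tendsto' 0 0 (by rfl)
  obtain ⟨ε, hε, hb⟩ := Metric.mem_nhds_iff.1 (h1 hN)
  refine ⟨ε, hε, fun v hv => ?_⟩
  have h2 : (fun i => v i) ∈ Metric.ball (0 : Fin n → ℝ) ε := by
    rw [mem_ball_zero_iff, pi_norm_lt_iff hε]
    exact hv
  exact hb h2

end Coordinates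

namespace ManC

/-- The differential at a point of a map to a vector space. -/
def tmapTo {X : ManC} {V : Type*} [NormedAddCommGroup V] [NormedSpace ℝ V] (φ : X → V) (x : X) :
    X.Vec →L[ℝ] V := mfderiv X.model 𝓘(ℝ, V) φ x

/-- The differential at a point of a map from a vector space. -/
def tmapFrom {X : ManC} {V : Type*} [NormedAddCommGroup V] [NormedSpace ℝ V] (ψ : V → X) (v : V) :
    V →L[ℝ] X.Vec := mfderiv 𝓘(ℝ, V) X.model ψ v

/-- The differential of a function at a point. -/
def dfun {X : ManC} (u : X → ℝ) (x : X) : Module.Dual ℝ X.Vec := (tmapTo u x : X.Vec →L[ℝ] ℝ)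

/-- A function which is smooth in a neighbourhood of a point. -/
def SmoothNear {X : ManC} (u : X → ℝ) (x : X) : Prop :=
  ∀ᶠ y in 𝓝 x, ContMDiffAt X.model 𝓘(ℝ, ℝ) ∞ u y

variable {X Y : ManC}

lemma SmoothNear.mdifferentiableAt {u : X → ℝ} {x : X} (h : SmoothNear u x) :
    MDifferentiableAt X.model 𝓘(ℝ, ℝ) u x := h.self_of_nhds.mdifferentiableAt (by simp)

lemma SmoothNear.comp {u : X → ℝ} (f : Y ⟶ X) {y : Y} (h : SmoothNear u (f y)) :
    SmoothNear (fun z => u (f z)) y := by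
  filter_upwards [(continuous f).continuousAt.eventually h] with z hz
  exact ContMDiffAt.comp (g := u) (f := f) z hz (contMDiff f z)

lemma dfun_congr {u u' : X → ℝ} {x : X} (h : ∀ᶠ y in 𝓝 x, u y = u' y) : dfun u x = dfun u' x :=
  congrArg (fun A : X.Vec →L[ℝ] ℝ => (A : X.Vec →ₗ[ℝ] ℝ)) (EventuallyEq.mfderiv_eq h)

lemma dfun_comp {u : X → ℝ} (f : Y ⟶ X) {y : Y}
    (hu : MDifferentiableAt X.model 𝓘(ℝ, ℝ) u (f y)) :
    dfun (fun z => u (f z)) y = dfun u (f y) ∘ₗ (tmap f y : Y.Vec →ₗ[ℝ] X.Vec) :=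
  congrArg (fun A : Y.Vec →L[ℝ] ℝ => (A : Y.Vec →ₗ[ℝ] ℝ))
    (mfderiv_comp y hu ((contMDiff f).mdifferentiable (by simp) y))

lemma dfun_eq_fderiv_comp {V : Type*} [NormedAddCommGroup V] [NormedSpace ℝ V] {φ : X → V}
    {U : V → ℝ} {u : X → ℝ} {x : X} (hφ : MDifferentiableAt X.model 𝓘(ℝ, V) φ x)
    (hU : DifferentiableAt ℝ U (φ x)) (h : ∀ᶠ y in 𝓝 x, u y = U (φ y)) :
    dfun u x = ((fderiv ℝ U (φ x) : V →L[ℝ] ℝ) : V →ₗ[ℝ] ℝ) ∘ₗ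
      (tmapTo φ x : X.Vec →ₗ[ℝ] V) := by
  rw [dfun_congr h]
  have h1 := mfderiv_comp x hU.mdifferentiableAt hφ
  rw [mfderiv_eq_fderiv] at h1
  exact congrArg (fun A : X.Vec →L[ℝ] ℝ => (A : X.Vec →ₗ[ℝ] ℝ)) h1

lemma fderiv_eq_dfun_comp {V : Type*} [NormedAddCommGroup V] [NormedSpace ℝ V] {ψ : V → X}
    {U : V → ℝ} {u : X → ℝ} {v : V} (hψ : MDifferentiableAt 𝓘(ℝ, V) X.model ψ v)
    (hu : MDifferentiableAt X.model 𝓘(ℝ, ℝ) u (ψ v)) (h : ∀ᶠ w in 𝓝 v, U w = u (ψ w)) :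
    ((fderiv ℝ U v : V →L[ℝ] ℝ) : V →ₗ[ℝ] ℝ) = dfun u (ψ v) ∘ₗ
      (tmapFrom ψ v : V →ₗ[ℝ] X.Vec) := by
  rw [EventuallyEq.fderiv_eq h]
  have h1 := mfderiv_comp v hu hψ
  rw [mfderiv_eq_fderiv] at h1
  exact congrArg (fun A : V →L[ℝ] ℝ => (A : V →ₗ[ℝ] ℝ)) h1

/-- In the product rule the term with the differential of `G` drops out at a zero of `v`. Equations
that differ by an invertible factor thus have proportional differentials. -/
lemma dfun_mul_of_eq_zero {u G v : X → ℝ} {x : X} (hG : MDifferentiableAt X.model 𝓘(ℝ, ℝ) G x)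
    (hv : MDifferentiableAt X.model 𝓘(ℝ, ℝ) v x) (hv0 : v x = 0)
    (h : ∀ᶠ y in 𝓝 x, u y = G y * v y) : dfun u x = G x • dfun v x := by
  rw [dfun_congr h]
  have h1 := (hG.hasMFDerivAt.mul hv.hasMFDerivAt).mfderiv
  ext w
  have h2 := congrArg (fun A : X.Vec →L[ℝ] ℝ => A w) h1
  refine h2.trans ?_
  change G x * dfun v x w + v x * dfun G x w = _
  rw [hv0, zero_mul, add_zero]
  rfl

/-- The preferred chart at `x`, restricted to the interior. -/
def interiorChart (X : ManC) (x : X) : OpenPartialHomeomorph X X.Vec where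
  toFun y := (chartAt (EuclideanQuadrant X.dim) x y).1
  invFun v := (chartAt (EuclideanQuadrant X.dim) x).symm (X.model.symm v)
  source := {y | y ∈ (chartAt (EuclideanQuadrant X.dim) x).source ∧ ∀ i, 0 < X.coord x y i}
  target := {v | (∀ i, 0 < v i) ∧ X.model.symm v ∈ (chartAt (EuclideanQuadrant X.dim) x).target}
  map_source' y hy := ⟨hy.2, by
    have h1 : X.model.symm (chartAt (EuclideanQuadrant X.dim) x y).1 =
      chartAt (EuclideanQuadrant X.dim) x y := X.model.left_inv _
    rw [h1]
    exact (chartAt (EuclideanQuadrant X.dim) x).map_source hy.1⟩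
  map_target' v hv := ⟨(chartAt (EuclideanQuadrant X.dim) x).map_target hv.2, fun i => by
    unfold ManC.coord
    rw [(chartAt (EuclideanQuadrant X.dim) x).right_inv hv.2, Box.model_symm_coe fun i => (hv.1 i).le]
    exact hv.1 i⟩
  left_inv' y hy := by
    have h1 : X.model.symm (chartAt (EuclideanQuadrant X.dim) x y).1 =
      chartAt (EuclideanQuadrant X.dim) x y := X.model.left_inv _
    rw [h1]
    exact (chartAt (EuclideanQuadrant X.dim) x).left_inv hy.1
  right_inv' v hv := by
    rw [(chartAt (EuclideanQuadrant X.dim) x).right_inv hv.2, Box.model_symm_coe fun i => (hv.1 i).le]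
  open_source := by
    have h1 : ∀ i, ContinuousOn (fun y => X.coord x y i)
      (chartAt (EuclideanQuadrant X.dim) x).source := fun i =>
        (X.contMDiffOn_coord x i).continuousOn
    have h2 : ContinuousOn (fun y i => X.coord x y i)
      (chartAt (EuclideanQuadrant X.dim) x).source := continuousOn_pi.2 h1
    have h3 : IsOpen {f : Fin X.dim → ℝ | ∀ i, 0 < f i} := by
      simp only [ofPred_forall]
      exact isOpen_iInter_of_finite fun i => isOpen_lt continuous_const (continuous_apply i)
    exact h2.isOpen_inter_preimage (chartAt (EuclideanQuadrant X.dim) x).open_source h3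
  open_target := by
    have h3 : IsOpen {f : X.Vec | ∀ i, 0 < f i} := by
      simp only [ofPred_forall]
      exact isOpen_iInter_of_finite fun i => isOpen_lt continuous_const (by fun_prop)
    exact h3.inter ((chartAt (EuclideanQuadrant X.dim) x).open_target.preimage X.model.continuous_symm)
  continuousOn_toFun := continuous_subtype_val.comp_continuousOn
    ((chartAt (EuclideanQuadrant X.dim) x).continuousOn.mono fun y hy => hy.1)
  continuousOn_invFun := (chartAt (EuclideanQuadrant X.dim) x).continuousOn_symm.comp
    X.model.continuous_symm.continuousOn fun v hv => hv.2

lemma IsBoundaryless.mem_interiorChart (hX : X.IsBoundaryless) (x : X) :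
    x ∈ (X.interiorChart x).source := ⟨mem_chart_source _ x, hX.coord_pos x⟩

lemma contMDiffOn_interiorChart (x : X) :
    ContMDiffOn X.model 𝓘(ℝ, X.Vec) ∞ (X.interiorChart x) (X.interiorChart x).source :=
  (contMDiffOn_extChartAt (I := X.model) (x := x)).mono fun _ hy => hy.1

lemma contMDiffOn_interiorChart_symm (x : X) :
    ContMDiffOn 𝓘(ℝ, X.Vec) X.model ∞ (X.interiorChart x).symm (X.interiorChart x).target := by
  refine (contMDiffOn_extChartAt_symm (I := X.model) x).mono fun v hv => ?_
  rw [extChartAt_target]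
  exact ⟨hv.2, ⟨⟨v, fun i => (hv.1 i).le⟩, rfl⟩⟩

end ManC

end HyperBlowup

namespace HyperBlowup

open Filter ManC

/-! ### Systems of equations of unions of hyperplanes -/

/-- Near `x`, the set `E` is the union of the zero sets of the functions `u`, which vanish at `x` and
have linearly independent differentials there. -/
structure IsSystem {X : ManC} (E : Set X) (x : X) {ι : Type} (u : ι → X → ℝ) : Prop where
  smooth : ∀ j, SmoothNear (u j) x
  zero : ∀ j, u j x = 0
  indep : LinearIndependent ℝ fun j => dfun (u j) x
  mem_iff : ∀ᶠ y in 𝓝 x, y ∈ E ↔ ∃ j, u j y = 0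

variable {X Y Z : ManC} {E : Set X} {x : X} {ι : Type} {u : ι → X → ℝ}

lemma Box.smoothNear (b : Box X E) (hx : x ∈ b.e.source) (i : Fin X.dim) :
    SmoothNear (fun y => b.e y i) x := by
  filter_upwards [b.e.open_source.mem_nhds hx] with y hy
  exact (EuclideanSpace.proj (𝕜 := ℝ) i : X.Vec →L[ℝ] ℝ).contMDiff.contMDiffAt.comp y
    (b.contMDiffOn.contMDiffAt (b.e.open_source.mem_nhds hy))

lemma Box.mdifferentiableAt_symm (b : Box X E) (hx : x ∈ b.e.source) :
    MDifferentiableAt 𝓘(ℝ, X.Vec) X.model b.e.symm (b.e x) :=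
  (b.contMDiffOn_symm.contMDiffAt
    (b.e.open_target.mem_nhds (b.e.map_source hx))).mdifferentiableAt (by simp)

lemma linearIndependent_proj (n : ℕ) : LinearIndependent ℝ fun i : Fin n =>
    ((EuclideanSpace.proj (𝕜 := ℝ) i : EuclideanSpace ℝ (Fin n) →L[ℝ] ℝ) :
      EuclideanSpace ℝ (Fin n) →ₗ[ℝ] ℝ) := by
  refine Fintype.linearIndependent_iff.2 fun c hc i => ?_
  have h1 := congrArg (fun φ => φ (EuclideanSpace.single i (1 : ℝ))) hc
  simpa [LinearMap.sum_apply] using h1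

/-- Composition with the differential of the inverse chart turns these differentials into the
coordinate projections. -/
lemma Box.linearIndependent (b : Box X E) (hx : x ∈ b.e.source) :
    LinearIndependent ℝ fun i => dfun (fun y => b.e y i) x := by
  let D : X.Vec →ₗ[ℝ] X.Vec := (tmapFrom b.e.symm (b.e x) : X.Vec →L[ℝ] X.Vec)
  refine LinearIndependent.of_comp D.dualMap ?_
  convert linearIndependent_proj X.dim using 2 with i
  have h1 : b.e.symm (b.e x) = x := b.e.left_inv hx
  have h2 := fderiv_eq_dfun_comp (U := (EuclideanSpace.proj (𝕜 := ℝ) i : X.Vec →L[ℝ] ℝ))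
    (u := fun y => b.e y i) (b.mdifferentiableAt_symm hx)
    (by rw [h1]; exact (b.smoothNear hx i).mdifferentiableAt) (by
      filter_upwards [b.e.open_target.mem_nhds (b.e.map_source hx)] with v hv
      rw [b.e.right_inv hv]
      rfl)
  rw [ContinuousLinearMap.fderiv, h1] at h2
  exact h2.symm

/-- The coordinates of a box form a system. -/
lemma Box.isSystem (b : Box X E) (hx : x ∈ b.e.source) (hx0 : b.e x = 0) :
    IsSystem E x fun (i : {i : Fin X.dim // i.1 < b.k}) y => b.e y i.1 where
  smooth i := b.smoothNear hx i.1
  zero i := by rw [hx0]; rfl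
  indep := (b.linearIndependent hx).comp _ Subtype.val_injective
  mem_iff := by
    filter_upwards [b.e.open_source.mem_nhds hx] with y hy
    rw [b.mem_iff y hy]
    simp

namespace IsSystem

lemma eventually_contDiffAt (hu : IsSystem E x u) {V : Type*} [NormedAddCommGroup V]
    [NormedSpace ℝ V] {e : OpenPartialHomeomorph X V}
    (he' : ContMDiffOn 𝓘(ℝ, V) X.model ∞ e.symm e.target) (hx : x ∈ e.source) (j : ι) :
    ∀ᶠ v in 𝓝 (e x), ContDiffAt ℝ ∞ (fun v => u j (e.symm v)) v := by
  have h1 := e.continuousAt_symm (e.map_source hx)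
  rw [ContinuousAt, e.left_inv hx] at h1
  filter_upwards [h1.eventually (hu.smooth j), e.open_target.mem_nhds (e.map_source hx)] with v hv hvt
  exact contMDiffAt_iff_contDiffAt.1 (ContMDiffAt.comp (g := u j) v hv
    (he'.contMDiffAt (e.open_target.mem_nhds hvt)))

lemma dfun_eq (hu : IsSystem E x u) {V : Type*} [NormedAddCommGroup V]
    [NormedSpace ℝ V] {e : OpenPartialHomeomorph X V}
    (he : ContMDiffOn X.model 𝓘(ℝ, V) ∞ e e.source)
    (he' : ContMDiffOn 𝓘(ℝ, V) X.model ∞ e.symm e.target) (hx : x ∈ e.source) (j : ι) :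
    dfun (u j) x = ((fderiv ℝ (fun v => u j (e.symm v)) (e x) : V →L[ℝ] ℝ) : V →ₗ[ℝ] ℝ) ∘ₗ
      (tmapTo e x : X.Vec →ₗ[ℝ] V) := by
  refine dfun_eq_fderiv_comp
    ((he.contMDiffAt (e.open_source.mem_nhds hx)).mdifferentiableAt (by simp))
    ((hu.eventually_contDiffAt he' hx j).self_of_nhds.differentiableAt (by simp)) ?_
  filter_upwards [e.open_source.mem_nhds hx] with y hy
  rw [e.left_inv hy]

/-- The zeros of one equation lie in `E`, which in the box is a union of coordinate hyperplanes;
`exists_eq_unit_mul_coord` then applies in the chart. -/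
lemma compare_one (hu : IsSystem E x u) (b : Box X E) (hx : x ∈ b.e.source) (hx0 : b.e x = 0) (j : ι) :
    ∃ (i : Fin X.dim) (G : X → ℝ), i.1 < b.k ∧ SmoothNear G x ∧ G x ≠ 0 ∧
      ∀ᶠ y in 𝓝 x, u j y = G y * b.e y i := by
  have h1 := hu.eventually_contDiffAt b.contMDiffOn_symm hx j
  have h2 := hu.dfun_eq b.contMDiffOn b.contMDiffOn_symm hx j
  have hs : Tendsto b.e.symm (𝓝 0) (𝓝 x) := by
    have := b.e.continuousAt_symm (b.e.map_source hx)
    rwa [ContinuousAt, b.e.left_inv hx, hx0] at this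
  rw [hx0] at h1 h2
  have hx1 : b.e.symm 0 = x := by rw [← hx0, b.e.left_inv hx]
  have ht : b.e.target ∈ 𝓝 (0 : X.Vec) := by
    rw [← hx0]; exact b.e.open_target.mem_nhds (b.e.map_source hx)
  obtain ⟨i, hi, G, hG, hG0, hGu⟩ := exists_eq_unit_mul_coord h1 (by rw [hx1, hu.zero j])
    (by
      intro h3
      rw [h3] at h2
      exact hu.indep.ne_zero j h2)
    {i | i.1 < b.k} (by
      filter_upwards [hs.eventually hu.mem_iff, ht] with v hv hvt hv0
      obtain ⟨i, hi, hi0⟩ := (b.mem_iff _ (b.e.map_target hvt)).1 (hv.2 ⟨j, hv0⟩)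
      rw [b.e.right_inv hvt] at hi0
      exact ⟨i, hi, hi0⟩)
  have hb : Tendsto b.e (𝓝 x) (𝓝 0) := by
    have := b.e.continuousAt hx
    rwa [ContinuousAt, hx0] at this
  refine ⟨i, fun y => G (b.e y), hi, ?_, by dsimp only; rw [hx0]; exact hG0, ?_⟩
  · filter_upwards [b.e.open_source.mem_nhds hx] with y hy
    exact hG.contMDiff.contMDiffAt.comp y (b.contMDiffOn.contMDiffAt (b.e.open_source.mem_nhds hy))
  · filter_upwards [hb.eventually hGu, b.e.open_source.mem_nhds hx] with y hy hys
    rwa [b.e.left_inv hys] at hy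

/-- The functions of a system agree, up to invertible functions and a bijection of the indices,
with the coordinates of a box. -/
lemma compare (hu : IsSystem E x u) (b : Box X E) (hx : x ∈ b.e.source) (hx0 : b.e x = 0) :
    ∃ (π : ι ≃ {i : Fin X.dim // i.1 < b.k}) (G : ι → X → ℝ), ∀ j, SmoothNear (G j) x ∧ G j x ≠ 0 ∧
      ∀ᶠ y in 𝓝 x, u j y = G j y * b.e y (π j).1 := by
  choose π G hπ hG hG0 hGu using hu.compare_one b hx hx0
  have hd : ∀ j, dfun (u j) x = G j x • dfun (fun y => b.e y (π j)) x := fun j =>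
    dfun_mul_of_eq_zero (hG j).mdifferentiableAt (b.smoothNear hx _).mdifferentiableAt
      (by rw [hx0]; rfl) (hGu j)
  -- Two equations assigned to the same coordinate would have proportional differentials.
  have hinj : Function.Injective π := by
    have h1 : LinearIndependent ℝ fun j => dfun (fun y => b.e y (π j)) x := by
      have h2 := hu.indep.units_smul fun j => (Units.mk0 (G j x) (hG0 j))⁻¹
      convert h2 using 2 with j
      rw [Pi.smul_apply', hd, Units.smul_def, smul_smul]
      simp [hG0 j]
    exact fun j j' hjj => h1.injective (by simp only [hjj])
  have : Finite ι := Finite.of_injective π hinj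
  let π' : ι → {i : Fin X.dim // i.1 < b.k} := fun j => ⟨π j, hπ j⟩
  have hbij : Function.Bijective π' := by
    refine ⟨fun j j' h => hinj (congrArg Subtype.val h), fun i => ?_⟩
    -- For small `t ≠ 0` the point with coordinates `t • d` lies on the `i`-th hyperplane and on no
    -- other. It belongs to `E`, so some equation vanishes there, and the coordinate assigned to
    -- that equation can only be the `i`-th.
    let d : X.Vec := WithLp.toLp 2 fun i' => if i' = i.1 then 0 else 1
    have h1 : Tendsto (fun t : ℝ => t • d) (𝓝[≠] 0) (𝓝 0) := by
      have : Tendsto (fun t : ℝ => t • d) (𝓝 0) (𝓝 0) := by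
        simpa using (by fun_prop : Continuous fun t : ℝ => t • d).tendsto 0
      exact this.mono_left nhdsWithin_le_nhds
    have hs : Tendsto b.e.symm (𝓝 0) (𝓝 x) := by
      have := b.e.continuousAt_symm (b.e.map_source hx)
      rwa [ContinuousAt, b.e.left_inv hx, hx0] at this
    have ht : b.e.target ∈ 𝓝 (0 : X.Vec) := by
      rw [← hx0]; exact b.e.open_target.mem_nhds (b.e.map_source hx)
    have hGne : ∀ᶠ y in 𝓝 x, ∀ j, G j y ≠ 0 := eventually_all.2 fun j =>
      (hG j).self_of_nhds.continuousAt.eventually_ne (hG0 j)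
    obtain ⟨t, ⟨⟨⟨h2, h3⟩, h4⟩, h5⟩, h6⟩ := (((((hs.comp h1).eventually hu.mem_iff).and
      (h1.eventually ht)).and ((hs.comp h1).eventually hGne)).and
      ((hs.comp h1).eventually (eventually_all.2 hGu))).and self_mem_nhdsWithin |>.exists
    have h3' : t • d ∈ b.e.target := h3
    have h7 : b.e.symm (t • d) ∈ E := (b.mem_iff _ (b.e.map_target h3')).2
      ⟨i.1, i.2, by rw [b.e.right_inv h3']; simp [d]⟩
    obtain ⟨j, hj⟩ := h2.1 h7
    have h8 := h5 j
    simp only [Function.comp_apply] at h8 hj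
    rw [hj, b.e.right_inv h3'] at h8
    have h9 := (mul_eq_zero.1 h8.symm).resolve_left (h4 j)
    refine ⟨j, Subtype.ext ?_⟩
    by_contra hne
    have h10 : π j ≠ i.1 := hne
    simp only [PiLp.smul_apply, smul_eq_mul, d, if_neg h10, mul_one] at h9
    exact h6 h9
  exact ⟨Equiv.ofBijective π' hbij, G, fun j => ⟨hG j, hG0 j, hGu j⟩⟩

/-- Independence of the pullback of a system along a map implies the same for the coordinates of
a box. -/
lemma linearIndependent_box {f : Y ⟶ X} {y : Y} (hu : IsSystem E (f y) u)
    (hf : LinearIndependent ℝ fun j => dfun (fun z => u j (f z)) y) (b : Box X E)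
    (hx : f y ∈ b.e.source) (hx0 : b.e (f y) = 0) :
    LinearIndependent ℝ fun i : {i : Fin X.dim // i.1 < b.k} => dfun (fun z => b.e (f z) i.1) y := by
  obtain ⟨π, G, h⟩ := hu.compare b hx hx0
  have hd : ∀ j, dfun (fun z => u j (f z)) y =
      G j (f y) • dfun (fun z => b.e (f z) (π j).1) y := fun j =>
    dfun_mul_of_eq_zero ((h j).1.comp f).mdifferentiableAt
      ((b.smoothNear hx _).comp f).mdifferentiableAt (by rw [hx0]; rfl)
      ((continuous f).continuousAt.eventually (h j).2.2)
  have h1 : LinearIndependent ℝ fun j => dfun (fun z => b.e (f z) (π j).1) y := by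
    have h2 := hf.units_smul fun j => (Units.mk0 (G j (f y)) (h j).2.1)⁻¹
    convert h2 using 2 with j
    rw [Pi.smul_apply', hd, Units.smul_def, smul_smul]
    simp [(h j).2.1]
  exact (linearIndependent_equiv π).1 h1

end IsSystem

/-- A chart in which `E` is a union of coordinate hyperplanes can be restricted to a box. -/
lemma exists_box_of_chart (e : OpenPartialHomeomorph X X.Vec) (hx : x ∈ e.source) (hx0 : e x = 0)
    (he : ContMDiffOn X.model 𝓘(ℝ, X.Vec) ∞ e e.source)
    (he' : ContMDiffOn 𝓘(ℝ, X.Vec) X.model ∞ e.symm e.target) (k : ℕ)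
    (hE : ∀ᶠ y in 𝓝 x, y ∈ E ↔ ∃ i : Fin X.dim, i.1 < k ∧ e y i = 0) :
    ∃ b : Box X E, x ∈ b.e.source ∧ b.e x = 0 := by
  have hs := e.continuousAt_symm (e.map_source hx)
  rw [ContinuousAt, e.left_inv hx] at hs
  -- The cube is small enough to lie in the target of the chart and in the region where the
  -- description of `E` is valid. It is afterwards rescaled by `ε⁻¹` to the unit cube.
  obtain ⟨ε, hε, hsub⟩ := exists_cube_subset (N := e.target ∩ e.symm ⁻¹'
    {y | y ∈ E ↔ ∃ i : Fin X.dim, i.1 < k ∧ e y i = 0}) (by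
      rw [← hx0]
      exact inter_mem (e.open_target.mem_nhds (e.map_source hx)) (hs hE))
  let C : Set X.Vec := {v | ∀ i, |v i| < ε}
  have hC : IsOpen C := by
    simp only [C, ofPred_forall]
    exact isOpen_iInter_of_finite fun i => isOpen_lt (by fun_prop) continuous_const
  let e₁ := (e.symm.restrOpen C hC).symm
  have he₁s : e₁.source ⊆ e.source := fun y hy => hy.1
  have he₁C : ∀ y ∈ e₁.source, e y ∈ C := fun y hy => hy.2
  let S : X.Vec ≃ₜ X.Vec := Homeomorph.smulOfNeZero ε⁻¹ (inv_ne_zero hε.ne')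
  have hS : ∀ v, S v = ε⁻¹ • v := fun v => rfl
  have hS' : ∀ v, S.symm v = ε • v := fun v => by
    rw [Homeomorph.symm_apply_eq, hS, smul_smul, inv_mul_cancel₀ hε.ne', one_smul]
  refine ⟨{ e := e₁.transHomeomorph S
            target_eq := ?_
            contMDiffOn := ?_
            contMDiffOn_symm := ?_
            k := k
            mem_iff := fun y hy => ?_ }, ⟨hx, ?_⟩, ?_⟩
  · ext v
    change S.symm v ∈ e.target ∩ C ↔ _
    rw [inter_eq_right.2 fun v hv => (hsub hv).1, hS']
    refine forall_congr' fun i => ?_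
    rw [PiLp.smul_apply, smul_eq_mul, abs_mul, abs_of_pos hε]
    constructor
    · intro h; by_contra! h'; nlinarith
    · intro h; nlinarith
  · have h1 : ContDiff ℝ ∞ S := contDiff_const_smul ε⁻¹
    exact h1.contMDiff.comp_contMDiffOn (he.mono he₁s)
  · have h1 : ContDiff ℝ ∞ S.symm := by
      rw [funext hS']
      exact contDiff_const_smul ε
    exact he'.comp h1.contMDiff.contMDiffOn fun v hv => hv.1
  · have h1 : y ∈ e.source := he₁s hy
    have h2 := (hsub (he₁C y hy)).2
    rw [mem_preimage, e.left_inv h1] at h2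
    refine h2.trans (exists_congr fun i => and_congr_right fun _ => ?_)
    change _ ↔ ε⁻¹ * e y i = 0
    simp [hε.ne']
  · change e x ∈ C
    rw [hx0]
    intro i
    simpa using hε
  · change ε⁻¹ • e x = 0
    rw [hx0, smul_zero]

/-- A system determines a box. -/
lemma IsSystem.exists_box (hX : X.IsBoundaryless) (hu : IsSystem E x u) :
    ∃ b : Box X E, x ∈ b.e.source ∧ b.e x = 0 := by
  let c := X.interiorChart x
  have hx : x ∈ c.source := hX.mem_interiorChart x
  have hc := contMDiffOn_interiorChart x
  have hc' := contMDiffOn_interiorChart_symm x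
  have : Finite ι := hu.indep.finite
  -- The differentials on `X` are images of the differentials in the chart under a linear map, so
  -- independence descends to the latter.
  have hli : LinearIndependent ℝ fun j =>
      ((fderiv ℝ (fun v => u j (c.symm v)) (c x) : X.Vec →L[ℝ] ℝ) : X.Vec →ₗ[ℝ] ℝ) := by
    refine LinearIndependent.of_comp (tmapTo c x : X.Vec →ₗ[ℝ] X.Vec).dualMap ?_
    convert hu.indep using 2 with j
    exact (hu.dfun_eq hc hc' hx j).symm
  obtain ⟨e, k, σ, ha, ha0, he, he', hσ, hσu⟩ := exists_coordinates
    (fun j => hu.eventually_contDiffAt hc' hx j) (fun j => by rw [c.left_inv hx, hu.zero j]) hli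
  refine exists_box_of_chart (c.trans e) (x := x) ⟨hx, ha⟩ ha0 ?_ ?_ k ?_
  · exact he.contMDiffOn.comp (hc.mono fun y hy => hy.1) fun y hy => hy.2
  · exact hc'.comp (he'.contMDiffOn.mono fun y hy => hy.1) fun y hy => hy.2
  · filter_upwards [hu.mem_iff, c.open_source.mem_nhds hx] with y hy hyc
    rw [hy]
    constructor
    · rintro ⟨j, hj⟩
      refine ⟨σ j, (hσ _).2 ⟨j, rfl⟩, ?_⟩
      change e (c y) (σ j) = 0
      rw [hσu, c.left_inv hyc, hj]
    · rintro ⟨i, hi, hi0⟩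
      obtain ⟨j, rfl⟩ := (hσ i).1 hi
      change e (c y) (σ j) = 0 at hi0
      rw [hσu, c.left_inv hyc] at hi0
      exact ⟨j, hi0⟩

end HyperBlowup

namespace HyperBlowup

open Filter ManC

/-! ### Systems of equations of hyper subsets -/

section Hyper

variable {W X : ManC} {h : W ⟶ X}

/-- Smoothness at all nearby points, and not only at the centre, is what the inverse function
theorem needs in order to produce a smooth inverse. -/
lemma eventually_contDiffAt_written (hW : W.IsBoundaryless) (w : W) {x : X} (hx : h w = x) :
    ∀ᶠ a in 𝓝 (extChartAt W.model w w), ContDiffAt ℝ ∞ (written h w x) a := by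
  have h1 : Tendsto (extChartAt W.model w).symm (𝓝 (extChartAt W.model w w)) (𝓝 w) := by
    have := (continuousAt_extChartAt_symm (I := W.model) w).tendsto
    rwa [extChartAt_to_inv] at this
  have h2 : ∀ᶠ a in 𝓝 (extChartAt W.model w w),
      h ((extChartAt W.model w).symm a) ∈ (chartAt (EuclideanQuadrant X.dim) x).source := by
    refine ((continuous h).continuousAt.tendsto.comp h1).eventually ?_
    rw [hx]
    exact (chartAt (EuclideanQuadrant X.dim) x).open_source.mem_nhds (mem_chart_source _ x)
  filter_upwards [(hW.target_mem_nhds w), h2, eventually_mem_nhds_iff.2 (hW.target_mem_nhds w)]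
    with a ha ha2 ha3
  have h3 : ContMDiffAt 𝓘(ℝ, W.Vec) W.model ∞ (extChartAt W.model w).symm a :=
    (contMDiffOn_extChartAt_symm w).contMDiffAt ha3
  have h4 : ContMDiffAt X.model 𝓘(ℝ, X.Vec) ∞ (extChartAt X.model x)
      (h ((extChartAt W.model w).symm a)) := contMDiffAt_extChartAt' ha2
  exact contMDiffAt_iff_contDiffAt.1 (h4.comp a ((contMDiff h _).comp a h3))

/-- The image of a branch of a hyper map is the zero set of a function with nonzero differential. -/
lemma ManC.IsHyperMap.exists_equation (H : IsHyperMap h) (w : W) :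
    ∃ u : X → ℝ, SmoothNear u (h w) ∧ u (h w) = 0 ∧ dfun u (h w) ≠ 0 ∧
      (∀ v ∈ tangentImage h w, dfun u (h w) v = 0) ∧ (∀ᶠ w' in 𝓝 w, u (h w') = 0) ∧
      ∀ᶠ y in 𝓝 (h w), u y = 0 → y ∈ range h := by
  set x := h w with hx
  have hX := H.boundaryless_target
  have hW := H.boundaryless_source
  set K := written h w x with hK
  set a := extChartAt W.model w w with ha
  let c := X.interiorChart x
  have hxc : x ∈ c.source := hX.mem_interiorChart x
  have hKa : K a = c x := by
    change extChartAt X.model x (h ((extChartAt W.model w).symm (extChartAt W.model w w))) = _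
    rw [extChartAt_to_inv]
    rfl
  have hK' : HasFDerivAt K (tmap h w) a := (hasStrictFDerivAt_written hW h w rfl).hasFDerivAt
  have hKs : ∀ᶠ v in 𝓝 a, ContDiffAt ℝ ∞ K v := eventually_contDiffAt_written hW w rfl
  obtain ⟨ν, hν⟩ : ∃ ν, ν ∉ tangentImage h w := by
    by_contra! hall
    exact H.tangentImage_ne_top w (eq_top_iff.2 fun v _ => hall v)
  -- The branch is thickened in a direction `ν` transverse to it. In codimension one this is a local
  -- diffeomorphism, and the `ℝ`-coordinate of its inverse is the required equation.
  let Φ : W.Vec × ℝ → X.Vec := fun r => K r.1 + r.2 • ν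
  let Φ' : W.Vec × ℝ →L[ℝ] X.Vec := (tmap h w).comp (ContinuousLinearMap.fst ℝ W.Vec ℝ) +
    (ContinuousLinearMap.snd ℝ W.Vec ℝ).smulRight ν
  have hΦ' : HasFDerivAt Φ Φ' (a, 0) := by
    refine HasFDerivAt.add ?_ ?_
    · exact HasFDerivAt.comp (a, (0 : ℝ)) (g := K) (f := Prod.fst) hK' hasFDerivAt_fst
    · exact ((ContinuousLinearMap.snd ℝ W.Vec ℝ).smulRight ν).hasFDerivAt
  have hinj : Function.Injective (Φ' : W.Vec × ℝ →ₗ[ℝ] X.Vec) := by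
    rw [← LinearMap.ker_eq_bot, LinearMap.ker_eq_bot']
    rintro ⟨v, t⟩ hvt
    have h1 : tmap h w v + t • ν = 0 := hvt
    by_cases ht : t = 0
    · rw [ht, zero_smul, add_zero] at h1
      have h2 := H.immersion w (h1.trans (map_zero _).symm)
      rw [h2, ht]; rfl
    · refine absurd ⟨-t⁻¹ • v, ?_⟩ hν
      change tmap h w (-t⁻¹ • v) = ν
      rw [map_smul, eq_neg_of_add_eq_zero_left h1, smul_neg, neg_smul, neg_neg, smul_smul,
        inv_mul_cancel₀ ht, one_smul]
  have hdim : Module.finrank ℝ (W.Vec × ℝ) = Module.finrank ℝ X.Vec := by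
    rcases H.codim_one with h1 | h1
    · rw [Module.finrank_prod, finrank_euclideanSpace, finrank_euclideanSpace, Fintype.card_fin,
        Fintype.card_fin, Module.finrank_self, h1]
    · exact (h1.false w).elim
  let L : (W.Vec × ℝ) ≃L[ℝ] X.Vec :=
    (LinearEquiv.ofInjectiveOfFinrankEq _ hinj hdim).toContinuousLinearEquiv
  have hΦs : ∀ᶠ r in 𝓝 (a, (0 : ℝ)), ContDiffAt ℝ ∞ Φ r := by
    have h1 : Tendsto Prod.fst (𝓝 (a, (0 : ℝ))) (𝓝 a) := continuous_fst.tendsto _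
    filter_upwards [h1.eventually hKs] with r hr
    exact (ContDiffAt.comp (g := K) r hr contDiffAt_fst).add (contDiffAt_snd.smul contDiffAt_const)
  obtain ⟨e, hae, heΦ, he, he'⟩ := exists_openPartialHomeomorph hΦs L hΦ'
  have heΦ' : ∀ r, e r = K r.1 + r.2 • ν := fun r => by rw [heΦ]
  have hea : e (a, 0) = c x := by rw [heΦ', zero_smul, add_zero, hKa]
  have hcx : c x ∈ e.target := hea ▸ e.map_source hae
  have hea' : e.symm (c x) = (a, 0) := by rw [← hea, e.left_inv hae]
  let u : X → ℝ := fun y => (e.symm (c y)).2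
  have hct : Tendsto c (𝓝 x) (𝓝 (c x)) := c.continuousAt hxc
  have hes : Tendsto e.symm (𝓝 (c x)) (𝓝 (a, 0)) := by
    have := e.continuousAt_symm hcx
    rwa [ContinuousAt, hea'] at this
  have hus : SmoothNear u x := by
    filter_upwards [c.open_source.mem_nhds hxc, hct.eventually (e.open_target.mem_nhds hcx)]
      with y hy hyt
    have h1 : ContDiffAt ℝ ∞ (fun v => (e.symm v).2) (c y) :=
      contDiffAt_snd.comp (c y) (he'.contDiffAt (e.open_target.mem_nhds hyt))
    exact h1.contMDiffAt.comp y
      ((contMDiffOn_interiorChart x).contMDiffAt (c.open_source.mem_nhds hy))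
  have hu0 : ∀ᶠ w' in 𝓝 w, u (h w') = 0 := by
    have h1 : Tendsto (fun w' => (extChartAt W.model w w', (0 : ℝ))) (𝓝 w) (𝓝 (a, 0)) :=
      (continuousAt_extChartAt (I := W.model) w).tendsto.prodMk_nhds tendsto_const_nhds
    filter_upwards [h1.eventually (e.open_source.mem_nhds hae),
      extChartAt_source_mem_nhds (I := W.model) w] with w' hw' hw's
    have h2 : c (h w') = e (extChartAt W.model w w', 0) := by
      rw [heΦ', zero_smul, add_zero]
      change _ = extChartAt X.model x (h ((extChartAt W.model w).symm (extChartAt W.model w w')))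
      rw [(extChartAt W.model w).left_inv hw's]
      rfl
    change (e.symm (c (h w'))).2 = 0
    rw [h2, e.left_inv hw']
  have hux : u x = 0 := hu0.self_of_nhds
  refine ⟨u, hus, hux, fun h0 => ?_, ?_, hu0, ?_⟩
  -- If the differential vanished, so would the derivative of the projection `W.Vec × ℝ → ℝ`,
  -- because `u` in the chart composed with `e` is this projection.
  · have h1 : MDifferentiableAt 𝓘(ℝ, X.Vec) X.model c.symm (c x) :=
      ((contMDiffOn_interiorChart_symm x).contMDiffAt
        (c.open_target.mem_nhds (c.map_source hxc))).mdifferentiableAt (by simp)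
    have h2 := fderiv_eq_dfun_comp (U := fun v => (e.symm v).2) (u := u) h1
      (by rw [c.left_inv hxc]; exact hus.mdifferentiableAt) (by
        filter_upwards [c.open_target.mem_nhds (c.map_source hxc)] with v hv
        change _ = (e.symm (c (c.symm v))).2
        rw [c.right_inv hv])
    rw [c.left_inv hxc, h0, LinearMap.zero_comp] at h2
    have h3 : DifferentiableAt ℝ (fun v => (e.symm v).2) (c x) :=
      (contDiffAt_snd.comp (c x) (he'.contDiffAt (e.open_target.mem_nhds hcx))).differentiableAt
        (by simp)
    have h3' := h3.hasFDerivAt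
    have h4 : fderiv ℝ (fun v => (e.symm v).2) (c x) = 0 := by
      ext v
      exact congrArg (fun A : X.Vec →ₗ[ℝ] ℝ => A v) h2
    rw [h4, ← hea] at h3'
    have h5 : HasFDerivAt (fun r => (e.symm (e r)).2) (0 : W.Vec × ℝ →L[ℝ] ℝ) (a, 0) := by
      have h6 : HasFDerivAt e Φ' (a, 0) := by rw [heΦ]; exact hΦ'
      have h7 := HasFDerivAt.comp (a, (0 : ℝ)) h3' h6
      rwa [ContinuousLinearMap.zero_comp] at h7
    have h8 : HasFDerivAt (fun r : W.Vec × ℝ => r.2) (0 : W.Vec × ℝ →L[ℝ] ℝ) (a, 0) := by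
      refine h5.congr_of_eventuallyEq ?_
      filter_upwards [e.open_source.mem_nhds hae] with r hr
      rw [e.left_inv hr]
    have h9 := congrArg (fun A : W.Vec × ℝ →L[ℝ] ℝ => A (0, 1)) (h8.unique hasFDerivAt_snd)
    simp at h9
  · rintro _ ⟨v, rfl⟩
    have h1 := dfun_comp h (y := w) (u := u) (hus.mdifferentiableAt (x := x))
    -- The function is identically zero along the branch, so its differential annihilates the
    -- tangent space of the branch.
    have h2 : dfun (fun z => u (h z)) w = 0 := by
      rw [dfun_congr (u' := fun _ => (0 : ℝ)) hu0]
      exact congrArg (fun A : W.Vec →L[ℝ] ℝ => (A : W.Vec →ₗ[ℝ] ℝ))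
        (mfderiv_const (I := W.model) (I' := 𝓘(ℝ, ℝ)) (c := (0 : ℝ)) (x := w))
    rw [h2] at h1
    exact (congrArg (fun A : W.Vec →ₗ[ℝ] ℝ => A v) h1).symm
  · have h1 : Tendsto (fun y => (e.symm (c y)).1) (𝓝 x) (𝓝 a) :=
      (continuous_fst.tendsto _).comp (hes.comp hct)
    have h2 : Tendsto (extChartAt W.model w).symm (𝓝 a) (𝓝 w) := by
      have := (continuousAt_extChartAt_symm (I := W.model) w).tendsto
      rwa [extChartAt_to_inv] at this
    have h3 : Tendsto (fun y => h ((extChartAt W.model w).symm (e.symm (c y)).1)) (𝓝 x) (𝓝 x) :=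
      ((continuous h).tendsto w).comp (h2.comp h1)
    filter_upwards [c.open_source.mem_nhds hxc, hct.eventually (e.open_target.mem_nhds hcx),
      h3.eventually (extChartAt_source_mem_nhds (I := X.model) x),
      extChartAt_source_mem_nhds (I := X.model) x] with y hy hyt hys hys' hy0
    refine ⟨(extChartAt W.model w).symm (e.symm (c y)).1,
      (extChartAt X.model x).injOn hys hys' ?_⟩
    have h4 : e (e.symm (c y)) = c y := e.right_inv hyt
    rw [heΦ'] at h4
    have h5 : (e.symm (c y)).2 = 0 := hy0
    rw [h5, zero_smul, add_zero] at h4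
    exact h4

/-- A choice of local equations of the branches of a hyper map. -/
def ManC.IsHyperMap.eqn (H : IsHyperMap h) (w : W) : X → ℝ := (H.exists_equation w).choose

lemma ManC.IsHyperMap.eqn_spec (H : IsHyperMap h) {w : W} {x : X} (hw : h w = x) :
    SmoothNear (H.eqn w) x ∧ H.eqn w x = 0 ∧ dfun (H.eqn w) x ≠ 0 ∧
      (∀ v ∈ tangentImage h w, dfun (H.eqn w) x v = 0) ∧ (∀ᶠ w' in 𝓝 w, H.eqn w (h w') = 0) ∧
      ∀ᶠ y in 𝓝 x, H.eqn w y = 0 → y ∈ range h := by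
  subst hw
  exact (H.exists_equation w).choose_spec

/-- The differential of the equation at `w` is a nonzero vector of the conormal space at `w`, and
these spaces are independent by self-transversality. Since `h` is closed, all preimages of points
near `x` lie near the finite fibre over `x`, where the equations apply. -/
lemma ManC.IsHyperMap.isSystem (H : IsHyperMap h) (x : X) :
    IsSystem (range h) x fun w : {w : W // h w = x} => H.eqn w.1 where
  smooth w := (H.eqn_spec w.2).1
  zero w := (H.eqn_spec w.2).2.1
  indep := by
    refine (H.selfTransversal x).linearIndependent _ (fun w => ?_) fun w => (H.eqn_spec w.2).2.2.1
    rw [conormal_eq, Submodule.mem_dualAnnihilator]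
    exact (H.eqn_spec w.2).2.2.2.1
  mem_iff := by
    have := H.finite_fiber x
    have h1 : ∀ᶠ y in 𝓝 x, ∀ w', h w' = y → ∃ w : {w : W // h w = x}, H.eqn w.1 (h w') = 0 := by
      refine H.isProper.isClosedMap.eventually_nhds_fiber x fun w hw => ?_
      filter_upwards [(H.eqn_spec hw).2.2.2.2.1] with w' hw'
      exact ⟨⟨w, hw⟩, hw'⟩
    have h2 : ∀ᶠ y in 𝓝 x, ∀ w : {w : W // h w = x}, H.eqn w.1 y = 0 → y ∈ range h :=
      eventually_all.2 fun w => (H.eqn_spec w.2).2.2.2.2.2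
    filter_upwards [h1, h2] with y hy1 hy2
    constructor
    · rintro ⟨w', rfl⟩
      exact hy1 w' rfl
    · rintro ⟨w, hw⟩
      exact hy2 w hw

end Hyper

variable {X Y Z : ManC}

lemma isNC_of_isHyperSubset {E : Set X} (hX : X.IsBoundaryless) (hE : X.IsHyperSubset E) :
    IsNC X E := by
  obtain ⟨W, h, H, rfl⟩ := hE
  exact ⟨hX, fun x => (H.isSystem x).exists_box hX⟩

/-- A map along which local equations of `E` remain independent. -/
def IsTransversal (f : Y ⟶ X) (E : Set X) : Prop :=
  ∀ y : Y, ∃ (ι : Type) (u : ι → X → ℝ), IsSystem E (f y) u ∧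
    LinearIndependent ℝ fun j => dfun (fun z => u j (f z)) y

/-- The pulled back differentials lie in the conormal spaces of the pullback, which are independent
by assumption. They are nonzero: a differential that vanishes on the tangent space of the branch and
on the image of `df` vanishes on their sum, which is everything by transversality. -/
lemma isTransversal_of_isMultiTransverse {f : Y ⟶ X} {E : Set X} (hf : IsMultiTransverse f E) :
    IsTransversal f E := by
  obtain ⟨W, h, H, rfl, hf1, hf2⟩ := hf
  intro y
  refine ⟨_, _, H.isSystem (f y), (hf2 y).linearIndependent _ (fun w => ?_) fun w h0 => ?_⟩
  · rw [dfun_comp f (H.eqn_spec w.2).1.mdifferentiableAt, Submodule.mem_dualAnnihilator]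
    exact fun v hv => (H.eqn_spec w.2).2.2.2.1 _ hv
  · rw [dfun_comp f (H.eqn_spec w.2).1.mdifferentiableAt] at h0
    refine (H.eqn_spec w.2).2.2.1 (LinearMap.ext fun v => ?_)
    have hv : v ∈ LinearMap.range (tmap f y : Y.Vec →ₗ[ℝ] X.Vec) ⊔ tangentImage h w.1 := by
      rw [hf1 y w.1 w.2]; trivial
    obtain ⟨_, ⟨v₁, rfl⟩, v₂, hv₂, rfl⟩ := Submodule.mem_sup.1 hv
    rw [map_add, (H.eqn_spec w.2).2.2.2.1 v₂ hv₂, add_zero]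
    exact congrArg (fun A : Y.Vec →ₗ[ℝ] ℝ => A v₁) h0

/-! #### Étale maps -/

lemma ManC.IsEtale.isLocalHomeomorph {f : Y ⟶ X} (hf : IsEtale f) : IsLocalHomeomorph f :=
  IsLocalDiffeomorph.isLocalHomeomorph hf

lemma ManC.IsEtale.comp {f : Y ⟶ X} {g : X ⟶ Z} (hf : IsEtale f) (hg : IsEtale g) :
    IsEtale (f ≫ g) := fun y => (hf y).comp Z.model Z (hg (f y))

lemma ManC.IsEtale.surjective_tmap {f : Y ⟶ X} (hf : IsEtale f) (y : Y) :
    Function.Surjective (tmap f y) := by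
  have h1 := IsLocalDiffeomorphAt.mfderivToContinuousLinearEquiv_coe (hf y) (by simp)
  intro v
  obtain ⟨w, hw⟩ := ((hf y).mfderivToContinuousLinearEquiv (by simp)).surjective v
  refine ⟨w, ?_⟩
  rw [← hw]
  exact (congrArg (fun A : Y.Vec →L[ℝ] X.Vec => A w) h1).symm

/-- The transpose of a surjective differential is injective. -/
lemma linearIndependent_dfun_comp {ι : Type} {u : ι → X → ℝ} {f : Y ⟶ X} {y : Y} (hf : IsEtale f)
    (hu : ∀ j, MDifferentiableAt X.model 𝓘(ℝ, ℝ) (u j) (f y))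
    (hli : LinearIndependent ℝ fun j => dfun (u j) (f y)) :
    LinearIndependent ℝ fun j => dfun (fun z => u j (f z)) y := by
  have h1 : Function.Injective (tmap f y : Y.Vec →ₗ[ℝ] X.Vec).dualMap :=
    LinearMap.dualMap_injective_of_surjective (hf.surjective_tmap y)
  have h2 : (fun j => dfun (fun z => u j (f z)) y) =
      (tmap f y : Y.Vec →ₗ[ℝ] X.Vec).dualMap ∘ fun j => dfun (u j) (f y) :=
    funext fun j => dfun_comp f (hu j)
  rw [h2]
  exact hli.map' _ (LinearMap.ker_eq_bot.2 h1)

lemma IsSystem.comp {E : Set X} {ι : Type} {u : ι → X → ℝ} {f : Y ⟶ X} {y : Y}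
    (hu : IsSystem E (f y) u) (hf : LinearIndependent ℝ fun j => dfun (fun z => u j (f z)) y) :
    IsSystem (f ⁻¹' E) y fun j z => u j (f z) where
  smooth j := (hu.smooth j).comp f
  zero j := hu.zero j
  indep := hf
  mem_iff := (continuous f).continuousAt.eventually hu.mem_iff

lemma IsSystem.comp_etale {E : Set X} {ι : Type} {u : ι → X → ℝ} {f : Y ⟶ X} {y : Y}
    (hu : IsSystem E (f y) u) (hf : IsEtale f) : IsSystem (f ⁻¹' E) y fun j z => u j (f z) :=
  hu.comp (linearIndependent_dfun_comp hf (fun j => (hu.smooth j).mdifferentiableAt) hu.indep)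

/-- The coordinates of a box are independent after composition with a transversal map. -/
lemma IsTransversal.linearIndependent {f : Y ⟶ X} {E : Set X} (hf : IsTransversal f E) (y : Y)
    (b : Box X E) (hx : f y ∈ b.e.source) (hx0 : b.e (f y) = 0) :
    LinearIndependent ℝ fun i : {i : Fin X.dim // i.1 < b.k} => dfun (fun z => b.e (f z) i.1) y := by
  obtain ⟨ι, u, hu, hli⟩ := hf y
  exact hu.linearIndependent_box hli b hx hx0

lemma IsNC.isTransversal_of_isEtale {f : Y ⟶ X} {E : Set X} (hE : IsNC X E) (hf : IsEtale f) :
    IsTransversal f E := fun y => by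
  obtain ⟨b, hb, hb0⟩ := hE.exists_box (f y)
  have h := b.isSystem hb hb0
  refine ⟨_, _, h, ?_⟩
  exact linearIndependent_dfun_comp (u := fun (i : {i : Fin X.dim // i.1 < b.k}) z => b.e z i.1) hf
    (fun j => (h.smooth j).mdifferentiableAt) h.indep

/-- Equations of `E` pull back along the étale map `g` to equations of `g⁻¹(E)`. With `g` the source
map, this passes transversality from objects to the arrows part of a functor and to the components
of a transformation. -/
lemma IsTransversal.of_comp_etale {f : Y ⟶ X} {g : X ⟶ Z} {E : Set Z} (hg : IsEtale g)
    (h : IsTransversal (f ≫ g) E) : IsTransversal f (g ⁻¹' E) := fun y => by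
  obtain ⟨ι, u, hu, hli⟩ := h y
  exact ⟨ι, _, IsSystem.comp_etale (f := g) (y := f y) hu hg, hli⟩

lemma IsTransversal.etale_comp {f : Y ⟶ X} {g : X ⟶ Z} {E : Set Z} (hf : IsEtale f)
    (h : IsTransversal g E) : IsTransversal (f ≫ g) E := fun y => by
  obtain ⟨ι, u, hu, hli⟩ := h (f y)
  refine ⟨ι, u, hu, ?_⟩
  exact linearIndependent_dfun_comp (u := fun j z => u j (g z)) hf
    (fun j => ((hu.smooth j).comp g).mdifferentiableAt) hli

/-- The quadrant has unique derivatives also at its boundary points, so the argument covers points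
of positive depth. -/
lemma ManC.dfun_coord_ne_zero (X : ManC) (x : X) (i : Fin X.dim) :
    dfun (fun y => X.coord x y i) x ≠ 0 := by
  intro h0
  have h2 : MDifferentiableAt X.model 𝓘(ℝ, ℝ) (fun y => X.coord x y i) x :=
    ((X.contMDiffOn_coord x i).contMDiffAt ((chartAt (EuclideanQuadrant X.dim) x).open_source.mem_nhds
      (mem_chart_source _ x))).mdifferentiableAt (by simp)
  have h3 := h2.mfderiv
  have h4 : HasFDerivWithinAt (writtenInExtChartAt X.model 𝓘(ℝ, ℝ) x fun y => X.coord x y i)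
      (EuclideanSpace.proj (𝕜 := ℝ) i : X.Vec →L[ℝ] ℝ) (range X.model) (extChartAt X.model x x) := by
    refine (EuclideanSpace.proj (𝕜 := ℝ) i : X.Vec →L[ℝ] ℝ).hasFDerivWithinAt.congr_of_eventuallyEq
      ?_ ?_
    · filter_upwards [extChartAt_target_mem_nhdsWithin (I := X.model) x] with v hv
      exact congrArg (fun v : X.Vec => v i) ((extChartAt X.model x).right_inv hv)
    · exact congrArg (fun v : X.Vec => v i)
        ((extChartAt X.model x).right_inv (mem_extChartAt_target x))
  rw [h4.fderivWithin (X.model.uniqueDiffOn _ (mem_range_self _))] at h3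
  have h5 : (EuclideanSpace.proj (𝕜 := ℝ) i : X.Vec →L[ℝ] ℝ) (EuclideanSpace.single i 1) = 0 :=
    (congrArg (fun A : X.Vec →L[ℝ] ℝ => A (EuclideanSpace.single i 1)) h3).symm.trans
      (congrArg (fun A : X.Vec →ₗ[ℝ] ℝ => A (EuclideanSpace.single i 1)) h0)
  simp at h5

/-- The source of an étale map to a manifold without boundary has no boundary. -/
lemma ManC.IsEtale.isBoundaryless {f : Y ⟶ X} (hf : IsEtale f) (hX : X.IsBoundaryless) :
    Y.IsBoundaryless := by
  intro y
  rw [ManC.depth, Set.ncard_eq_zero (Set.toFinite _), eq_empty_iff_forall_notMem]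
  intro i hi
  obtain ⟨Φ, hy, hΦ⟩ := hf y
  let c := X.interiorChart (f y)
  have hx : f y ∈ c.source := hX.mem_interiorChart (f y)
  have hfy : Φ y = f y := (hΦ hy).symm
  let U : X.Vec → ℝ := fun v => Y.coord y (Φ.symm (c.symm v)) i
  have hc' := contMDiffOn_interiorChart_symm (f y)
  have hcx : c.symm (c (f y)) = f y := c.left_inv hx
  have hΦs : Φ.symm (f y) = y := by rw [← hfy]; exact Φ.left_inv hy
  have hxt : f y ∈ Φ.target := hfy ▸ Φ.map_source hy
  have h1 : ContMDiffAt 𝓘(ℝ, X.Vec) 𝓘(ℝ, ℝ) ∞ U (c (f y)) := by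
    have e1 : ContMDiffAt 𝓘(ℝ, X.Vec) X.model ∞ c.symm (c (f y)) :=
      hc'.contMDiffAt (c.open_target.mem_nhds (c.map_source hx))
    have e2 : ContMDiffAt X.model Y.model ∞ Φ.symm (c.symm (c (f y))) := by
      rw [hcx]
      exact Φ.contMDiffOn_invFun.contMDiffAt (Φ.open_target.mem_nhds hxt)
    have e3 : ContMDiffAt Y.model 𝓘(ℝ, ℝ) ∞ (fun z => Y.coord y z i)
        (Φ.symm (c.symm (c (f y)))) := by
      rw [hcx, hΦs]
      exact (Y.contMDiffOn_coord y i).contMDiffAt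
        ((chartAt _ y).open_source.mem_nhds (mem_chart_source _ y))
    exact ContMDiffAt.comp (g := fun z => Y.coord y (Φ.symm z) i) _ (ContMDiffAt.comp (g := fun z => Y.coord y z i) _ e3 e2) e1
  have h2 : DifferentiableAt ℝ U (c (f y)) :=
    (contMDiffAt_iff_contDiffAt.1 h1).differentiableAt (by simp)
  -- A boundary coordinate vanishing at `y` would become, through the local inverse, a nonnegative
  -- function with a zero at an interior point of $\mathbb R^n$. Its derivative is zero at this
  -- minimum, whereas the differential of a coordinate is not.
  have hmin : IsLocalMin U (c (f y)) := Eventually.of_forall fun v => by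
    change Y.coord y (Φ.symm (c.symm (c (f y)))) i ≤ _
    rw [hcx, hΦs]
    exact (le_of_eq hi).trans (Y.coord_nonneg y _ i)
  have hcf : MDifferentiableAt Y.model 𝓘(ℝ, X.Vec) (fun z => c (f z)) y :=
    (((contMDiffOn_interiorChart (f y)).contMDiffAt (c.open_source.mem_nhds hx)).comp y
      (contMDiff f y)).mdifferentiableAt (by simp)
  refine Y.dfun_coord_ne_zero y i ((dfun_eq_fderiv_comp hcf h2 ?_).trans ?_)
  · filter_upwards [Φ.open_source.mem_nhds hy,
      (continuous f).continuousAt (c.open_source.mem_nhds hx)] with z hz hzc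
    change _ = Y.coord y (Φ.symm (c.symm (c (f z)))) i
    rw [c.left_inv hzc, hΦ hz]
    congr 1
    exact (Φ.left_inv hz).symm
  · rw [hmin.fderiv_eq_zero]
    rfl

/-- The preimage of a union of hyperplanes under an étale map. -/
lemma IsNC.preimage {f : Y ⟶ X} {E : Set X} (hE : IsNC X E) (hf : IsEtale f) :
    IsNC Y (f ⁻¹' E) where
  boundaryless := hf.isBoundaryless hE.boundaryless
  exists_box y := by
    obtain ⟨b, hb, hb0⟩ := hE.exists_box (f y)
    exact ((b.isSystem hb hb0).comp_etale hf).exists_box (hf.isBoundaryless hE.boundaryless)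

end HyperBlowup

namespace HyperBlowup

open TopologicalSpace (Opens)
open Filter ManC

/-! ### Blowups of maps -/

namespace Blowup

variable {X Y Z : ManC} {E : Set X} {E' : Set Y} {E'' : Set Z} {f : X ⟶ Y}

lemma continuous_map (f : X ⟶ Y) (h : f ⁻¹' E' = E) : Continuous (map f h) :=
  GermSpace.continuous_map _ _

lemma map_map (h : f ⁻¹' E' = E) {f' : Y ⟶ Z} (h' : f' ⁻¹' E'' = E')
    (h'' : (f ≫ f') ⁻¹' E'' = E) (g : Blowup X E) :
    map f' h' (map f h g) = map (f ≫ f') h'' g :=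
  GermSpace.map_map _ _ _ _ g

lemma map_id (h : (𝟙 X : X ⟶ X) ⁻¹' E = E) (g : Blowup X E) : map (𝟙 X) h g = g :=
  GermSpace.map_id _ g

lemma preimage_compl (h : f ⁻¹' E' = E) : f ⁻¹' E'ᶜ = Eᶜ := by
  rw [← h]; rfl

lemma map_injOn_fibre (hf : IsEtale f) (h : f ⁻¹' E' = E) {g g' : Blowup X E} (hpt : g.pt = g'.pt)
    (he : map f h g = map f h g') : g = g' :=
  GermSpace.map_injOn_fibre (ManC.continuous f) (preimage_compl h) hf.isLocalHomeomorph hpt he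

lemma exists_map_eq (hf : IsEtale f) (h : f ⁻¹' E' = E) (x : X) (g' : Blowup Y E')
    (hx : g'.pt = f x) : ∃ g : Blowup X E, g.pt = x ∧ map f h g = g' :=
  GermSpace.exists_map_eq (ManC.continuous f) (preimage_compl h) hf.isLocalHomeomorph x g' hx

lemma tendsto_of_tendsto_map (hf : IsEtale f) (h : f ⁻¹' E' = E) {α : Type*} {l : Filter α}
    {F : α → Blowup X E} {g : Blowup X E} (h1 : Tendsto (fun a => (F a).pt) l (𝓝 g.pt))
    (h2 : Tendsto (fun a => map f h (F a)) l (𝓝 (map f h g))) : Tendsto F l (𝓝 g) :=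
  GermSpace.tendsto_of_tendsto_map (ManC.continuous f) (preimage_compl h) hf.isLocalHomeomorph h1 h2

/-- The coordinates of a box, pulled back along a transversal map, agree up to positive functions
with the coordinates of a box in the source. -/
lemma exists_coord_eq (hf : IsTransversal f E') (h : f ⁻¹' E' = E) (g : Blowup X E) (b : Box X E)
    (hb : g ∈ b.cell) (hb0 : b.e g.pt = 0) (b' : Box Y E') (hb' : map f h g ∈ b'.cell)
    (hb0' : b'.e (f g.pt) = 0) :
    ∃ (π : {j : Fin Y.dim // j.1 < b'.k} ≃ {i : Fin X.dim // i.1 < b.k})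
      (G : {j : Fin Y.dim // j.1 < b'.k} → X → ℝ), ∀ j, SmoothNear (G j) g.pt ∧ 0 < G j g.pt ∧
        ∀ᶠ y in 𝓝 g.pt, b'.e (f y) j.1 = G j y * b.e y (π j).1 := by
  have hs' : f g.pt ∈ b'.e.source := hb'.1
  have h1 := (b'.isSystem hs' hb0').comp (hf.linearIndependent g.pt b' hs' hb0')
  rw [h] at h1
  obtain ⟨π, G, hG⟩ := h1.compare b hb.1 hb0
  refine ⟨π, G, fun j => ⟨(hG j).1, ?_, (hG j).2.2⟩⟩
  -- Near the base point the component of `g` lies in the positive part of `b` and its image in the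
  -- positive part of `b'`. A negative factor would contradict this at any point of the component.
  by_contra hneg
  have hlt : G j g.pt < 0 := lt_of_le_of_ne (not_lt.1 hneg) (hG j).2.1
  have hev := ((hG j).1.self_of_nhds.continuousAt.eventually (gt_mem_nhds hlt)).and (hG j).2.2
  obtain ⟨O, hO, hOo, hgO⟩ := mem_nhds_iff.1 hev
  let V : Opens X := ⟨O ∩ b.e.source ∩ f ⁻¹' b'.e.source, (hOo.inter b.e.open_source).inter
    (b'.e.open_source.preimage (ManC.continuous f))⟩
  have hgV : g.pt ∈ V := ⟨⟨hgO, hb.1⟩, hs'⟩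
  obtain ⟨z, hz⟩ := g.comp_nonempty V hgV
  have hzO := hO (g.comp_subset V hz).1.1.1
  have hz1 : z ∈ b.pos := by
    rw [← hb.2]
    exact g.compatible V b.src hgV (fun y hy => hy.1.2) hz
  have hz2 : f z ∈ b'.pos := by
    rw [← hb'.2]
    exact GermSpace.mem_map_comp g (g.compatible V
      ⟨f ⁻¹' b'.src, b'.src.isOpen.preimage (ManC.continuous f)⟩ hgV (fun y hy => hy.2) hz)
  have e1 : 0 < b'.e (f z) j.1 := hz2.2 j.1 j.2
  have e2 : 0 < b.e z (π j).1 := hz1.2 _ (π j).2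
  rw [hzO.2] at e1
  exact (mul_neg_of_neg_of_pos hzO.1 e2).not_gt e1

end Blowup

lemma ManC.isMonomialAt_of_coord_ne_zero {M X : ManC} {f : M → X}
    (hf : ContMDiff M.model X.model ∞ f) (c : M) (j : Fin X.dim)
    (hj : X.coord (f c) (f c) j ≠ 0) :
    M.IsMonomialAt c (fun y => X.coord (f c) (f y) j) 0 := by
  have h1 : ContMDiffOn M.model 𝓘(ℝ, ℝ) ∞ (fun y => X.coord (f c) (f y) j)
      (f ⁻¹' (chartAt (EuclideanQuadrant X.dim) (f c)).source) :=
    (X.contMDiffOn_coord (f c) j).comp hf.contMDiffOn fun _ h => h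
  have ho := h1.continuousOn.isOpen_inter_preimage
    ((chartAt (EuclideanQuadrant X.dim) (f c)).open_source.preimage hf.continuous)
    (isOpen_Ioi (a := (0 : ℝ)))
  exact ManC.isMonomialAt_of_pos ho ⟨mem_chart_source _ (f c),
    lt_of_le_of_ne (X.coord_nonneg _ _ j) hj.symm⟩ (h1.mono inter_subset_left) fun y hy => hy.2

lemma ManC.isMonomialAt_of_smoothNear {X : ManC} {x : X} {G : X → ℝ} (hG : SmoothNear G x)
    (hpos : 0 < G x) : X.IsMonomialAt x G 0 := by
  obtain ⟨O, hO, hOo, hx⟩ := mem_nhds_iff.1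
    (hG.and (hG.self_of_nhds.continuousAt.eventually (lt_mem_nhds hpos)))
  exact ManC.isMonomialAt_of_pos hOo hx (fun y hy => (hO hy).1.contMDiffWithinAt)
    fun y hy => (hO hy).2

namespace IsNC

variable {X Y Z : ManC} {E : Set X} {E' : Set Y} {E'' : Set Z} {f : X ⟶ Y}

lemma coord_eq_of_lt (h : IsNC X E) {g g' : h.blowup} (hg' : g' ∈ (h.box g).cell) {i : Fin X.dim}
    (hi : i.1 < (h.box g).k) : h.blowup.coord g g' i = (h.box g).e (GermSpace.pt g') i :=
  (h.coord_eq hg' i).trans (by rw [if_pos hi, add_zero])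

lemma contMDiff_map (hX : IsNC X E) (hY : IsNC Y E') (f : X ⟶ Y) (h : f ⁻¹' E' = E) :
    ContMDiff (M := hX.blowup) (M' := hY.blowup) hX.blowup.model hY.blowup.model ∞
      (Blowup.map f h) :=
  hY.contMDiff_of_pt (M := hX.blowup) (Blowup.continuous_map f h)
    ((ManC.contMDiff f).comp hX.contMDiff_pt)

/-- Boundary coordinates correspond under `π` up to positive factors, and the remaining coordinates
are positive. The exponents thus form a permutation matrix on the vanishing coordinates, which
yields smoothness, simplicity and, by counting, equality of depths. -/
lemma isMonomialAt_coord_map (hX : IsNC X E) (hY : IsNC Y E') (hf : IsTransversal f E')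
    (h : f ⁻¹' E' = E) (g : hX.blowup) :
    ∃ π : {j : Fin Y.dim // j.1 < (hY.box (Blowup.map f h g)).k} ≃
        {i : Fin X.dim // i.1 < (hX.box g).k},
      ∀ j : Fin Y.dim, hX.blowup.IsMonomialAt g
        (fun g' => hY.blowup.coord (Blowup.map f h g) (Blowup.map f h g') j)
        (if hj : j.1 < (hY.box (Blowup.map f h g)).k then Pi.single (π ⟨j, hj⟩).1 1 else 0) := by
  obtain ⟨π, G, hG⟩ := Blowup.exists_coord_eq hf h g (hX.box g) (hX.mem_cell g) (hX.box_pt g)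
    (hY.box (Blowup.map f h g)) (hY.mem_cell _) (hY.box_pt (Blowup.map f h g))
  refine ⟨π, fun j => ?_⟩
  split_ifs with hj
  · obtain ⟨h1, h2, h3⟩ := hG ⟨j, hj⟩
    have m1 : hX.blowup.IsMonomialAt g (fun g' => G ⟨j, hj⟩ (GermSpace.pt g')) 0 :=
      ManC.isMonomialAt_of_smoothNear (SmoothNear.comp hX.β h1) h2
    have m2 := ManC.isMonomialAt_coord (X := hX.blowup) g (π ⟨j, hj⟩).1
    have e2 : hX.blowup.coord g g (π ⟨j, hj⟩).1 = 0 :=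
      (hX.coord_self g _).trans (if_pos (π ⟨j, hj⟩).2)
    rw [if_pos e2] at m2
    have m3 := m1.mul m2
    rw [zero_add] at m3
    refine m3.congr ?_
    have e3 : ∀ᶠ g' in 𝓝 g, (Blowup.map f h g' : Blowup Y E') ∈ (hY.box (Blowup.map f h g)).cell :=
      (Blowup.continuous_map f h).continuousAt.eventually (hY.cell_mem_nhds (Blowup.map f h g))
    filter_upwards [e3, hX.cell_mem_nhds g, (hX.continuous_pt.tendsto g).eventually h3]
      with g' t1 t2 t3
    refine (hY.coord_eq_of_lt t1 hj).trans (t3.trans ?_)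
    exact congrArg (G ⟨j, hj⟩ (GermSpace.pt g') * ·) (hX.coord_eq_of_lt t2 (π ⟨j, hj⟩).2).symm
  · refine ManC.isMonomialAt_of_coord_ne_zero (hX.contMDiff_map hY f h) g j ?_
    have e1 := hY.coord_self (Blowup.map f h g) j
    rw [if_neg hj] at e1
    exact fun e2 => one_ne_zero (e1.symm.trans e2)

/-- The blowup of a transversal map. -/
def map (hX : IsNC X E) (hY : IsNC Y E') (f : X ⟶ Y) (hf : IsTransversal f E') (h : f ⁻¹' E' = E) :
    hX.blowup ⟶ hY.blowup :=
  show ManC.Hom _ _ from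
  { toFun := Blowup.map f h
    weaklySmooth := hX.contMDiff_map hY f h
    smooth := fun g j => by
      obtain ⟨π, hπ⟩ := hX.isMonomialAt_coord_map hY hf h g
      exact Or.inl ⟨_, hπ j⟩ }

lemma isPerfectlySimple_map (hX : IsNC X E) (hY : IsNC Y E') (hf : IsTransversal f E')
    (h : f ⁻¹' E' = E) : IsPerfectlySimple (hX.map hY f hf h) := by
  refine ⟨fun g => ?_, fun g => ?_⟩
  · obtain ⟨π, hπ⟩ := hX.isMonomialAt_coord_map hY hf h g
    refine ⟨_, hπ, fun i hi => ?_⟩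
    have hik : i.1 < (hX.box g).k := by
      by_contra hik
      have e1 := hX.coord_self g i
      rw [if_neg hik] at e1
      exact one_ne_zero (e1.symm.trans hi)
    refine ⟨(π.symm ⟨i, hik⟩).1, ?_, fun j hj => ?_⟩
    · rw [dif_pos (π.symm ⟨i, hik⟩).2, Subtype.coe_eta, π.apply_symm_apply, Pi.single_eq_same]
    · by_cases hjk : Fin.val (n := Y.dim) j < (hY.box (Blowup.map f h g)).k
      · rw [dif_pos hjk]
        refine Pi.single_eq_of_ne (fun hij => hj ?_) 1
        have : (⟨i, hik⟩ : {i : Fin X.dim // i.1 < (hX.box g).k}) = π ⟨j, hjk⟩ := Subtype.ext hij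
        rw [this, π.symm_apply_apply]
      · rw [dif_neg hjk]
        rfl
  · obtain ⟨π, -⟩ := hX.isMonomialAt_coord_map hY hf h g
    refine (hY.depth_eq (Blowup.map f h g)).trans (Eq.trans ?_ (hX.depth_eq g).symm)
    exact Nat.card_congr π

lemma map_β (hX : IsNC X E) (hY : IsNC Y E') (hf : IsTransversal f E') (h : f ⁻¹' E' = E) :
    hX.map hY f hf h ≫ hY.β = hX.β ≫ f := rfl

lemma map_comp (hX : IsNC X E) (hY : IsNC Y E') (hZ : IsNC Z E'') {f' : Y ⟶ Z}
    (hf : IsTransversal f E') (h : f ⁻¹' E' = E) (hf' : IsTransversal f' E'')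
    (h' : f' ⁻¹' E'' = E') (hf'' : IsTransversal (f ≫ f') E'') (h'' : (f ≫ f') ⁻¹' E'' = E) :
    hX.map hY f hf h ≫ hY.map hZ f' hf' h' = hX.map hZ (f ≫ f') hf'' h'' :=
  ManC.hom_ext fun g => Blowup.map_map h h' h'' g

lemma map_id (hX : IsNC X E) (hf : IsTransversal (𝟙 X) E) (h : (𝟙 X : X ⟶ X) ⁻¹' E = E) :
    hX.map hX (𝟙 X) hf h = 𝟙 hX.blowup :=
  ManC.hom_ext fun g => Blowup.map_id h g

/-- The blowup of an étale map is étale. -/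
lemma isEtale_map (hX : IsNC X E) (hY : IsNC Y E') (hf : IsTransversal f E') (h : f ⁻¹' E' = E)
    (he : IsEtale f) : IsEtale (hX.map hY f hf h) := by
  classical
  intro g
  obtain ⟨Φ, hg, hΦ⟩ := he (GermSpace.pt g)
  have key : ∀ g' : Blowup Y E', g'.pt ∈ Φ.target → ∃ g'' : Blowup X E, g''.pt = Φ.symm g'.pt ∧
      Blowup.map f h g'' = g' := fun g' hg' => Blowup.exists_map_eq he h _ g' (by
    have h1 : Φ.symm g'.pt ∈ Φ.source := Φ.map_target hg'
    rw [hΦ h1]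
    exact (Φ.right_inv hg').symm)
  let inv : hY.blowup → hX.blowup := fun g' =>
    if hg' : GermSpace.pt g' ∈ Φ.target then (key g' hg').choose else g
  have hinv : ∀ g' : hY.blowup, GermSpace.pt g' ∈ Φ.target →
      GermSpace.pt (inv g') = Φ.symm (GermSpace.pt g') ∧ Blowup.map f h (inv g') = g' := by
    intro g' hg'
    have h1 : inv g' = (key g' hg').choose := dif_pos hg'
    rw [h1]
    exact (key g' hg').choose_spec
  refine ⟨{ toFun := Blowup.map f h
            invFun := inv
            source := {g' | GermSpace.pt g' ∈ Φ.source}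
            target := {g' | GermSpace.pt g' ∈ Φ.target}
            map_source' := fun g' hg' => ?_
            map_target' := fun g' hg' => ?_
            left_inv' := fun g' hg' => ?_
            right_inv' := fun g' hg' => (hinv g' hg').2
            open_source := Φ.open_source.preimage hX.continuous_pt
            open_target := Φ.open_target.preimage hY.continuous_pt
            contMDiffOn_toFun := (hX.contMDiff_map hY f h).contMDiffOn
            contMDiffOn_invFun := fun g' hg' => ?_ }, hg, fun g' _ => rfl⟩
  · change f (GermSpace.pt g') ∈ Φ.target
    rw [hΦ hg']
    exact Φ.map_source hg'
  · change GermSpace.pt (inv g') ∈ Φ.source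
    rw [(hinv g' hg').1]
    exact Φ.map_target hg'
  · have h1 : f (GermSpace.pt g') ∈ Φ.target := by
      rw [hΦ hg']
      exact Φ.map_source hg'
    have h2 := hinv (Blowup.map f h g') h1
    refine Blowup.map_injOn_fibre he h (h2.1.trans ?_) h2.2
    change Φ.symm (f (GermSpace.pt g')) = _
    rw [hΦ hg']
    exact Φ.left_inv hg'
  · have hΦc : ContMDiffWithinAt hY.blowup.model X.model ∞
        (fun g' : hY.blowup => Φ.symm (GermSpace.pt g')) {g' | GermSpace.pt g' ∈ Φ.target} g' :=
      (Φ.contMDiffOn_invFun.comp hY.contMDiff_pt.contMDiffOn fun _ h => h) g' hg'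
    have hpt : ContMDiffWithinAt hY.blowup.model X.model ∞
        (fun g' : hY.blowup => GermSpace.pt (inv g')) {g' | GermSpace.pt g' ∈ Φ.target} g' :=
      hΦc.congr (fun g'' hg'' => (hinv g'' hg'').1) (hinv g' hg').1
    -- The projection of the inverse is `Φ.symm` of the projection, hence smooth. Continuity is
    -- checked on the projection and on the image, which is the identity.
    refine hX.contMDiffWithinAt_of_pt ?_ hpt
    refine Blowup.tendsto_of_tendsto_map he h hpt.continuousWithinAt ?_
    have h3 : Tendsto (fun g'' : hY.blowup => g'') (𝓝[{g' | GermSpace.pt g' ∈ Φ.target}] g')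
        (𝓝 g') := tendsto_id.mono_left nhdsWithin_le_nhds
    have h4 : Blowup.map f h (inv g') = g' := (hinv g' hg').2
    rw [h4]
    refine h3.congr' ?_
    filter_upwards [self_mem_nhdsWithin] with g'' hg''
    exact (hinv g'' hg'').2.symm

/-- The blowup of the source of an étale map is a pullback. -/
lemma isPullback (hX : IsNC X E) (hY : IsNC Y E') (hf : IsTransversal f E') (h : f ⁻¹' E' = E)
    (he : IsEtale f) : IsPullback (hX.map hY f hf h) hX.β hY.β f := by
  -- Pointwise, the lift is the unique germ at `c t` with image `a t`. The pullback topology makes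
  -- it continuous, and smoothness of its projection `c` makes it weakly smooth.
  have hlift : ∀ {T : ManC} (a : T ⟶ hY.blowup) (c : T ⟶ X), a ≫ hY.β = c ≫ f →
      ∃ l : T ⟶ hX.blowup, l ≫ hX.map hY f hf h = a ∧ l ≫ hX.β = c := by
    intro T a c hac
    have hac' : ∀ t, GermSpace.pt (a t) = f (c t) := fun t =>
      congrArg (fun k : T ⟶ Y => k t) hac
    choose l hl1 hl2 using fun t => Blowup.exists_map_eq he h (c t) (a t) (hac' t)
    have hcont : Continuous (l : T → hX.blowup) := by
      refine continuous_iff_continuousAt.2 fun t => ?_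
      refine Blowup.tendsto_of_tendsto_map he h ?_ ?_
      · simp only [hl1]
        exact (ManC.continuous c).tendsto t
      · simp only [hl2]
        exact (ManC.continuous a).tendsto t
    have hsm : ContMDiff (M' := hX.blowup) T.model hX.blowup.model ∞ l :=
      hX.contMDiff_of_pt hcont (by simp only [hl1]; exact ManC.contMDiff c)
    refine ⟨show ManC.Hom _ _ from ⟨l, hsm, fun t i => ?_⟩, ManC.hom_ext hl2, ManC.hom_ext hl1⟩
    by_cases hi : i.1 < (hX.box (l t)).k
    · obtain ⟨π, G, hG⟩ := Blowup.exists_coord_eq hf h (l t) (hX.box (l t)) (hX.mem_cell (l t))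
        (hX.box_pt (l t)) (hY.box (a t)) (by rw [hl2]; exact hY.mem_cell (a t)) (by
          rw [hl1, ← hac']; exact hY.box_pt (a t))
      obtain ⟨j, hj⟩ : ∃ j, π j = ⟨i, hi⟩ := π.surjective _
      obtain ⟨h1, h2, h3⟩ := hG j
      rw [hl1] at h1 h2 h3
      -- Each boundary coordinate of the lift is a positive function times a boundary coordinate of
      -- `a`. It therefore inherits from `a` whichever alternative holds, monomial or identically
      -- zero.
      have hG' : SmoothNear (fun z => (G j (c z))⁻¹) t := by
        filter_upwards [SmoothNear.comp c h1, (ManC.continuous c).continuousAt.eventually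
          (h1.self_of_nhds.continuousAt.eventually (lt_mem_nhds h2))] with z hz1 hz2
        exact hz1.inv₀ (ne_of_gt hz2)
      have m1 := ManC.isMonomialAt_of_smoothNear hG' (inv_pos.2 h2)
      have e1 : ∀ᶠ z in 𝓝 t, hX.blowup.coord (l t) (l z) i =
          (G j (c z))⁻¹ * hY.blowup.coord (a t) (a z) j.1 := by
        filter_upwards [hcont.continuousAt.eventually (hX.cell_mem_nhds (l t)),
          (ManC.continuous a).continuousAt.eventually (hY.cell_mem_nhds (a t)),
          (ManC.continuous c).continuousAt.eventually h3,
          (ManC.continuous c).continuousAt.eventually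
            (h1.self_of_nhds.continuousAt.eventually (lt_mem_nhds h2))] with z t1 t2 t3 t4
        have u1 := hX.coord_eq_of_lt t1 hi
        have u2 := hY.coord_eq_of_lt t2 j.2
        refine u1.trans (Eq.trans ?_ (congrArg ((G j (c z))⁻¹ * ·) u2).symm)
        have u3 : (hY.box (a t)).e (GermSpace.pt (a z)) j.1 =
            G j (c z) * (hX.box (l t)).e (GermSpace.pt (l z)) i := by
          rw [hac' z, t3, hj, hl1]
        dsimp only
        rw [u3, inv_mul_cancel_left₀ (ne_of_gt t4)]
      rcases ManC.Hom.smooth a t j.1 with ⟨k, hk⟩ | h0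
      · exact Or.inl ⟨_, (m1.mul hk).congr e1⟩
      · right
        filter_upwards [e1, h0] with z hz1 hz2
        refine hz1.trans ?_
        exact (congrArg ((G j (c z))⁻¹ * ·) hz2).trans (mul_zero _)
    · refine Or.inl ⟨0, ManC.isMonomialAt_of_coord_ne_zero hsm t i fun e2 => ?_⟩
      have e1 := hX.coord_self (l t) i
      rw [if_neg hi] at e1
      exact one_ne_zero (e1.symm.trans e2)
  refine ⟨⟨map_β hX hY hf h⟩, ⟨Limits.PullbackCone.IsLimit.mk _
    (fun s => (hlift s.fst s.snd s.condition).choose)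
    (fun s => (hlift s.fst s.snd s.condition).choose_spec.1)
    (fun s => (hlift s.fst s.snd s.condition).choose_spec.2) fun s m hm1 hm2 => ?_⟩⟩
  refine ManC.hom_ext fun t => ?_
  have h1 := (hlift s.fst s.snd s.condition).choose_spec
  refine Blowup.map_injOn_fibre he h ?_ ?_
  · exact congrArg (fun k : s.pt ⟶ X => k t) (hm2.trans h1.2.symm)
  · exact congrArg (fun k : s.pt ⟶ hY.blowup => k t) (hm1.trans h1.1.symm)

end IsNC

end HyperBlowup

namespace HyperBlowup

open Filter ManC

/-! ### Discrete fibrations of internal groupoids -/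

section DiscreteFibrations

universe v u

variable {C : Type u} [Category.{v} C]

/-- A map of groupoid data for which arrows are determined by their image and their source. -/
structure GroupoidData.DiscreteFibration (D X : GroupoidData C) where
  b0 : D.X0 ⟶ X.X0
  b1 : D.X1 ⟶ X.X1
  b2 : D.X2 ⟶ X.X2
  b1_s : b1 ≫ X.s = D.s ≫ b0
  b1_t : b1 ≫ X.t = D.t ≫ b0
  e_b1 : D.e ≫ b1 = b0 ≫ X.e
  i_b1 : D.i ≫ b1 = b1 ≫ X.i
  b2_p : b2 ≫ X.p = D.p ≫ b1
  b2_q : b2 ≫ X.q = D.q ≫ b1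
  m_b1 : D.m ≫ b1 = b2 ≫ X.m
  ext : ∀ {T : C} {a b : T ⟶ D.X1}, a ≫ b1 = b ≫ b1 → a ≫ D.s = b ≫ D.s → a = b

lemma GroupoidData.mul_s (D : GroupoidData C) {T : C} (a b : T ⟶ D.X1) (h : a ≫ D.t = b ≫ D.s) :
    D.mul a b h ≫ D.s = a ≫ D.s := by
  simp [GroupoidData.mul, D.m_s]

namespace GroupoidData.DiscreteFibration

variable {D : GroupoidData C} {X : Gpd C} (β : DiscreteFibration D X.toGroupoidData)

lemma comp_b1_t_eq {T : C} {a b : T ⟶ D.X1} (h : a ≫ D.t = b ≫ D.s) :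
    (a ≫ β.b1) ≫ X.t = (b ≫ β.b1) ≫ X.s := by
  rw [Category.assoc, Category.assoc, β.b1_t, β.b1_s, ← Category.assoc, h, Category.assoc]

lemma mul_b1 {T : C} (a b : T ⟶ D.X1) (h : a ≫ D.t = b ≫ D.s) :
    D.mul a b h ≫ β.b1 = X.mul (a ≫ β.b1) (b ≫ β.b1) (β.comp_b1_t_eq h) := by
  have h1 : D.isPullback.lift a b h ≫ β.b2 =
      X.isPullback.lift (a ≫ β.b1) (b ≫ β.b1) (β.comp_b1_t_eq h) := by
    refine X.isPullback.hom_ext ?_ ?_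
    · rw [IsPullback.lift_fst, Category.assoc, β.b2_p, IsPullback.lift_fst_assoc]
    · rw [IsPullback.lift_snd, Category.assoc, β.b2_q, IsPullback.lift_snd_assoc]
  rw [GroupoidData.mul, Category.assoc, β.m_b1, ← Category.assoc, h1]
  rfl

lemma comp_e_b1 {T : C} (c : T ⟶ D.X0) : (c ≫ D.e) ≫ β.b1 = (c ≫ β.b0) ≫ X.e := by
  rw [Category.assoc, β.e_b1, Category.assoc]

/-- The total space of a discrete fibration over a groupoid is a groupoid. -/
lemma isGroupoid (β : DiscreteFibration D X.toGroupoidData) : D.IsGroupoid where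
  unit_mul a := by
    -- Here and below, both sides are compared after projection, where the axiom of `X` applies, and
    -- by their sources.
    refine β.ext ((β.mul_b1 _ _ _).trans ?_) ?_
    · refine (Gpd.mul_congr ((congrArg (· ≫ β.b1) (Category.assoc a D.s D.e).symm).trans
        (β.comp_e_b1 _)) rfl _).trans ?_
      exact Gpd.unit_mul' _ _ _
    · rw [D.mul_s, Category.assoc, Category.assoc, D.e_s, Category.comp_id]
  mul_unit a := by
    refine β.ext ((β.mul_b1 _ _ _).trans ?_) (D.mul_s _ _ _)
    refine (Gpd.mul_congr rfl ((congrArg (· ≫ β.b1) (Category.assoc a D.t D.e).symm).trans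
        (β.comp_e_b1 _)) _).trans ?_
    exact Gpd.mul_unit' _ _ _
  mul_inv a := by
    refine β.ext ((β.mul_b1 _ _ _).trans ?_) ?_
    · refine (Gpd.mul_congr rfl ((Category.assoc _ _ _).trans ((congrArg (a ≫ ·) β.i_b1).trans
        (Category.assoc _ _ _).symm)) _).trans ?_
      refine (X.isGroupoid.mul_inv (a ≫ β.b1)).trans ?_
      rw [Category.assoc, Category.assoc, Category.assoc, β.e_b1, ← Category.assoc β.b1, β.b1_s,
        Category.assoc]
    · rw [D.mul_s, Category.assoc, Category.assoc, D.e_s, Category.comp_id]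
  inv_mul a := by
    refine β.ext ((β.mul_b1 _ _ _).trans ?_) ?_
    · refine (Gpd.mul_congr ((Category.assoc _ _ _).trans ((congrArg (a ≫ ·) β.i_b1).trans
        (Category.assoc _ _ _).symm)) rfl _).trans ?_
      refine (X.isGroupoid.inv_mul (a ≫ β.b1)).trans ?_
      rw [Category.assoc, Category.assoc, Category.assoc, β.e_b1, ← Category.assoc β.b1, β.b1_t,
        Category.assoc]
    · rw [D.mul_s, Category.assoc, D.i_s, Category.assoc, Category.assoc, D.e_s, Category.comp_id]
  assoc a b c hab hbc := by
    refine β.ext ?_ ?_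
    · refine (β.mul_b1 _ _ _).trans (Eq.trans ?_ (β.mul_b1 _ _ _).symm)
      refine (Gpd.mul_congr (β.mul_b1 _ _ _) rfl _).trans (Eq.trans ?_
        (Gpd.mul_congr rfl (β.mul_b1 _ _ _) _).symm)
      exact Gpd.mul_assoc' _ _ _ (β.comp_b1_t_eq hab) (β.comp_b1_t_eq hbc)
    · rw [D.mul_s, D.mul_s, D.mul_s]

variable {D' : GroupoidData C} {X' : Gpd C} (β' : DiscreteFibration D' X'.toGroupoidData)

/-- Maps between total spaces of discrete fibrations which lie over functors preserve composition. -/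
lemma mul_comp (F : X.Fun X') (f0 : D.X0 ⟶ D'.X0) (f1 : D.X1 ⟶ D'.X1) (hs : f1 ≫ D'.s = D.s ≫ f0)
    (ht : f1 ≫ D'.t = D.t ≫ f0) (h1 : f1 ≫ β'.b1 = β.b1 ≫ F.f1) {T : C} (a b : T ⟶ D.X1)
    (h : a ≫ D.t = b ≫ D.s) :
    D.mul a b h ≫ f1 = D'.mul (a ≫ f1) (b ≫ f1) (by
      rw [Category.assoc, Category.assoc, hs, ht, ← Category.assoc, h, Category.assoc]) := by
  have h1' : ∀ c : T ⟶ D.X1, (c ≫ β.b1) ≫ F.f1 = (c ≫ f1) ≫ β'.b1 := fun c => by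
    rw [Category.assoc, ← h1, Category.assoc]
  refine β'.ext ?_ ?_
  · rw [β'.mul_b1, Category.assoc, h1, ← Category.assoc, β.mul_b1, F.map_mul]
    exact Gpd.mul_congr (h1' a) (h1' b) _
  · rw [D'.mul_s, Category.assoc, hs, ← Category.assoc, D.mul_s, Category.assoc, Category.assoc, hs]

/-- Maps between total spaces of discrete fibrations which lie over natural transformations are
natural. -/
lemma naturality {F G : X ⟶ X'} (η : F ⟶ G) (f0 g0 : D.X0 ⟶ D'.X0) (f1 g1 : D.X1 ⟶ D'.X1)
    (α : D.X0 ⟶ D'.X1) (hs : f1 ≫ D'.s = D.s ≫ f0) (hα : α ≫ D'.s = f0)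
    (ht : f1 ≫ D'.t = D.t ≫ f0) (hs' : g1 ≫ D'.s = D.s ≫ g0) (hα' : α ≫ D'.t = g0)
    (hf : f1 ≫ β'.b1 = β.b1 ≫ Gpd.Fun.f1 F) (hg : g1 ≫ β'.b1 = β.b1 ≫ Gpd.Fun.f1 G)
    (hb : α ≫ β'.b1 = β.b0 ≫ Gpd.Trans.α η) {T : C} (a : T ⟶ D.X1) :
    D'.mul (a ≫ f1) (a ≫ D.t ≫ α) (by simp [ht, hα]) =
      D'.mul (a ≫ D.s ≫ α) (a ≫ g1) (by simp [hs', hα']) := by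
  refine β'.ext ?_ ?_
  · rw [β'.mul_b1, β'.mul_b1]
    have e1 : (a ≫ f1) ≫ β'.b1 = (a ≫ β.b1) ≫ Gpd.Fun.f1 F := by
      rw [Category.assoc, hf, Category.assoc]
    have e2 : (a ≫ g1) ≫ β'.b1 = (a ≫ β.b1) ≫ Gpd.Fun.f1 G := by
      rw [Category.assoc, hg, Category.assoc]
    have e3 : (a ≫ D.t ≫ α) ≫ β'.b1 = (a ≫ β.b1) ≫ X.t ≫ Gpd.Trans.α η := by
      rw [Category.assoc, Category.assoc, hb, ← Category.assoc D.t, ← β.b1_t, Category.assoc,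
        Category.assoc]
    have e4 : (a ≫ D.s ≫ α) ≫ β'.b1 = (a ≫ β.b1) ≫ X.s ≫ Gpd.Trans.α η := by
      rw [Category.assoc, Category.assoc, hb, ← Category.assoc D.s, ← β.b1_s, Category.assoc,
        Category.assoc]
    rw [Gpd.mul_congr e1 e3, Gpd.mul_congr e4 e2]
    exact Gpd.Trans.naturality η (a ≫ β.b1)
  · rw [D'.mul_s, D'.mul_s, Category.assoc, Category.assoc, Category.assoc, hs, hα]

end GroupoidData.DiscreteFibration

end DiscreteFibrations

/-! ### The blowup of a marked groupoid -/

namespace IsNC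

variable {X Y Z : ManC} {E : Set X} {E' : Set Y} {E'' : Set Z} {f : X ⟶ Y}

lemma map_comp_eq (hX : IsNC X E) (hY : IsNC Y E') (hZ : IsNC Z E'') {f' : Y ⟶ Z} {k : X ⟶ Z}
    (hf : IsTransversal f E') (h : f ⁻¹' E' = E) (hf' : IsTransversal f' E'')
    (h' : f' ⁻¹' E'' = E') (hk : IsTransversal k E'') (hk' : k ⁻¹' E'' = E) (e : f ≫ f' = k) :
    hX.map hY f hf h ≫ hY.map hZ f' hf' h' = hX.map hZ k hk hk' := by
  subst e
  exact map_comp hX hY hZ hf h hf' h' hk hk'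

/-- Blowing up is functorial, so commutative squares remain commutative. The equation is a separate
hypothesis so that the groupoid identities apply without rewriting inside the transversality
assumptions. -/
lemma map_comp_map_eq (hX : IsNC X E) (hY : IsNC Y E') (hZ : IsNC Z E'') {W : ManC} {E₁ : Set W}
    (hW : IsNC W E₁) {f' : Y ⟶ Z} {k : X ⟶ W} {k' : W ⟶ Z}
    (hf : IsTransversal f E') (h : f ⁻¹' E' = E) (hf' : IsTransversal f' E'')
    (h' : f' ⁻¹' E'' = E') (hk : IsTransversal k E₁) (h₁ : k ⁻¹' E₁ = E)
    (hk' : IsTransversal k' E'') (h₁' : k' ⁻¹' E'' = E₁) (e : f ≫ f' = k ≫ k') :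
    hX.map hY f hf h ≫ hY.map hZ f' hf' h' = hX.map hW k hk h₁ ≫ hW.map hZ k' hk' h₁' :=
  ManC.hom_ext fun g => by
    have h2 : (f ≫ f') ⁻¹' E'' = E := by rw [← h, ← h']; rfl
    have h3 : (k ≫ k') ⁻¹' E'' = E := by rw [← h₁, ← h₁']; rfl
    refine (Blowup.map_map h h' h2 g).trans (Eq.trans ?_ (Blowup.map_map h₁ h₁' h3 g).symm)
    congr 1

lemma map_comp_eq_id (hX : IsNC X E) (hY : IsNC Y E') {f' : Y ⟶ X} (hf : IsTransversal f E')
    (h : f ⁻¹' E' = E) (hf' : IsTransversal f' E) (h' : f' ⁻¹' E = E') (e : f ≫ f' = 𝟙 X) :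
    hX.map hY f hf h ≫ hY.map hX f' hf' h' = 𝟙 hX.blowup :=
  ManC.hom_ext fun g => by
    have h2 : (f ≫ f') ⁻¹' E = E := by rw [e]; rfl
    have h3 : (𝟙 X : X ⟶ X) ⁻¹' E = E := rfl
    refine (Blowup.map_map h h' h2 g).trans (Eq.trans ?_ (Blowup.map_id h3 g))
    congr 1

end IsNC

namespace MarkedPEG

variable (X : MarkedPEG)

lemma isNC0 : IsNC X.X0 X.E := isNC_of_isHyperSubset X.boundaryless X.hyper

lemma isNC1 : IsNC X.X1 X.E1 := X.isNC0.preimage X.etale_s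

/-- The projections from composable pairs are not among the maps assumed étale, but the first object
of a pair is also the source of its composite. -/
lemma etale_ps : IsEtale (X.p ≫ X.s) := by
  rw [← X.m_s]; exact X.etale_m.comp X.etale_s

lemma etale_qt : IsEtale (X.q ≫ X.t) := by
  rw [← X.m_t]; exact X.etale_m.comp X.etale_t

lemma isNC2 : IsNC X.X2 X.E2 := X.isNC0.preimage X.etale_ps

lemma isTransversal_s : IsTransversal X.s X.E := X.isNC0.isTransversal_of_isEtale X.etale_s

lemma isTransversal_t : IsTransversal X.t X.E := X.isNC0.isTransversal_of_isEtale X.etale_t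

lemma isTransversal_e : IsTransversal X.e X.E1 := X.isNC1.isTransversal_of_isEtale X.etale_e

lemma isTransversal_i : IsTransversal X.i X.E1 := X.isNC1.isTransversal_of_isEtale X.etale_i

lemma isTransversal_m : IsTransversal X.m X.E1 := X.isNC1.isTransversal_of_isEtale X.etale_m

lemma isTransversal_ps : IsTransversal (X.p ≫ X.s) X.E := X.isNC0.isTransversal_of_isEtale X.etale_ps

lemma isTransversal_p : IsTransversal X.p X.E1 := X.isTransversal_ps.of_comp_etale X.etale_s

lemma isTransversal_q : IsTransversal X.q X.E1 := by
  rw [← X.preimage_t]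
  exact (X.isNC0.isTransversal_of_isEtale X.etale_qt).of_comp_etale X.etale_t

/-- The blowup of the source map. -/
def blowupS : X.isNC1.blowup ⟶ X.isNC0.blowup :=
  X.isNC1.map X.isNC0 X.s X.isTransversal_s X.preimage_s

/-- The blowup of the target map. -/
def blowupT : X.isNC1.blowup ⟶ X.isNC0.blowup :=
  X.isNC1.map X.isNC0 X.t X.isTransversal_t X.preimage_t

/-- The blowup of the units. -/
def blowupE : X.isNC0.blowup ⟶ X.isNC1.blowup :=
  X.isNC0.map X.isNC1 X.e X.isTransversal_e X.preimage_e

/-- The blowup of the inversion. -/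
def blowupI : X.isNC1.blowup ⟶ X.isNC1.blowup :=
  X.isNC1.map X.isNC1 X.i X.isTransversal_i X.preimage_i

/-- The blowup of the first projection. -/
def blowupP : X.isNC2.blowup ⟶ X.isNC1.blowup :=
  X.isNC2.map X.isNC1 X.p X.isTransversal_p X.preimage_p

/-- The blowup of the second projection. -/
def blowupQ : X.isNC2.blowup ⟶ X.isNC1.blowup :=
  X.isNC2.map X.isNC1 X.q X.isTransversal_q X.preimage_q

/-- The blowup of the composition. -/
def blowupM : X.isNC2.blowup ⟶ X.isNC1.blowup :=
  X.isNC2.map X.isNC1 X.m X.isTransversal_m X.preimage_m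

lemma isPullback_blowupS : IsPullback X.blowupS X.isNC1.β X.isNC0.β X.s :=
  X.isNC1.isPullback X.isNC0 X.isTransversal_s X.preimage_s X.etale_s

/-- The squares of `s` and of `p ≫ s` are pullbacks because these maps are étale; the square of `p`
follows by cancellation. -/
lemma isPullback_blowupP : IsPullback X.blowupP X.isNC2.β X.isNC1.β X.p := by
  have h1 := X.isNC2.isPullback X.isNC0 X.isTransversal_ps rfl X.etale_ps
  rw [← X.isNC2.map_comp_eq X.isNC1 X.isNC0 X.isTransversal_p X.preimage_p X.isTransversal_s
    X.preimage_s X.isTransversal_ps rfl rfl] at h1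
  exact IsPullback.of_right h1 rfl X.isPullback_blowupS

lemma blowupP_T : X.blowupP ≫ X.blowupT = X.blowupQ ≫ X.blowupS :=
  IsNC.map_comp_map_eq _ _ _ _ _ _ _ _ _ _ _ _ X.isPullback.w

/-- Pasting the square of `p` onto the fibre product `X₂` gives a pullback rectangle over `s`. Its
composite sides factor also through `blowupQ` and `blowupT`, and cancelling the pullback square of
`s` leaves the blown up square. -/
lemma isPullback_blowup : IsPullback X.blowupP X.blowupQ X.blowupT X.blowupS :=
  IsPullback.of_bot (X.isPullback_blowupP.paste_vert X.isPullback) X.blowupP_T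
    X.isPullback_blowupS.flip.flip

/-- The structure maps of the blowup. -/
def blowupData : GroupoidData ManC where
  X0 := X.isNC0.blowup
  X1 := X.isNC1.blowup
  X2 := X.isNC2.blowup
  s := X.blowupS
  t := X.blowupT
  e := X.blowupE
  i := X.blowupI
  p := X.blowupP
  q := X.blowupQ
  m := X.blowupM
  isPullback := X.isPullback_blowup
  e_s := IsNC.map_comp_eq_id _ _ _ _ _ _ X.e_s
  e_t := IsNC.map_comp_eq_id _ _ _ _ _ _ X.e_t
  i_s := IsNC.map_comp_eq _ _ _ _ _ _ _ _ _ X.i_s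
  i_t := IsNC.map_comp_eq _ _ _ _ _ _ _ _ _ X.i_t
  m_s := IsNC.map_comp_map_eq _ _ _ _ _ _ _ _ _ _ _ _ X.m_s
  m_t := IsNC.map_comp_map_eq _ _ _ _ _ _ _ _ _ _ _ _ X.m_t

/-- The projections from the blowup form a discrete fibration. -/
def blowupFibration : GroupoidData.DiscreteFibration X.blowupData X.toGroupoidData where
  b0 := X.isNC0.β
  b1 := X.isNC1.β
  b2 := X.isNC2.β
  b1_s := rfl
  b1_t := rfl
  e_b1 := rfl
  i_b1 := rfl
  b2_p := rfl
  b2_q := rfl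
  m_b1 := rfl
  ext h1 h2 := X.isPullback_blowupS.hom_ext h2 h1

/-- If the endpoints of an ultrafilter of arrows converge, properness of `X` yields a limit of the
projected arrows. It lifts to an arrow `a` with the limiting source, and the ultrafilter converges
to `a` because the topology is pulled back along `s`. The target of `a` is right since limits are
unique. -/
lemma blowup_proper : IsProperMap fun a : X.isNC1.blowup => (X.blowupS a, X.blowupT a) := by
  refine isProperMap_iff_ultrafilter.2 ⟨(ManC.continuous X.blowupS).prodMk
    (ManC.continuous X.blowupT), ?_⟩
  rintro 𝒰 ⟨g, g'⟩ h
  rw [nhds_prod_eq, tendsto_prod_iff'] at h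
  have h1 : Tendsto (fun a : X.isNC1.blowup => (X.s (GermSpace.pt a), X.t (GermSpace.pt a))) 𝒰
      (𝓝 (GermSpace.pt g, GermSpace.pt g')) :=
    ((X.isNC0.continuous_pt.tendsto g).comp h.1).prodMk_nhds
      ((X.isNC0.continuous_pt.tendsto g').comp h.2)
  obtain ⟨x, hx, hle⟩ := (isProperMap_iff_ultrafilter.1 X.proper).2
    (𝒰 := 𝒰.map fun a : X.isNC1.blowup => GermSpace.pt a) h1
  obtain ⟨a, ha, hag⟩ := Blowup.exists_map_eq X.etale_s X.preimage_s x g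
    (congrArg Prod.fst hx).symm
  have h2 : (𝒰 : Filter X.isNC1.blowup) ≤ 𝓝 (a : X.isNC1.blowup) := by
    refine Blowup.tendsto_of_tendsto_map (F := fun a : X.isNC1.blowup => a) X.etale_s X.preimage_s
      (g := a) ?_ ?_
    · rw [ha]; exact hle
    · rw [hag]; exact h.1
  refine ⟨a, Prod.ext hag ?_, h2⟩
  exact tendsto_nhds_unique (((ManC.continuous X.blowupT).tendsto a).mono_left h2) h.2

/-- The blowup of a marked proper étale groupoid. -/
def blowup : PEG where
  toGroupoidData := X.blowupData
  isGroupoid := GroupoidData.DiscreteFibration.isGroupoid (X := X.toGpd) X.blowupFibration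
  etale_s := IsNC.isEtale_map _ _ X.isTransversal_s X.preimage_s X.etale_s
  etale_t := IsNC.isEtale_map _ _ X.isTransversal_t X.preimage_t X.etale_t
  etale_e := IsNC.isEtale_map _ _ X.isTransversal_e X.preimage_e X.etale_e
  etale_i := IsNC.isEtale_map _ _ X.isTransversal_i X.preimage_i X.etale_i
  etale_m := IsNC.isEtale_map _ _ X.isTransversal_m X.preimage_m X.etale_m
  proper := X.blowup_proper

/-! ### Blowups of functors, natural transformations and refinements -/

variable {X} {Y Z : MarkedPEG}

/-- The functors which are 1-cells of marked groupoids. -/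
abbrev IsMarked (F : X.toGpd ⟶ Y.toGpd) : Prop := IsMultiTransverse F.f0 Y.E ∧ F.f0 ⁻¹' Y.E = X.E

namespace IsMarked

variable {F G : X.toGpd ⟶ Y.toGpd}

lemma isTransversal0 (hF : IsMarked F) : IsTransversal F.f0 Y.E :=
  isTransversal_of_isMultiTransverse hF.1

lemma preimage1 (hF : IsMarked F) : F.f1 ⁻¹' Y.E1 = X.E1 := by
  change (F.f1 ≫ Y.s) ⁻¹' Y.E = X.E1
  rw [F.f1_s]
  change X.s ⁻¹' (F.f0 ⁻¹' Y.E) = _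
  rw [hF.2]

lemma isTransversal1 (hF : IsMarked F) : IsTransversal F.f1 Y.E1 := by
  refine IsTransversal.of_comp_etale Y.etale_s ?_
  rw [F.f1_s]
  exact hF.isTransversal0.etale_comp X.etale_s

lemma preimageα (hF : IsMarked F) (η : F ⟶ G) : (Gpd.Trans.α η) ⁻¹' Y.E1 = X.E := by
  change (Gpd.Trans.α η ≫ Y.s) ⁻¹' Y.E = X.E
  rw [Gpd.Trans.α_s η, hF.2]

lemma isTransversalα (hF : IsMarked F) (η : F ⟶ G) : IsTransversal (Gpd.Trans.α η) Y.E1 := by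
  refine IsTransversal.of_comp_etale Y.etale_s ?_
  rw [Gpd.Trans.α_s η]
  exact hF.isTransversal0

end IsMarked

/-- The blowup of the objects part of a functor. -/
def blowupF0 (F : X.toGpd ⟶ Y.toGpd) (hF : IsMarked F) : X.isNC0.blowup ⟶ Y.isNC0.blowup :=
  X.isNC0.map Y.isNC0 F.f0 hF.isTransversal0 hF.2

/-- The blowup of the arrows part of a functor. -/
def blowupF1 (F : X.toGpd ⟶ Y.toGpd) (hF : IsMarked F) : X.isNC1.blowup ⟶ Y.isNC1.blowup :=
  X.isNC1.map Y.isNC1 F.f1 hF.isTransversal1 hF.preimage1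

lemma blowupF1_s (F : X.toGpd ⟶ Y.toGpd) (hF : IsMarked F) :
    blowupF1 F hF ≫ Y.blowupS = X.blowupS ≫ blowupF0 F hF :=
  IsNC.map_comp_map_eq _ _ _ _ _ _ _ _ _ _ _ _ F.f1_s

lemma blowupF1_t (F : X.toGpd ⟶ Y.toGpd) (hF : IsMarked F) :
    blowupF1 F hF ≫ Y.blowupT = X.blowupT ≫ blowupF0 F hF :=
  IsNC.map_comp_map_eq _ _ _ _ _ _ _ _ _ _ _ _ F.f1_t

lemma blowupE_F1 (F : X.toGpd ⟶ Y.toGpd) (hF : IsMarked F) :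
    X.blowupE ≫ blowupF1 F hF = blowupF0 F hF ≫ Y.blowupE :=
  IsNC.map_comp_map_eq _ _ _ _ _ _ _ _ _ _ _ _ F.map_e

/-- The blowup of a functor. -/
def blowupFun (F : X.toGpd ⟶ Y.toGpd) (hF : IsMarked F) : X.blowup.toGpd ⟶ Y.blowup.toGpd :=
  show Gpd.Fun _ _ from
  { f0 := blowupF0 F hF
    f1 := blowupF1 F hF
    f1_s := blowupF1_s F hF
    f1_t := blowupF1_t F hF
    map_e := blowupE_F1 F hF
    map_mul := fun a b h => X.blowupFibration.mul_comp (X := X.toGpd) (X' := Y.toGpd)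
      Y.blowupFibration F _ _ (blowupF1_s F hF) (blowupF1_t F hF) rfl a b h }

/-- The blowup of the components of a natural transformation. -/
def blowupα {F G : X.toGpd ⟶ Y.toGpd} (hF : IsMarked F) (η : F ⟶ G) :
    X.isNC0.blowup ⟶ Y.isNC1.blowup :=
  X.isNC0.map Y.isNC1 (Gpd.Trans.α η) (hF.isTransversalα η) (hF.preimageα η)

lemma blowupα_s {F G : X.toGpd ⟶ Y.toGpd} (hF : IsMarked F) (η : F ⟶ G) :
    blowupα hF η ≫ Y.blowupS = blowupF0 F hF :=
  IsNC.map_comp_eq _ _ _ _ _ _ _ _ _ (Gpd.Trans.α_s η)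

lemma blowupα_t {F G : X.toGpd ⟶ Y.toGpd} (hF : IsMarked F) (hG : IsMarked G) (η : F ⟶ G) :
    blowupα hF η ≫ Y.blowupT = blowupF0 G hG :=
  IsNC.map_comp_eq _ _ _ _ _ _ _ _ _ (Gpd.Trans.α_t η)

/-- The blowup of a natural transformation. -/
def blowupTrans {F G : X.toGpd ⟶ Y.toGpd} (hF : IsMarked F) (hG : IsMarked G) (η : F ⟶ G) :
    blowupFun F hF ⟶ blowupFun G hG :=
  show Gpd.Trans _ _ from
  { α := blowupα hF η
    α_s := blowupα_s hF η
    α_t := blowupα_t hF hG η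
    naturality := fun a => X.blowupFibration.naturality (X := X.toGpd) (X' := Y.toGpd)
      Y.blowupFibration η _ _ _ _ _ (blowupF1_s F hF) (blowupα_s hF η) (blowupF1_t F hF)
      (blowupF1_s G hG) (blowupα_t hF hG η) rfl rfl rfl a }

/-- The projection from the blowup. -/
def blowupProj (X : MarkedPEG) : X.blowup.toGpd ⟶ X.toGpd :=
  show Gpd.Fun _ _ from
  { f0 := X.isNC0.β
    f1 := X.isNC1.β
    f1_s := rfl
    f1_t := rfl
    map_e := rfl
    map_mul := fun a b h => X.blowupFibration.mul_b1 (X := X.toGpd) a b h }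

/-- The blowup of a refinement is a refinement. -/
lemma isRefinement_blowupFun {F : X.toGpd ⟶ Y.toGpd} (hF : IsMarked F) (h : IsRefinement F) :
    IsRefinement (blowupFun F hF) where
  etale := IsNC.isEtale_map _ _ hF.isTransversal0 hF.2 h.etale
  fullyFaithful := by
    intro (g : Blowup X.X0 X.E) (g' : Blowup X.X0 X.E) (b : Blowup Y.X1 Y.E1) hs ht
    have hs' : Blowup.map Y.s Y.preimage_s b = Blowup.map F.f0 hF.2 g := hs
    have ht' : Blowup.map Y.t Y.preimage_t b = Blowup.map F.f0 hF.2 g' := ht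
    obtain ⟨a₀, ⟨h1, h2, h3⟩, huniq⟩ := h.fullyFaithful g.pt g'.pt b.pt
      (congrArg GermSpace.pt hs') (congrArg GermSpace.pt ht')
    -- The unique arrow downstairs is lifted with prescribed source `g`. Its image is `b` since both
    -- have the same projection and source.
    obtain ⟨a, ha, has⟩ := Blowup.exists_map_eq X.etale_s X.preimage_s a₀ g h1.symm
    have hab : Blowup.map F.f1 hF.preimage1 a = b := by
      refine Blowup.map_injOn_fibre Y.etale_s Y.preimage_s ?_ ?_
      · change F.f1 a.pt = b.pt
        rw [ha, h3]
      · rw [hs', ← has]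
        exact congrArg (fun k : X.isNC1.blowup ⟶ Y.isNC0.blowup => k a) (blowupF1_s F hF)
    refine ⟨a, ⟨has, ?_, hab⟩, ?_⟩
    -- The target of `a` and `g'` have the same base point and the same image under the blowup of
    -- the étale map `F.f0`, hence agree.
    · refine Blowup.map_injOn_fibre h.etale hF.2 ?_ ?_
      · change X.t a.pt = g'.pt
        rw [ha, h2]
      · rw [← ht', ← hab]
        exact congrArg (fun k : X.isNC1.blowup ⟶ Y.isNC0.blowup => k a)
          (Gpd.Fun.f1_t (blowupFun F hF)).symm
    · rintro (a' : Blowup X.X1 X.E1) ⟨hs1, ht1, hb1⟩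
      have hs1' : Blowup.map X.s X.preimage_s a' = g := hs1
      refine Blowup.map_injOn_fibre X.etale_s X.preimage_s ?_ (hs1'.trans has.symm)
      rw [ha]
      exact huniq _ ⟨congrArg GermSpace.pt hs1', congrArg GermSpace.pt ht1,
        congrArg GermSpace.pt hb1⟩
  essSurj := by
    intro (y : Blowup Y.X0 Y.E)
    obtain ⟨x₀, b₀, h1, h2⟩ := h.essSurj y.pt
    -- The arrow is lifted with prescribed target `y`; its source then lifts to a germ at `x₀`
    -- because `F.f0` is étale.
    obtain ⟨b, hb, hby⟩ := Blowup.exists_map_eq Y.etale_t Y.preimage_t b₀ y h2.symm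
    obtain ⟨x, -, hxb⟩ := Blowup.exists_map_eq h.etale hF.2 x₀ (Blowup.map Y.s Y.preimage_s b) (by
      change Y.s b.pt = _
      rw [hb]; exact h1)
    exact ⟨x, b, hxb.symm, hby⟩

end MarkedPEG

end HyperBlowup

/-! ### The strict 2-functor and its projection to the marked groupoids -/

namespace HyperBlowup

open Bicategory

namespace MarkedPEG

variable {X Y Z : MarkedPEG}

lemma blowupFun_id (h : IsMarked (𝟙 X.toGpd)) : blowupFun (𝟙 X.toGpd) h = 𝟙 X.blowup.toGpd :=
  Gpd.fun_ext (X.isNC0.map_id h.isTransversal0 h.2) (X.isNC1.map_id h.isTransversal1 h.preimage1)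

lemma blowupFun_comp {F : X.toGpd ⟶ Y.toGpd} {G : Y.toGpd ⟶ Z.toGpd} (hF : IsMarked F)
    (hG : IsMarked G) (h : IsMarked (F ≫ G)) :
    blowupFun (F ≫ G) h = blowupFun F hF ≫ blowupFun G hG :=
  Gpd.fun_ext
    (IsNC.map_comp_eq X.isNC0 Y.isNC0 Z.isNC0 hF.isTransversal0 hF.2 hG.isTransversal0 hG.2
      h.isTransversal0 h.2 rfl).symm
    (IsNC.map_comp_eq X.isNC1 Y.isNC1 Z.isNC1 hF.isTransversal1 hF.preimage1 hG.isTransversal1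
      hG.preimage1 h.isTransversal1 h.preimage1 rfl).symm

lemma blowupTrans_id {F : X.toGpd ⟶ Y.toGpd} (hF : IsMarked F) :
    blowupTrans hF hF (𝟙 F) = 𝟙 (blowupFun F hF) :=
  Gpd.trans_ext (IsNC.map_comp_eq X.isNC0 Y.isNC0 Y.isNC1 hF.isTransversal0 hF.2 Y.isTransversal_e
    Y.preimage_e (hF.isTransversalα (𝟙 F)) (hF.preimageα (𝟙 F)) rfl).symm

/-- The two families of arrows have the same projection and the same source, hence agree by the
discrete fibration property. -/
lemma blowupTrans_comp {F G H : X.toGpd ⟶ Y.toGpd} (hF : IsMarked F) (hG : IsMarked G)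
    (hH : IsMarked H) (η : F ⟶ G) (θ : G ⟶ H) :
    blowupTrans hF hH (η ≫ θ) = blowupTrans hF hG η ≫ blowupTrans hG hH θ := by
  have e := (blowupα_t hF hG η).trans (blowupα_s hG θ).symm
  exact Gpd.trans_ext (Y.blowupFibration.ext
    ((Gpd.comp_mul (X := Y.toGpd) X.isNC0.β (Gpd.Trans.α η) (Gpd.Trans.α θ)
      ((Gpd.Trans.α_t η).trans (Gpd.Trans.α_s θ).symm)).trans
      (Y.blowupFibration.mul_b1 (X := Y.toGpd) (blowupα hF η) (blowupα hG θ) e).symm)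
    ((blowupα_s hF (η ≫ θ)).trans ((blowupα_s hF η).symm.trans
      (GroupoidData.mul_s Y.blowupData (blowupα hF η) (blowupα hG θ) e).symm)))

lemma blowupα_whiskerL {F : X.toGpd ⟶ Y.toGpd} {G H : Y.toGpd ⟶ Z.toGpd} (hF : IsMarked F)
    (hG : IsMarked G) (h : IsMarked (F ≫ G)) (η : G ⟶ H) :
    blowupα h (F ◁ η) = blowupF0 F hF ≫ blowupα hG η :=
  (IsNC.map_comp_eq X.isNC0 Y.isNC0 Z.isNC1 hF.isTransversal0 hF.2 (hG.isTransversalα η)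
    (hG.preimageα η) (h.isTransversalα (F ◁ η)) (h.preimageα (F ◁ η)) rfl).symm

lemma blowupα_whiskerR {F G : X.toGpd ⟶ Y.toGpd} {H : Y.toGpd ⟶ Z.toGpd} (hF : IsMarked F)
    (hH : IsMarked H) (h : IsMarked (F ≫ H)) (η : F ⟶ G) :
    blowupα h (η ▷ H) = blowupα hF η ≫ blowupF1 H hH :=
  (IsNC.map_comp_eq X.isNC0 Y.isNC1 Z.isNC1 (hF.isTransversalα η) (hF.preimageα η)
    hH.isTransversal1 hH.preimage1 (h.isTransversalα (η ▷ H)) (h.preimageα (η ▷ H)) rfl).symm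

end MarkedPEG

namespace PEGps

variable {X Y : PEGps} {F G H : X ⟶ Y}

lemma trans_ext {η θ : F ⟶ G} (h : (trans η).α = (trans θ).α) : η = θ :=
  LocallyFull.hom₂_ext (Gpd.trans_ext h)

/-- Transport along equalities of 1-cells leaves components unchanged, so strict compatibility with
whiskering reduces to identities between blown up maps. -/
lemma eqToHom_comp_comp_eqToHom_α {K : X ⟶ Y} (h : F = G) (η : G ⟶ H) (h' : H = K) :
    (trans (eqToHom h ≫ η ≫ eqToHom h')).α = (trans η).α := by
  subst h
  subst h'
  rw [eqToHom_refl, eqToHom_refl, Category.comp_id, Category.id_comp]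

end PEGps

open MarkedPEG in
/-- The blowup of marked proper étale groupoids, on objects, 1-cells and 2-cells. -/
def blowupPrelax : PrelaxFunctor PEGplus PEGps where
  obj X := ⟨X.obj.blowup⟩
  map F := ⟨blowupFun (PEGplus.functor F) F.mem,
    IsNC.isPerfectlySimple_map _ _
      (IsMarked.isTransversal0 F.mem) (PEGplus.preimage_f0 F)⟩
  map₂ {_ _ F G} η := ⟨blowupTrans F.mem G.mem (PEGplus.trans η)⟩
  map₂_id F := LocallyFull.hom₂_ext (blowupTrans_id F.mem)
  map₂_comp {_ _ F G H} η θ := LocallyFull.hom₂_ext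
    (blowupTrans_comp F.mem G.mem H.mem (PEGplus.trans η) (PEGplus.trans θ))

namespace blowupPrelax

open MarkedPEG

lemma map_id (X : PEGplus) : blowupPrelax.map (𝟙 X) = 𝟙 (blowupPrelax.obj X) :=
  LocallyFull.hom_ext (blowupFun_id (LocallyFull.Hom.mem (𝟙 X)))

lemma map_comp {X Y Z : PEGplus} (F : X ⟶ Y) (G : Y ⟶ Z) :
    blowupPrelax.map (F ≫ G) = blowupPrelax.map F ≫ blowupPrelax.map G :=
  LocallyFull.hom_ext (blowupFun_comp F.mem G.mem (LocallyFull.Hom.mem (F ≫ G)))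

lemma map₂_eqToHom {X Y : PEGplus} {F G : X ⟶ Y} (h : F = G) :
    blowupPrelax.map₂ (eqToHom h) = eqToHom (congrArg blowupPrelax.map h) := by
  subst h
  exact blowupPrelax.map₂_id F

lemma map₂_whisker_left {X Y Z : PEGplus} (F : X ⟶ Y) {G H : Y ⟶ Z} (η : G ⟶ H) :
    blowupPrelax.map₂ (F ◁ η) = eqToHom (map_comp F G) ≫
      (blowupPrelax.map F ◁ blowupPrelax.map₂ η) ≫ eqToHom (map_comp F H).symm :=
  PEGps.trans_ext ((blowupα_whiskerL F.mem G.mem (LocallyFull.Hom.mem (F ≫ G))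
    (PEGplus.trans η)).trans (PEGps.eqToHom_comp_comp_eqToHom_α (map_comp F G)
      (blowupPrelax.map F ◁ blowupPrelax.map₂ η) (map_comp F H).symm).symm)

lemma map₂_whisker_right {X Y Z : PEGplus} {F G : X ⟶ Y} (η : F ⟶ G) (H : Y ⟶ Z) :
    blowupPrelax.map₂ (η ▷ H) = eqToHom (map_comp F H) ≫
      (blowupPrelax.map₂ η ▷ blowupPrelax.map H) ≫ eqToHom (map_comp G H).symm :=
  PEGps.trans_ext ((blowupα_whiskerR F.mem H.mem (LocallyFull.Hom.mem (F ≫ H))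
    (PEGplus.trans η)).trans (PEGps.eqToHom_comp_comp_eqToHom_α (map_comp F H)
      (blowupPrelax.map₂ η ▷ blowupPrelax.map H) (map_comp G H).symm).symm)

end blowupPrelax

/-- The blowup of marked proper étale groupoids, as a strict 2-functor. -/
def blowupFunctor : StrictPseudofunctor PEGplus PEGps :=
  StrictPseudofunctor.mk'
    { toPrelaxFunctor := blowupPrelax
      map_id := blowupPrelax.map_id
      map_comp := blowupPrelax.map_comp
      map₂_whisker_left := blowupPrelax.map₂_whisker_left
      map₂_whisker_right := blowupPrelax.map₂_whisker_right
      -- Both bicategories are strict: unitors and associators come from equalities of 1-cells, and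
      -- their preservation amounts to preservation of `eqToHom`.
      map₂_left_unitor := fun f => by
        rw [Strict.leftUnitor_eqToIso, Strict.leftUnitor_eqToIso, eqToIso.hom, eqToIso.hom,
          eqToHom_trans]
        exact blowupPrelax.map₂_eqToHom _
      map₂_right_unitor := fun f => by
        rw [Strict.rightUnitor_eqToIso, Strict.rightUnitor_eqToIso, eqToIso.hom, eqToIso.hom,
          eqToHom_trans]
        exact blowupPrelax.map₂_eqToHom _
      map₂_associator := fun f g h => by
        rw [Strict.associator_eqToIso, Strict.associator_eqToIso, eqToIso.hom, eqToIso.hom,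
          eqToHom_trans, eqToHom_trans]
        exact blowupPrelax.map₂_eqToHom _ }

/-- The projections from the blowups form a strict natural transformation. -/
def blowupFunctorProj :
    StrictTrans (blowupFunctor.comp perfectlySimpleCells.incl) markedCells.incl where
  app X := X.obj.blowupProj
  naturality _ := Gpd.fun_ext rfl rfl
  naturality₂ _ := Gpd.trans_ext (Eq.trans rfl
    ((Gpd.eqToHom_comp_α _ _).trans (Gpd.comp_eqToHom_α _ _)).symm)

/-- The strict 2-functor is given by blowing up all manifolds and maps. -/
def blowupFunctorExtends : ExtendsBlowup blowupFunctor where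
  φ₀ _ := Homeomorph.refl _
  φ₁ _ := Homeomorph.refl _
  φ₂ _ := Homeomorph.refl _
  rectilinear₀ X := X.obj.isNC0.isRectilinear
  rectilinear₁ X := X.obj.isNC1.isRectilinear
  rectilinear₂ X := X.obj.isNC2.isRectilinear
  map_s _ _ := rfl
  map_t _ _ := rfl
  map_e _ _ := rfl
  map_i _ _ := rfl
  map_p _ _ := rfl
  map_q _ _ := rfl
  map_m _ _ := rfl
  map_f0 _ _ := rfl
  map_f1 _ _ := rfl
  map_α _ _ := rfl

lemma isCanonical_blowupFunctorProj : IsCanonical blowupFunctorExtends blowupFunctorProj :=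
  fun _ => ⟨fun _ => rfl, fun _ => rfl⟩

lemma refinementsPs_blowupFunctor ⦃X Y : PEGplus⦄ (F : X ⟶ Y) (h : refinementsPlus F) :
    refinementsPs (blowupFunctor.map F) :=
  MarkedPEG.isRefinement_blowupFun F.mem h

end HyperBlowup

namespace HyperBlowup

/-! ### The universal property of the 2-localization -/

namespace TwoLoc

open Bicategory

local infixr:80 " ⊚ " => CategoryStruct.comp

universe w v u w' v' u'

variable {B : Type u} [Bicategory.{w, v} B] {C : Type u'} [Bicategory.{w', v'} C]
  {W : ∀ ⦃a b : B⦄, (a ⟶ b) → Prop}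

/-- A choice of adjoint inverses in `C` for the images under `G` of the 1-cells in `W`. -/
structure AdjointInverses (W : ∀ ⦃a b : B⦄, (a ⟶ b) → Prop) (G : Pseudofunctor B C) where
  inv : ∀ {a b : B} (f : a ⟶ b), W f → (G.obj b ⟶ G.obj a)
  unit : ∀ {a b : B} (w : a ⟶ b) (hw : W w), 𝟙 (G.obj a) ≅ G.map w ⊚ inv w hw
  counit : ∀ {a b : B} (w : a ⟶ b) (hw : W w), inv w hw ⊚ G.map w ≅ 𝟙 (G.obj b)
  left_triangle : ∀ {a b : B} (w : a ⟶ b) (hw : W w),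
    (unit w hw).hom ▷ G.map w ⊚ (α_ _ _ _).hom ⊚ G.map w ◁ (counit w hw).hom =
      (λ_ _).hom ⊚ (ρ_ _).inv
  right_triangle : ∀ {a b : B} (w : a ⟶ b) (hw : W w),
    inv w hw ◁ (unit w hw).hom ⊚ (α_ _ _ _).inv ⊚ (counit w hw).hom ▷ inv w hw =
      (ρ_ _).hom ⊚ (λ_ _).inv

namespace AdjointInverses

variable {G : Pseudofunctor B C} (I : AdjointInverses W G)

/-- The image of a formal composite. -/
def liftHom : ∀ {a b : B}, TwoLoc.Hom W a b → (G.obj a ⟶ G.obj b)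
  | _, _, .of f => G.map f
  | _, _, .inv w hw => I.inv w hw
  | _, _, .id a => 𝟙 (G.obj a)
  | _, _, .comp f g => liftHom f ⊚ liftHom g

/-- The image of a representative of a 2-cell. -/
def liftHom₂ : ∀ {a b : B} {f g : TwoLoc.Hom W a b}, TwoLoc.Hom₂ W f g →
    (I.liftHom f ⟶ I.liftHom g)
  | _, _, _, _, .of η => G.map₂ η
  | _, _, _, _, .mapId a => (G.mapId a).hom
  | _, _, _, _, .mapIdInv a => (G.mapId a).inv
  | _, _, _, _, .mapComp f g => (G.mapComp f g).hom
  | _, _, _, _, .mapCompInv f g => (G.mapComp f g).inv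
  | _, _, _, _, .unit w hw => (I.unit w hw).hom
  | _, _, _, _, .unitInv w hw => (I.unit w hw).inv
  | _, _, _, _, .counit w hw => (I.counit w hw).hom
  | _, _, _, _, .counitInv w hw => (I.counit w hw).inv
  | _, _, _, _, .id f => 𝟙 (I.liftHom f)
  | _, _, _, _, .vcomp η θ => liftHom₂ η ⊚ liftHom₂ θ
  | _, _, _, _, .whiskerLeft f η => I.liftHom f ◁ liftHom₂ η
  | _, _, _, _, .whiskerRight h η => liftHom₂ η ▷ I.liftHom h
  | _, _, _, _, .associator f g h => (α_ (I.liftHom f) (I.liftHom g) (I.liftHom h)).hom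
  | _, _, _, _, .associatorInv f g h => (α_ (I.liftHom f) (I.liftHom g) (I.liftHom h)).inv
  | _, _, _, _, .leftUnitor f => (λ_ (I.liftHom f)).hom
  | _, _, _, _, .leftUnitorInv f => (λ_ (I.liftHom f)).inv
  | _, _, _, _, .rightUnitor f => (ρ_ (I.liftHom f)).hom
  | _, _, _, _, .rightUnitorInv f => (ρ_ (I.liftHom f)).inv

/-- Every generating relation is a congruence, an axiom of the bicategory `C`, a law of the
pseudofunctor `G`, or a property of the chosen adjoint equivalences. -/
lemma liftHom₂_eq {a b : B} {f g : TwoLoc.Hom W a b} {η θ : TwoLoc.Hom₂ W f g}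
    (h : TwoLoc.Rel W η θ) : I.liftHom₂ η = I.liftHom₂ θ := by
  induction h
  case vcomp_right ih => exact congrArg (_ ⊚ ·) ih
  case vcomp_left ih => exact congrArg (· ⊚ _) ih
  case whiskerLeft ih => exact congrArg (_ ◁ ·) ih
  case whiskerRight ih => exact congrArg (· ▷ _) ih
  case id_comp => exact Category.id_comp _
  case comp_id => exact Category.comp_id _
  case assoc => exact Category.assoc _ _ _
  case whiskerLeft_id => exact Bicategory.whiskerLeft_id _ _
  case whiskerLeft_comp => exact Bicategory.whiskerLeft_comp _ _ _
  case id_whiskerLeft => exact Bicategory.id_whiskerLeft _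
  case comp_whiskerLeft => exact Bicategory.comp_whiskerLeft _ _ _
  case id_whiskerRight => exact Bicategory.id_whiskerRight _ _
  case comp_whiskerRight => exact Bicategory.comp_whiskerRight _ _ _
  case whiskerRight_id => exact Bicategory.whiskerRight_id _
  case whiskerRight_comp => exact Bicategory.whiskerRight_comp _ _ _
  case whisker_assoc => exact Bicategory.whisker_assoc _ _ _
  case whisker_exchange => exact Bicategory.whisker_exchange _ _
  case pentagon => exact Bicategory.pentagon _ _ _ _
  case triangle => exact Bicategory.triangle _ _
  case of_id => exact G.map₂_id _
  case of_comp => exact G.map₂_comp _ _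
  case of_whiskerLeft => exact G.map₂_whisker_left _ _
  case of_whiskerRight => exact G.map₂_whisker_right _ _
  case of_associator => exact G.map₂_associator _ _ _
  case of_leftUnitor => exact G.map₂_left_unitor _
  case of_rightUnitor => exact G.map₂_right_unitor _
  case left_triangle => exact I.left_triangle _ _
  case right_triangle => exact I.right_triangle _ _
  -- The remaining relations state that two structure 2-cells are mutually inverse.
  all_goals first | exact Iso.hom_inv_id _ | exact Iso.inv_hom_id _

/-- The extension of a pseudofunctor to the 2-localization. -/
def lift : Pseudofunctor (TwoLoc W) C where
  obj a := G.obj a.as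
  map f := I.liftHom f
  map₂ {a b f g} η := Quot.lift (r := @TwoLoc.Rel _ _ W a.as b.as f g) I.liftHom₂
    (fun _ _ h => I.liftHom₂_eq h) η
  map₂_id _ := rfl
  map₂_comp := by rintro a b f g h ⟨η⟩ ⟨θ⟩; rfl
  -- Formal identities and composites are sent to actual ones by definition, so all comparison
  -- 2-cells of the extension are identities.
  mapId a := Iso.refl (𝟙 (G.obj a.as))
  mapComp f g := Iso.refl (I.liftHom f ⊚ I.liftHom g)
  map₂_whisker_left := by
    rintro a b c f g h ⟨η⟩
    exact (Category.id_comp _).symm.trans (congrArg (_ ⊚ ·) (Category.comp_id _).symm)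
  map₂_whisker_right := by
    rintro a b c f g ⟨η⟩ h
    exact (Category.id_comp _).symm.trans (congrArg (_ ⊚ ·) (Category.comp_id _).symm)
  map₂_associator f g h := by
    change (α_ (I.liftHom f) (I.liftHom g) (I.liftHom h)).hom =
      𝟙 ((I.liftHom f ⊚ I.liftHom g) ⊚ I.liftHom h) ⊚
        𝟙 (I.liftHom f ⊚ I.liftHom g) ▷ I.liftHom h ⊚ (α_ _ _ _).hom ⊚
          I.liftHom f ◁ 𝟙 (I.liftHom g ⊚ I.liftHom h) ⊚ 𝟙 (I.liftHom f ⊚ I.liftHom g ⊚ I.liftHom h)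
    simp
  map₂_left_unitor f := by
    change (λ_ (I.liftHom f)).hom =
      𝟙 (𝟙 _ ⊚ I.liftHom f) ⊚ 𝟙 (𝟙 _) ▷ I.liftHom f ⊚ (λ_ (I.liftHom f)).hom
    simp
  map₂_right_unitor f := by
    change (ρ_ (I.liftHom f)).hom =
      𝟙 (I.liftHom f ⊚ 𝟙 _) ⊚ I.liftHom f ◁ 𝟙 (𝟙 _) ⊚ (ρ_ (I.liftHom f)).hom
    simp

/-- The composite has the same underlying data as `G`, and its comparison 2-cells are those of `G`
followed by identities. The extension therefore restricts to `G` on the nose. -/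
lemma L_comp_lift : (L W).comp I.lift = G := by
  -- A pseudofunctor is determined by its prelax part and its comparison 2-cells. Heterogeneous
  -- equality is needed because the two prelax parts are only assumed equal to a common `P`.
  have h : ∀ (P : PrelaxFunctor B C) (F F' : Pseudofunctor B C) (h : F.toPrelaxFunctor = P)
      (h' : F'.toPrelaxFunctor = P),
      (∀ a, (F.mapId a).hom ≍ (F'.mapId a).hom) →
      (∀ {a b c} (f : a ⟶ b) (g : b ⟶ c), (F.mapComp f g).hom ≍ (F'.mapComp f g).hom) →
      F = F' := by
    rintro P ⟨F, i, c, _, _, _, _, _⟩ ⟨F', i', c', _, _, _, _, _⟩ h h' hi hc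
    dsimp only at h h'
    subst h
    subst h'
    have h1 : @i = @i' := funext fun a => Iso.ext (eq_of_heq (hi a))
    have h2 : @c = @c' := by
      funext a b d f g
      exact Iso.ext (eq_of_heq (hc f g))
    subst h1
    subst h2
    rfl
  refine h G.toPrelaxFunctor _ _ rfl rfl (fun a => heq_of_eq ?_) fun f g => heq_of_eq ?_
  · exact Category.comp_id (G.mapId a).hom
  · exact Category.comp_id (G.mapComp f g).hom

end AdjointInverses

section Induced

universe w₂ v₂ u₂

variable {D : Type u₂} [Bicategory.{w₂, v₂} D] {W' : ∀ ⦃a b : D⦄, (a ⟶ b) → Prop}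

/-- The composite of a pseudofunctor which maps `W` to `W'` with the localization at `W'`. -/
def adjointInversesComp (F : Pseudofunctor B D) (hF : ∀ ⦃a b : B⦄ (f : a ⟶ b), W f → W' (F.map f)) :
    AdjointInverses W (F.comp (L W')) where
  inv w hw := Hom.inv (F.map w) (hF w hw)
  unit w hw :=
    { hom := Quot.mk _ (Hom₂.unit (F.map w) (hF w hw))
      inv := Quot.mk _ (Hom₂.unitInv (F.map w) (hF w hw))
      hom_inv_id := Quot.sound (Rel.unit_hom_inv _ _)
      inv_hom_id := Quot.sound (Rel.unit_inv_hom _ _) }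
  counit w hw :=
    { hom := Quot.mk _ (Hom₂.counit (F.map w) (hF w hw))
      inv := Quot.mk _ (Hom₂.counitInv (F.map w) (hF w hw))
      hom_inv_id := Quot.sound (Rel.counit_hom_inv _ _)
      inv_hom_id := Quot.sound (Rel.counit_inv_hom _ _) }
  left_triangle w hw := Quot.sound (Rel.left_triangle (F.map w) (hF w hw))
  right_triangle w hw := Quot.sound (Rel.right_triangle (F.map w) (hF w hw))

open scoped CategoryTheory.Pseudofunctor.StrongTrans in
/-- A pseudofunctor which maps `W` to `W'` induces a pseudofunctor of the localizations. -/
theorem exists_induced (F : Pseudofunctor B D)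
    (hF : ∀ ⦃a b : B⦄ (f : a ⟶ b), W f → W' (F.map f)) :
    ∃ F' : Pseudofunctor (TwoLoc W) (TwoLoc W'),
      Nonempty ((L W).comp F' ≌ F.comp (L W')) := by
  refine ⟨(adjointInversesComp F hF).lift, ?_⟩
  rw [AdjointInverses.L_comp_lift]
  exact ⟨Bicategory.Equivalence.id _⟩

end Induced

end TwoLoc

end HyperBlowup

end

open HyperBlowup in
open scoped CategoryTheory.Bicategory CategoryTheory.Pseudofunctor.StrongTrans in
theorem mainTheorem7 :
    ∃ (𝔹 : CategoryTheory.StrictPseudofunctor PEGplus PEGps) (φ : ExtendsBlowup 𝔹),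
      (∃ β : StrictTrans (𝔹.comp perfectlySimpleCells.incl) markedCells.incl, IsCanonical φ β) ∧
      (∀ ⦃X Y : PEGplus⦄ (F : X ⟶ Y), refinementsPlus F → refinementsPs (𝔹.map F)) ∧
      ∃ 𝔹' : CategoryTheory.Pseudofunctor OrbPlus OrbPs,
        Nonempty ((TwoLoc.L refinementsPlus).comp 𝔹' ≌
          𝔹.toPseudofunctor.comp (TwoLoc.L refinementsPs)) := by
  obtain ⟨𝔹', h⟩ := TwoLoc.exists_induced (W := refinementsPlus) (W' := refinementsPs)
    blowupFunctor.toPseudofunctor fun _ _ F hF => refinementsPs_blowupFunctor F hF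
  exact ⟨blowupFunctor, blowupFunctorExtends, ⟨blowupFunctorProj, isCanonical_blowupFunctorProj⟩,
    refinementsPs_blowupFunctor, 𝔹', h⟩
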